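/- **Setting.** Let $R\subset\mathbb R^3$ be a non-empty bounded convex open set with outer unit normal $n$, $S\subset\mathbb R^3$ the unit sphere, $D=S\times R$, $\partial D_-=\{(s,r)\in S\times\partial R: s\cdot n(r)<0\}$, $\mathbb V=L^2(D)$ with inner product $(\cdot,\cdot)$, and $\mathbb V^\pm\subset\mathbb V$ the subspaces of functions that are even/odd in $s$. Let $$\mathbb W=\{w\in L^2(D): s\cdot\nabla_r w\in L^2(D),\ w|_{\partial D_-}\in L^2(\partial D_-;|s\cdot n|)\}$$ with norm $\|w\|_{\mathbb W}^2=\|s\cdot\nabla_r w\|^2_{L^2(D)}+\|w\|^2_{L^2(D)}+\|w\|^2_{L^2(\partial D_-;|s\cdot n|)}$, and $\mathbb W^+=\mathbb W\cap\mathbb V^+$. Let $\sigma_a,\sigma_s\in L^\infty(R)$ with $\sigma_s\ge0$ and $\sigma_a\ge\gamma$ a.e. for some constant $\gamma>0$; put $\sigma_t=\sigma_a+\sigma_s$ and $c=\|\sigma_s/\sigma_t\|_{L^\infty(R)}$. Let $0\le g<1$ and $$k(t)=\frac1{4\pi}\frac{1-g^2}{(1-2gt+g^2)^{3/2}},\qquad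 (\mathcal Su)(s,r)=\int_S k(s\cdot s')u(s',r)\,ds'.$$ Let $\mathcal Mu=\sigma_tu$ and $\mathcal Ku=\sigma_s\mathcal Su$, acting on $\mathbb V$, on $\mathbb V^-$, and as operators $\mathbb W^+\to(\mathbb W^+)'$; let $\mathcal A:\mathbb W^+\to\mathbb V^-$, $\mathcal Aw=s\cdot\nabla_rw$, let $\mathcal A':\mathbb V^-\to(\mathbb W^+)'$, $\langle\mathcal A'v,w\rangle=(\mathcal Aw,v)$, and let $\mathcal R:\mathbb W^+\to(\mathbb W^+)'$, $\langle\mathcal Ru,w\rangle=\int_{S\times\partial R}|s\cdot n|\,u\,w$. Define $\mathbb W^+\to(\mathbb W^+)'$ by $$\mathcal E=\mathcal R+\mathcal A'(\mathcal M-\mathcal K)^{-1}\mathcal A+\mathcal M,\qquad \mathcal E_0=(1-cg)^{-1}\mathcal A'\mathcal M^{-1}\mathcal A+\mathcal M+\mathcal R,$$ where $(\mathcal M-\mathcal K)^{-1}$ and $\mathcal M^{-1}$ are inverses on $\mathbb V^-$. Write $\mathcal B=\mathcal E-\mathcal K$ and $\|w\|_{\mathcal B}=\langle\mathcal Bw,w\rangle^{1/2}$.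 **Lemma.** The operators $\mathcal M-\mathcal K$ and $\mathcal M$ are boundedly invertible on $\mathbb V^-$. Let $\mathcal Q=\mathcal E$ or $\mathcal Q=\mathcal E_0$. Then $\mathcal Q:\mathbb W^+\to(\mathbb W^+)'$ is symmetric, positive definite and boundedly invertible, so that $\mathcal P_1=\mathcal Q^{-1}$ is defined, and the following holds. 1. $\mathcal P_1$ is spectrally equivalent to $\mathcal E-\mathcal K$: for all $w\in\mathbb W^+$, $$(1-c)\langle\mathcal P_1^{-1}w,w\rangle\le\langle(\mathcal E-\mathcal K)w,w\rangle\le\langle\mathcal P_1^{-1}w,w\rangle .$$ 2. The number $\beta=1-c$ satisfies $0<\beta\le1$, and every $\lambda\in\mathbb R$ for which $(\mathcal E-\mathcal K)w=\lambda\mathcal P_1^{-1}w$ has a solution $0\ne w\in\mathbb W^+$ satisfies $\beta\le\lambda\le1$. 3. The corrected Richardson iteration contracts with rate $1-\beta=c$: for every $\ell\in(\mathbb W^+)'$ the equation $\mathcal Bu=\ell$ has a unique solution $u\in\mathbb W^+$, and for every closed subspace $\mathbb W_N^+\subset\mathbb W^+$ and every $u_n\in\mathbb W^+$ there is a unique $u_{n+1}\in\mathbb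 W^+$ of the form $$u_{n+1}=u_n-\mathcal P_1(\mathcal Bu_n-\ell)+d_n,\qquad d_n\in\mathbb W_N^+,\quad \langle\mathcal Bd_n,v\rangle=\langle(\mathcal B\mathcal P_1-\mathcal I)(\mathcal Bu_n-\ell),v\rangle\ \text{ for all } v\in\mathbb W_N^+ .$$ For every sequence $(u_n)_{n\ge0}$ generated in this way, $$\|u-u_{n+1}\|_{\mathcal B}\le c\,\|u-u_n\|_{\mathcal B}\quad\text{for all } n\ge0 .$$ -/

import Mathlib

open MeasureTheory Set TopologicalSpace
open scoped ENNReal MeasureTheory ContDiff Pointwise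

noncomputable section

namespace RTE

/-! ### Phase space -/

/-- The ambient space `ℝ³`. -/
abbrev E3 : Type := EuclideanSpace ℝ (Fin 3)

/-- The unit sphere `S` of directions. -/
abbrev S2 : Type := Metric.sphere (0 : E3) 1

/-- Surface measure `ds` on the unit sphere (total mass `4π`). -/
def sph : Measure S2 := (volume : Measure E3).toSphere

instance : IsFiniteMeasure sph := by unfold sph; infer_instance

/-- The map `(r, s) ↦ (r, -s)`. Points of phase space are written with the position first. -/
def reflect (x : E3 × S2) : E3 × S2 := (x.1, -x.2)

/-- The inclusion of `ℝ³ × S` into `ℝ³ × ℝ³`. -/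
def incl (x : E3 × S2) : E3 × E3 := (x.1, (x.2 : E3))

/-- The measure `dr ds` of the phase space `D = R × S`. -/
abbrev phaseMeasure (R : Opens E3) : Measure (E3 × S2) :=
  ((volume : Measure E3).restrict (R : Set E3)).prod sph

/-- `𝕍 = L²(D)`. -/
abbrev V (R : Opens E3) : Type := Lp ℝ 2 (phaseMeasure R)

theorem measurePreserving_neg_sph : MeasurePreserving (fun s : S2 => -s) sph sph := by
  have hm : Measurable (fun s : S2 => -s) := continuous_neg.measurable
  refine ⟨hm, ?_⟩
  ext A hA
  rw [Measure.map_apply hm hA, sph, Measure.toSphere_apply' _ (hm hA),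
    Measure.toSphere_apply' _ hA]
  congr 1
  have : Ioo (0 : ℝ) 1 • ((↑) '' ((fun s : S2 => -s) ⁻¹' A) : Set E3)
      = -(Ioo (0 : ℝ) 1 • ((↑) '' A : Set E3)) := by
    ext x
    simp only [Set.mem_smul, Set.mem_image, Set.mem_preimage, Set.mem_neg]
    constructor
    · rintro ⟨c, hc, _, ⟨s, hs, rfl⟩, rfl⟩
      exact ⟨c, hc, _, ⟨-s, hs, rfl⟩, by simp⟩
    · rintro ⟨c, hc, _, ⟨s, hs, rfl⟩, h⟩
      refine ⟨c, hc, _, ⟨-s, by simpa using hs, rfl⟩, ?_⟩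
      rw [← neg_neg x, ← h]; simp
  rw [this, Measure.measure_neg]

theorem measurable_reflect : Measurable reflect :=
  measurable_fst.prodMk (continuous_neg.measurable.comp measurable_snd)

theorem measurePreserving_reflect_prod (ν : Measure E3) :
    MeasurePreserving reflect (ν.prod sph) (ν.prod sph) := by
  refine ⟨measurable_reflect, ?_⟩
  ext A hA
  rw [Measure.map_apply measurable_reflect hA, Measure.prod_apply (measurable_reflect hA),
    Measure.prod_apply hA]
  refine lintegral_congr fun r => ?_
  exact measurePreserving_neg_sph.measure_preimage
    (measurable_prodMk_left hA).nullMeasurableSet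

theorem reflect_reflect (x : E3 × S2) : reflect (reflect x) = x := by
  simp [reflect]

/-- The operator `v(r, s) ↦ v(r, -s)` on `𝕍`. -/
def reflection (R : Opens E3) : V R →L[ℝ] V R :=
  (Lp.compMeasurePreservingₗᵢ ℝ reflect
    (measurePreserving_reflect_prod _)).toContinuousLinearMap

theorem coeFn_reflection (R : Opens E3) (v : V R) :
    reflection R v =ᵐ[phaseMeasure R] fun x => v (reflect x) :=
  Lp.coeFn_compMeasurePreserving v (measurePreserving_reflect_prod _)

/-- `𝕍⁺`: functions that are even in the direction variable. -/
def VEven (R : Opens E3) : Submodule ℝ (V R) where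
  carrier := {v | reflection R v = v}
  add_mem' {v w} hv hw := by
    rw [mem_ofPred_eq] at *
    rw [map_add, hv, hw]
  zero_mem' := map_zero _
  smul_mem' c v hv := by
    rw [mem_ofPred_eq] at *
    rw [map_smul, hv]

/-- `𝕍⁻`: functions that are odd in the direction variable. -/
def VOdd (R : Opens E3) : Submodule ℝ (V R) where
  carrier := {v | reflection R v = -v}
  add_mem' {v w} hv hw := by
    rw [mem_ofPred_eq] at *
    rw [map_add, hv, hw, neg_add]
  zero_mem' := by
    rw [mem_ofPred_eq, map_zero, neg_zero]
  smul_mem' c v hv := by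
    rw [mem_ofPred_eq] at *
    rw [map_smul, hv, smul_neg]

/-! ### Attenuation and scattering -/

/-- A coefficient `σ ∈ L^∞(R)` viewed as a function on `D` that does not depend on `s`. -/
def liftCoeff (R : Opens E3) (σ : Lp ℝ ∞ ((volume : Measure E3).restrict (R : Set E3))) :
    Lp ℝ ∞ (phaseMeasure R) :=
  MemLp.toLp (fun x : E3 × S2 => σ x.1) <| by
    refine memLp_top_of_bound (Lp.aestronglyMeasurable σ).comp_fst ‖σ‖ ?_
    refine Measure.quasiMeasurePreserving_fst.ae (p := fun r => ‖σ r‖ ≤ ‖σ‖) ?_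
    have h := ae_le_eLpNormEssSup (f := σ) (μ := (volume : Measure E3).restrict (R : Set E3))
    filter_upwards [h] with r hr
    rw [Lp.norm_def, eLpNorm_exponent_top, ← toReal_enorm]
    refine ENNReal.toReal_mono ?_ hr
    have := Lp.eLpNorm_ne_top σ
    rwa [eLpNorm_exponent_top] at this

theorem coeFn_liftCoeff (R : Opens E3)
    (σ : Lp ℝ ∞ ((volume : Measure E3).restrict (R : Set E3))) :
    liftCoeff R σ =ᵐ[phaseMeasure R] fun x => σ x.1 :=
  MemLp.coeFn_toLp _

/-- Multiplication by `σ ∈ L^∞(R)` on `𝕍`. -/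
def mulOp (R : Opens E3) (σ : Lp ℝ ∞ ((volume : Measure E3).restrict (R : Set E3))) :
    V R →L[ℝ] V R :=
  (ContinuousLinearMap.mul ℝ ℝ).holderL (phaseMeasure R) ∞ 2 2 (liftCoeff R σ)

theorem coeFn_mulOp (R : Opens E3) (σ : Lp ℝ ∞ ((volume : Measure E3).restrict (R : Set E3)))
    (v : V R) : mulOp R σ v =ᵐ[phaseMeasure R] fun x => σ x.1 * v x := by
  have h := (ContinuousLinearMap.mul ℝ ℝ).coeFn_holder (r := 2) (liftCoeff R σ) v
  filter_upwards [h, coeFn_liftCoeff R σ] with x hx hσ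
  rw [← hσ]
  exact hx

/-- The Henyey–Greenstein phase function with anisotropy factor `g`, as a function of the
cosine of the scattering angle. -/
def hgKernel (g t : ℝ) : ℝ :=
  1 / (4 * Real.pi) * ((1 - g ^ 2) / (1 - 2 * g * t + g ^ 2) ^ (3 / 2 : ℝ))

/-- `(Su)(r, s) = ∫_S k(s · s') u(r, s') ds'`. -/
def scatterFun (g : ℝ) (u : E3 × S2 → ℝ) (x : E3 × S2) : ℝ :=
  ∫ s' : S2, hgKernel g (inner ℝ (x.2 : E3) (s' : E3)) * u (x.1, s') ∂sph

theorem hgKernel_bound (g : ℝ) :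
    ∃ C, 0 ≤ C ∧ ∀ s s' : S2, |hgKernel g (inner ℝ (s : E3) (s' : E3))| ≤ C := by
  refine ⟨1 / (4 * Real.pi) * (|1 - g ^ 2| / (((1 - |g|) ^ 2) ^ (3 / 2 : ℝ))), by positivity, ?_⟩
  intro s s'
  have h1 : |inner ℝ (s : E3) (s' : E3)| ≤ 1 := by
    have := abs_real_inner_le_norm (s : E3) (s' : E3)
    simpa using this
  have h2 : (1 - |g|) ^ 2 ≤ 1 - 2 * g * inner ℝ (s : E3) (s' : E3) + g ^ 2 := by
    have : g * inner ℝ (s : E3) (s' : E3) ≤ |g| := by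
      calc _ ≤ |g * inner ℝ (s : E3) (s' : E3)| := le_abs_self _
        _ = |g| * |inner ℝ (s : E3) (s' : E3)| := abs_mul _ _
        _ ≤ |g| * 1 := by gcongr
        _ = |g| := mul_one _
    nlinarith [sq_abs g]
  have h3 : (0 : ℝ) ≤ (1 - |g|) ^ 2 := by positivity
  rw [hgKernel, abs_mul, abs_of_pos (by positivity : (0 : ℝ) < 1 / (4 * Real.pi)), abs_div,
    abs_of_nonneg (Real.rpow_nonneg (h3.trans h2) _)]
  refine mul_le_mul_of_nonneg_left ?_ (by positivity)
  rcases eq_or_lt_of_le h3 with h | h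
  · have hg : 1 - |g| = 0 := by
      have := h.symm
      exact pow_eq_zero_iff (two_ne_zero) |>.1 this
    have : 1 - g ^ 2 = 0 := by nlinarith [sq_abs g]
    simp [this]
  · gcongr

theorem measurable_kernel (g : ℝ) :
    Measurable fun p : S2 × S2 => hgKernel g (inner ℝ (p.1 : E3) (p.2 : E3)) := by
  have : Measurable fun p : S2 × S2 => inner ℝ (p.1 : E3) (p.2 : E3) :=
    (by fun_prop : Continuous fun p : S2 × S2 => inner ℝ (p.1 : E3) (p.2 : E3)).measurable
  unfold hgKernel
  fun_prop


theorem stronglyMeasurable_scatterFun (g : ℝ) {u : E3 × S2 → ℝ} (hu : Measurable u) :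
    StronglyMeasurable (scatterFun g u) := by
  have h1 : Measurable fun p : (E3 × S2) × S2 => hgKernel g (inner ℝ (p.1.2 : E3) (p.2 : E3)) :=
    Measurable.comp (g := fun p : S2 × S2 => hgKernel g (inner ℝ (p.1 : E3) (p.2 : E3)))
      (f := fun p : (E3 × S2) × S2 => (p.1.2, p.2)) (measurable_kernel g)
      ((measurable_snd.comp measurable_fst).prodMk measurable_snd)
  have h2 : Measurable fun p : (E3 × S2) × S2 => u (p.1.1, p.2) :=
    hu.comp ((measurable_fst.comp measurable_fst).prodMk measurable_snd)
  have h3 : StronglyMeasurable fun p : (E3 × S2) × S2 =>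
      hgKernel g (inner ℝ (p.1.2 : E3) (p.2 : E3)) * u (p.1.1, p.2) :=
    (h1.mul h2).stronglyMeasurable
  exact h3.integral_prod_right'

theorem sq_integral_abs_le {f : S2 → ℝ} (hf : MemLp f 2 sph) :
    (∫ s, |f s| ∂sph) ^ 2 ≤ sph.real univ * ∫ s, f s ^ 2 ∂sph := by
  have h1 : Integrable (fun s => |f s|) sph := (hf.integrable (by norm_num)).abs
  have h2 : Integrable (fun s => f s ^ 2) sph := hf.integrable_sq
  have key : ∀ t : ℝ, 0 ≤ sph.real univ * (t * t) + (-2 * ∫ s, |f s| ∂sph) * t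
      + ∫ s, f s ^ 2 ∂sph := by
    intro t
    have h : 0 ≤ ∫ s, (|f s| - t) ^ 2 ∂sph := integral_nonneg fun s => sq_nonneg _
    have e : (fun s => (|f s| - t) ^ 2) = fun s => (f s ^ 2 - 2 * t * |f s|) + t ^ 2 := by
      funext s
      rw [← sq_abs (f s)]
      ring
    have h3 : Integrable (fun s => 2 * t * |f s|) sph := h1.const_mul _
    have h4 : Integrable (fun s => f s ^ 2 - 2 * t * |f s|) sph := h2.sub h3
    rw [e, integral_add h4 (integrable_const _), integral_sub h2 h3, integral_const_mul, integral_const, smul_eq_mul] at h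
    linarith
  have := discrim_le_zero key
  rw [discrim] at this
  linarith

theorem scatterFun_sq_le (g : ℝ) {C : ℝ}
    (hC : ∀ s s' : S2, |hgKernel g (inner ℝ (s : E3) (s' : E3))| ≤ C) {u : E3 × S2 → ℝ}
    (r : E3) (hu : MemLp (fun s => u (r, s)) 2 sph) (s : S2) :
    scatterFun g u (r, s) ^ 2 ≤ C ^ 2 * (sph.real univ * ∫ s', u (r, s') ^ 2 ∂sph) := by
  have h1 : Integrable (fun s => |u (r, s)|) sph := (hu.integrable (by norm_num)).abs
  have h2 : |scatterFun g u (r, s)| ≤ C * ∫ s', |u (r, s')| ∂sph := by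
    rw [← integral_const_mul, ← Real.norm_eq_abs]
    refine norm_integral_le_of_norm_le (h1.const_mul C) (Filter.Eventually.of_forall fun s' => ?_)
    rw [norm_mul, Real.norm_eq_abs, Real.norm_eq_abs]
    exact mul_le_mul_of_nonneg_right (hC _ _) (abs_nonneg _)
  rw [← sq_abs]
  calc _ ≤ (C * ∫ s', |u (r, s')| ∂sph) ^ 2 := by gcongr
    _ = C ^ 2 * (∫ s', |u (r, s')| ∂sph) ^ 2 := mul_pow _ _ _
    _ ≤ _ := by gcongr; exact sq_integral_abs_le hu

theorem ae_memLp_slice (R : Opens E3) (u : V R) :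
    ∀ᵐ r ∂(volume : Measure E3).restrict (R : Set E3), MemLp (fun s => u (r, s)) 2 sph := by
  have h := (Lp.memLp u).integrable_sq.prod_right_ae
  filter_upwards [h] with r hr
  exact (memLp_two_iff_integrable_sq ((Lp.stronglyMeasurable u).measurable.comp
    measurable_prodMk_left).aestronglyMeasurable).2 hr

theorem memLp_scatterFun (R : Opens E3) (g : ℝ) (u : V R) :
    MemLp (scatterFun g u) 2 (phaseMeasure R) ∧
      ∀ C, (∀ s s' : S2, |hgKernel g (inner ℝ (s : E3) (s' : E3))| ≤ C) →
        ∫ x, scatterFun g u x ^ 2 ∂phaseMeasure R ≤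
          C ^ 2 * (sph.real univ * (sph.real univ * ‖u‖ ^ 2)) := by
  have hm := (stronglyMeasurable_scatterFun g (Lp.stronglyMeasurable u).measurable)
  have hu2 := (Lp.memLp u).integrable_sq
  have hq : Integrable (fun r => ∫ s', u (r, s') ^ 2 ∂sph)
      ((volume : Measure E3).restrict (R : Set E3)) := hu2.integral_prod_left
  have hb : ∀ C, (∀ s s' : S2, |hgKernel g (inner ℝ (s : E3) (s' : E3))| ≤ C) →
      ∀ᵐ x ∂phaseMeasure R, scatterFun g u x ^ 2 ≤
        C ^ 2 * (sph.real univ * ∫ s', u (x.1, s') ^ 2 ∂sph) := by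
    intro C hC
    have := Measure.quasiMeasurePreserving_fst (ν := sph) |>.ae (ae_memLp_slice R u)
    filter_upwards [this] with x hx
    exact scatterFun_sq_le g hC x.1 hx x.2
  have hi : ∀ C : ℝ, Integrable (fun x : E3 × S2 =>
      C ^ 2 * (sph.real univ * ∫ s', u (x.1, s') ^ 2 ∂sph)) (phaseMeasure R) := fun C =>
    ((hq.comp_fst sph).const_mul _).const_mul _
  have hint : Integrable (fun x => scatterFun g u x ^ 2) (phaseMeasure R) := by
    obtain ⟨C, -, hC⟩ := hgKernel_bound g
    refine (hi C).mono' (hm.pow 2).aestronglyMeasurable ?_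
    filter_upwards [hb C hC] with x hx
    rwa [Real.norm_eq_abs, abs_of_nonneg (sq_nonneg _)]
  refine ⟨(memLp_two_iff_integrable_sq hm.aestronglyMeasurable).2 hint, fun C hC => ?_⟩
  refine (integral_mono_ae hint (hi C) (hb C hC)).trans_eq ?_
  rw [integral_const_mul, integral_const_mul, 
    integral_fun_fst (fun r => ∫ s', u (r, s') ^ 2 ∂sph), smul_eq_mul,
    integral_integral (f := fun r s => u (r, s) ^ 2) hu2, ← real_inner_self_eq_norm_sq,
    L2.inner_def]
  simp [sq]

theorem scatterFun_add_ae (R : Opens E3) (g : ℝ) (u v : V R) :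
    scatterFun g ↑↑(u + v) =ᵐ[phaseMeasure R] scatterFun g u + scatterFun g v := by
  obtain ⟨C, hC0, hC⟩ := hgKernel_bound g
  have hi : ∀ u : V R, ∀ r, MemLp (fun s => u (r, s)) 2 sph → ∀ s : S2,
      Integrable (fun s' : S2 => hgKernel g (inner ℝ (s : E3) (s' : E3)) * u (r, s')) sph := by
    intro u r hr s
    refine (hr.integrable (by norm_num)).bdd_mul (c := C) ?_ ?_
    · exact ((measurable_kernel g).comp measurable_prodMk_left).aestronglyMeasurable
    · exact Filter.Eventually.of_forall fun s' => hC s s'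
  have h1 : ∀ᵐ r ∂(volume : Measure E3).restrict (R : Set E3), ∀ᵐ s ∂sph,
      (u + v : V R) (r, s) = u (r, s) + v (r, s) := Measure.ae_ae_of_ae_prod (Lp.coeFn_add u v)
  have h2 : ∀ᵐ r ∂(volume : Measure E3).restrict (R : Set E3), ∀ s,
      scatterFun g ↑↑(u + v) (r, s) = scatterFun g u (r, s) + scatterFun g v (r, s) := by
    filter_upwards [h1, ae_memLp_slice R u, ae_memLp_slice R v] with r hr hu hv s
    unfold scatterFun
    rw [← integral_add (hi u r hu s) (hi v r hv s)]
    refine integral_congr_ae ?_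
    filter_upwards [hr] with s' hs'
    simp only [hs', mul_add]
  have h3 := Measure.quasiMeasurePreserving_fst (ν := sph) |>.ae h2
  filter_upwards [h3] with x hx
  exact hx x.2

theorem scatterFun_smul_ae (R : Opens E3) (g c : ℝ) (u : V R) :
    scatterFun g ↑↑(c • u) =ᵐ[phaseMeasure R] c • scatterFun g u := by
  have h1 : ∀ᵐ r ∂(volume : Measure E3).restrict (R : Set E3), ∀ᵐ s ∂sph,
      (c • u : V R) (r, s) = c * u (r, s) := Measure.ae_ae_of_ae_prod (Lp.coeFn_smul c u)
  have h2 : ∀ᵐ r ∂(volume : Measure E3).restrict (R : Set E3), ∀ s,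
      scatterFun g ↑↑(c • u) (r, s) = c * scatterFun g u (r, s) := by
    filter_upwards [h1] with r hr s
    unfold scatterFun
    rw [← integral_const_mul]
    refine integral_congr_ae ?_
    filter_upwards [hr] with s' hs'
    simp only [hs']
    ring
  have h3 := Measure.quasiMeasurePreserving_fst (ν := sph) |>.ae h2
  filter_upwards [h3] with x hx
  exact hx x.2

/-- The scattering operator `S`, acting in the direction variable, as an operator on `𝕍`. -/
def scatter (R : Opens E3) (g : ℝ) : V R →L[ℝ] V R :=
  LinearMap.mkContinuousOfExistsBound
    { toFun := fun u => (memLp_scatterFun R g u).1.toLp _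
      map_add' := fun u v => by
        rw [← MemLp.toLp_add]
        exact MemLp.toLp_congr _ _ (scatterFun_add_ae R g u v)
      map_smul' := fun c u => by
        rw [RingHom.id_apply, ← MemLp.toLp_const_smul]
        exact MemLp.toLp_congr _ _ (scatterFun_smul_ae R g c u) } <| by
    obtain ⟨C, hC0, hC⟩ := hgKernel_bound g
    refine ⟨C * sph.real univ, fun u => ?_⟩
    refine le_of_sq_le_sq ?_ (by positivity)
    have h := (memLp_scatterFun R g u).2 C hC
    rw [← real_inner_self_eq_norm_sq, L2.inner_def]
    refine le_trans (le_of_eq ?_) (h.trans_eq (by ring))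
    refine integral_congr_ae ?_
    filter_upwards [MemLp.coeFn_toLp (memLp_scatterFun R g u).1] with x hx
    simp only [LinearMap.coe_mk, AddHom.coe_mk, hx]
    simp [sq]

theorem coeFn_scatter (R : Opens E3) (g : ℝ) (u : V R) :
    scatter R g u =ᵐ[phaseMeasure R] scatterFun g u :=
  MemLp.coeFn_toLp (memLp_scatterFun R g u).1

theorem mulOp_reflection (R : Opens E3)
    (σ : Lp ℝ ∞ ((volume : Measure E3).restrict (R : Set E3))) (v : V R) :
    mulOp R σ (reflection R v) = reflection R (mulOp R σ v) := by
  refine Lp.ext ?_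
  have h := (measurePreserving_reflect_prod
    ((volume : Measure E3).restrict (R : Set E3))).quasiMeasurePreserving.ae (coeFn_mulOp R σ v)
  filter_upwards [coeFn_mulOp R σ (reflection R v), coeFn_reflection R v,
    coeFn_reflection R (mulOp R σ v), h] with x h1 h2 h3 h4
  rw [h1, h2, h3, h4, reflect]

theorem scatter_reflection (R : Opens E3) (g : ℝ) (v : V R) :
    scatter R g (reflection R v) = reflection R (scatter R g v) := by
  have h1 : ∀ᵐ r ∂(volume : Measure E3).restrict (R : Set E3), ∀ᵐ s ∂sph,
      reflection R v (r, s) = v (reflect (r, s)) :=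
    Measure.ae_ae_of_ae_prod (coeFn_reflection R v)
  have h2 : ∀ᵐ r ∂(volume : Measure E3).restrict (R : Set E3), ∀ s,
      scatterFun g (reflection R v) (r, s) = scatterFun g v (reflect (r, s)) := by
    filter_upwards [h1] with r hr s
    have e : scatterFun g v (reflect (r, s)) = ∫ s' : S2,
        hgKernel g (inner ℝ (-s : E3) (-s' : E3)) * v (r, -s') ∂sph :=
      (measurePreserving_neg_sph.integral_comp (MeasurableEquiv.neg S2).measurableEmbedding
        fun s' : S2 => hgKernel g (inner ℝ (-s : E3) (s' : E3)) * v (r, s')).symm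
    rw [e, scatterFun]
    refine integral_congr_ae ?_
    filter_upwards [hr] with s' hs'
    simp only [hs', reflect, inner_neg_neg]
  have h3 := Measure.quasiMeasurePreserving_fst (ν := sph) |>.ae h2
  have h4 := (measurePreserving_reflect_prod
    ((volume : Measure E3).restrict (R : Set E3))).quasiMeasurePreserving.ae (coeFn_scatter R g v)
  refine Lp.ext ?_
  filter_upwards [h3, h4, coeFn_scatter R g (reflection R v),
    coeFn_reflection R (scatter R g v)] with x h3 h4 h5 h6
  rw [h5, h6, h4]
  exact h3 x.2

/-! ### The boundary and the trace -/

/-- `ν` is a unit vector normal to a supporting plane of the convex set `R` at `r`, pointing out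
of `R`. -/
def IsUnitOuterNormal (R : Set E3) (r ν : E3) : Prop :=
  ‖ν‖ = 1 ∧ ∀ y ∈ R, inner ℝ (y - r) ν ≤ 0

open Classical in
/-- The outer unit normal field of a convex set. It is the unique unit outer normal at every
regular boundary point, that is, at almost every boundary point, and `0` at the others. -/
def outerNormal (R : Set E3) (r : E3) : E3 :=
  if h : ∃! ν, IsUnitOuterNormal R r ν then h.choose else 0

/-- `s · n(r)`. -/
def normalComp (R : Opens E3) (x : E3 × S2) : ℝ :=
  inner ℝ (x.2 : E3) (outerNormal R x.1)

/-- Surface measure on `∂R × S`. -/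
abbrev bdryMeasure (R : Opens E3) : Measure (E3 × S2) :=
  ((μHE[2] : Measure E3).restrict (frontier (R : Set E3))).prod sph

/-- The measure `|s · n| dr ds` on `∂R × S`. -/
def fluxMeasure (R : Opens E3) : Measure (E3 × S2) :=
  (bdryMeasure R).withDensity fun x => ENNReal.ofReal |normalComp R x|

/-- The inflow boundary is `∂D₋ = {(r, s) ∈ ∂R × S : s · n(r) < 0}`; the constraint `r ∈ ∂R` is
carried by the boundary measures. -/
def inflow (R : Opens E3) : Set (E3 × S2) := {x | normalComp R x < 0}

theorem isClosed_setOf_normal (R : Set E3) :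
    IsClosed {p : E3 × E3 | IsUnitOuterNormal R p.1 p.2} := by
  have : {p : E3 × E3 | IsUnitOuterNormal R p.1 p.2} =
      {p | ‖p.2‖ = 1} ∩ ⋂ y ∈ R, {p | inner ℝ (y - p.1) p.2 ≤ 0} := by
    ext p
    simp [IsUnitOuterNormal]
  rw [this]
  refine (isClosed_eq (by fun_prop) (by fun_prop)).inter ?_
  exact isClosed_biInter fun y _ => isClosed_le (by fun_prop) (by fun_prop)

theorem measurable_outerNormal (R : Set E3) : Measurable (outerNormal R) := by
  have hP : ∀ C : Set E3, IsClosed C →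
      IsClosed {r | ∃ s : S2, (s : E3) ∈ C ∧ IsUnitOuterNormal R r s} := by
    intro C hC
    have h : IsClosed {p : E3 × S2 | (p.2 : E3) ∈ C ∧ IsUnitOuterNormal R p.1 p.2} :=
      (hC.preimage (by fun_prop : Continuous fun p : E3 × S2 => (p.2 : E3))).inter
        ((isClosed_setOf_normal R).preimage
          (by fun_prop : Continuous fun p : E3 × S2 => (p.1, (p.2 : E3))))
    convert! isClosedMap_fst_of_compactSpace _ h using 1
    ext r
    simp
  have hQ : ∀ k : ℕ, IsClosed {r | ∃ q : S2 × S2, 1 / ((k : ℝ) + 1) ≤ dist q.1 q.2 ∧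
      IsUnitOuterNormal R r q.1 ∧ IsUnitOuterNormal R r q.2} := by
    intro k
    have h : IsClosed {p : E3 × (S2 × S2) | 1 / ((k : ℝ) + 1) ≤ dist p.2.1 p.2.2 ∧
        IsUnitOuterNormal R p.1 p.2.1 ∧ IsUnitOuterNormal R p.1 p.2.2} :=
      (isClosed_le (f := fun _ : E3 × (S2 × S2) => 1 / ((k : ℝ) + 1))
        (g := fun p : E3 × (S2 × S2) => dist p.2.1 p.2.2) continuous_const (by fun_prop)).inter
        (((isClosed_setOf_normal R).preimage
          (by fun_prop : Continuous fun p : E3 × (S2 × S2) => (p.1, (p.2.1 : E3)))).inter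
        ((isClosed_setOf_normal R).preimage
          (by fun_prop : Continuous fun p : E3 × (S2 × S2) => (p.1, (p.2.2 : E3)))))
    convert! isClosedMap_fst_of_compactSpace _ h using 1
    ext r
    simp
  have hU : MeasurableSet {r | ∃! ν, IsUnitOuterNormal R r ν} := by
    have e : {r | ∃! ν, IsUnitOuterNormal R r ν} =
        {r | ∃ s : S2, (s : E3) ∈ univ ∧ IsUnitOuterNormal R r s} \
          ⋃ k : ℕ, {r | ∃ q : S2 × S2, 1 / ((k : ℝ) + 1) ≤ dist q.1 q.2 ∧
            IsUnitOuterNormal R r q.1 ∧ IsUnitOuterNormal R r q.2} := by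
      ext r
      simp only [mem_sdiff, mem_ofPred_eq, mem_iUnion]
      constructor
      · rintro ⟨ν, hν, hu⟩
        refine ⟨⟨⟨ν, by simpa using hν.1⟩, mem_univ _, hν⟩, ?_⟩
        rintro ⟨k, q, hk, h1, h2⟩
        have : q.1 = q.2 := Subtype.ext ((hu _ h1).trans (hu _ h2).symm)
        rw [this, dist_self] at hk
        have : (0 : ℝ) < 1 / ((k : ℝ) + 1) := by positivity
        linarith
      · rintro ⟨⟨s, -, hs⟩, hn⟩
        refine ⟨s, hs, fun ν hν => ?_⟩
        by_contra hne
        refine hn ?_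
        have hpos : 0 < dist (⟨ν, by simpa using hν.1⟩ : S2) s :=
          dist_pos.2 fun h => hne (congrArg Subtype.val h)
        obtain ⟨k, hk⟩ := exists_nat_one_div_lt hpos
        exact ⟨k, (⟨ν, by simpa using hν.1⟩, s), hk.le, hν, hs⟩
    rw [e]
    exact (hP univ isClosed_univ).measurableSet.diff
      (MeasurableSet.iUnion fun k => (hQ k).measurableSet)
  refine measurable_of_isClosed fun C hC => ?_
  have e : outerNormal R ⁻¹' C =
      ({r | ∃! ν, IsUnitOuterNormal R r ν} ∩
        {r | ∃ s : S2, (s : E3) ∈ C ∧ IsUnitOuterNormal R r s}) ∪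
      ({r | ∃! ν, IsUnitOuterNormal R r ν}ᶜ ∩ {_r | (0 : E3) ∈ C}) := by
    ext r
    by_cases h : ∃! ν, IsUnitOuterNormal R r ν
    · have hn := h.choose_spec
      simp only [mem_preimage, outerNormal, h, dif_pos, mem_union, mem_inter_iff, mem_ofPred_eq,
        mem_compl_iff, true_and, not_true_eq_false, false_and, or_false]
      constructor
      · intro hc
        exact ⟨⟨h.choose, by simpa using hn.1.1⟩, hc, hn.1⟩
      · rintro ⟨s, hs, hs'⟩
        rwa [← hn.2 _ hs']
    · simp [outerNormal, h]
  rw [e]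
  exact (hU.inter (hP C hC).measurableSet).union (hU.compl.inter (MeasurableSet.const _))

theorem measurable_normalComp (R : Opens E3) : Measurable (normalComp R) :=
  (measurable_subtype_coe.comp measurable_snd).inner
    ((measurable_outerNormal R).comp measurable_fst)

theorem normalComp_reflect (R : Opens E3) (x : E3 × S2) :
    normalComp R (reflect x) = -normalComp R x := by
  simp [normalComp, reflect]

theorem measurePreserving_reflect_flux (R : Opens E3) :
    MeasurePreserving reflect (fluxMeasure R) (fluxMeasure R) := by
  refine ⟨measurable_reflect, ?_⟩
  ext A hA
  rw [Measure.map_apply measurable_reflect hA, fluxMeasure,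
    withDensity_apply _ (measurable_reflect hA), withDensity_apply _ hA]
  have h := (measurePreserving_reflect_prod
    ((μHE[2] : Measure E3).restrict (frontier (R : Set E3)))).setLIntegral_comp_preimage hA
    (f := fun x => ENNReal.ofReal |normalComp R x|)
    ((measurable_normalComp R).abs.ennreal_ofReal)
  simpa only [normalComp_reflect, abs_neg] using h

/-! ### The streaming operator and the space `𝕎⁺` -/

/-- `(s · ∇_r φ)(r, s)` for a smooth function `φ` of `(r, s) ∈ ℝ³ × ℝ³`. -/
def streamDeriv (φ : E3 × E3 → ℝ) (x : E3 × S2) : ℝ :=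
  fderiv ℝ φ (incl x) ((x.2 : E3), 0)

/-- `a ∈ 𝕍` is the weak derivative `s · ∇_r w` on `D = R × S`. -/
def IsWeakStream (R : Opens E3) (w a : V R) : Prop :=
  ∀ φ : E3 × E3 → ℝ, ContDiff ℝ ∞ φ → HasCompactSupport φ →
    tsupport φ ⊆ (R : Set E3) ×ˢ (univ : Set E3) →
    ∫ x, w x * streamDeriv φ x ∂phaseMeasure R = -∫ x, a x * φ (incl x) ∂phaseMeasure R

/-- The function `t` on `∂R × S` is the trace of `w`, where `a = s · ∇_r w`, in the sense of
Green's formula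
`∫_D (s · ∇_r w) φ + w (s · ∇_r φ) = ∫_{S × ∂R} t φ (s · n)`. -/
def IsBdryTrace (R : Opens E3) (w a : V R) (t : E3 × S2 → ℝ) : Prop :=
  Integrable t (fluxMeasure R) ∧
    ∀ φ : E3 × E3 → ℝ, ContDiff ℝ ∞ φ → HasCompactSupport φ →
      ∫ x, (a x * φ (incl x) + w x * streamDeriv φ x) ∂phaseMeasure R =
        ∫ x, t x * φ (incl x) * normalComp R x ∂bdryMeasure R

theorem isClosedEmbedding_incl : Topology.IsClosedEmbedding incl :=
  Topology.IsClosedEmbedding.id.prodMap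
    (Metric.isClosed_sphere (x := (0 : E3)) (ε := 1)).isClosedEmbedding_subtypeVal

theorem memLp_test (R : Opens E3) {φ : E3 × E3 → ℝ} (hφ : ContDiff ℝ ∞ φ)
    (hc : HasCompactSupport φ) : MemLp (fun x => φ (incl x)) 2 (phaseMeasure R) :=
  (hφ.continuous.comp isClosedEmbedding_incl.continuous).memLp_of_hasCompactSupport
    (hc.comp_isClosedEmbedding isClosedEmbedding_incl)

theorem memLp_streamDeriv (R : Opens E3) {φ : E3 × E3 → ℝ} (hφ : ContDiff ℝ ∞ φ)
    (hc : HasCompactSupport φ) : MemLp (streamDeriv φ) 2 (phaseMeasure R) := by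
  have h1 : Continuous (fderiv ℝ φ) := hφ.continuous_fderiv (by simp)
  have h2 : Continuous (streamDeriv φ) :=
    (h1.comp isClosedEmbedding_incl.continuous).clm_apply (by fun_prop)
  refine h2.memLp_of_hasCompactSupport ?_
  refine ((hc.fderiv ℝ).comp_isClosedEmbedding isClosedEmbedding_incl).mono ?_
  intro x hx h
  exact hx (by simp only [Function.comp] at h; simp [streamDeriv, h])

theorem integrable_mul_test (R : Opens E3) {φ : E3 × E3 → ℝ} (hφ : ContDiff ℝ ∞ φ)
    (hc : HasCompactSupport φ) (v : V R) :
    Integrable (fun x => v x * φ (incl x)) (phaseMeasure R) :=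
  (Lp.memLp v).integrable_mul (memLp_test R hφ hc)

theorem integrable_mul_streamDeriv (R : Opens E3) {φ : E3 × E3 → ℝ} (hφ : ContDiff ℝ ∞ φ)
    (hc : HasCompactSupport φ) (v : V R) :
    Integrable (fun x => v x * streamDeriv φ x) (phaseMeasure R) :=
  (Lp.memLp v).integrable_mul (memLp_streamDeriv R hφ hc)

theorem integrable_trace_mul_normalComp (R : Opens E3) {t : E3 × S2 → ℝ}
    (ht : Integrable t (fluxMeasure R)) :
    Integrable (fun x => t x * normalComp R x) (bdryMeasure R) := by
  have hm := measurable_normalComp R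
  have h := (integrable_withDensity_iff_integrable_smul' (hm.abs.ennreal_ofReal)
    (Filter.Eventually.of_forall fun _ => ENNReal.ofReal_lt_top)).1 ht
  have hs : Measurable fun x => if 0 ≤ normalComp R x then (1 : ℝ) else -1 :=
    Measurable.ite (measurableSet_le measurable_const hm) measurable_const measurable_const
  refine (h.bdd_mul (c := 1) hs.aestronglyMeasurable
    (Filter.Eventually.of_forall fun x => ?_)).congr (Filter.Eventually.of_forall fun x => ?_)
  · split_ifs <;> simp
  · dsimp only
    rw [ENNReal.toReal_ofReal (abs_nonneg _), smul_eq_mul]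
    split_ifs with h0
    · rw [abs_of_nonneg h0]; ring
    · rw [abs_of_neg (not_le.1 h0)]; ring

theorem integrable_trace_mul_test (R : Opens E3) {t : E3 × S2 → ℝ}
    (ht : Integrable t (fluxMeasure R)) {φ : E3 × E3 → ℝ} (hφ : ContDiff ℝ ∞ φ)
    (hc : HasCompactSupport φ) :
    Integrable (fun x => t x * φ (incl x) * normalComp R x) (bdryMeasure R) := by
  obtain ⟨C, hC⟩ := hφ.continuous.bounded_above_of_compact_support hc
  refine ((integrable_trace_mul_normalComp R ht).bdd_mul (c := C)
    (hφ.continuous.comp isClosedEmbedding_incl.continuous).aestronglyMeasurable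
    (Filter.Eventually.of_forall fun x => hC (incl x))).congr
    (Filter.Eventually.of_forall fun x => ?_)
  dsimp only [Function.comp]
  ring

/-- The fundamental lemma of the calculus of variations on `ℝ³ × S`. -/
theorem ae_eq_zero_of_test {μ : Measure (E3 × S2)} {U : Set (E3 × E3)} (hU : IsOpen U)
    {f : E3 × S2 → ℝ} (hf : LocallyIntegrable (Function.extend incl f 0) (μ.map incl))
    (h : ∀ φ : E3 × E3 → ℝ, ContDiff ℝ ∞ φ → HasCompactSupport φ → tsupport φ ⊆ U →
      ∫ x, f x * φ (incl x) ∂μ = 0) :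
    ∀ᵐ x ∂μ, incl x ∈ U → f x = 0 := by
  have he := isClosedEmbedding_incl.measurableEmbedding
  have := hU.ae_eq_zero_of_integral_contDiff_smul_eq_zero (hf.locallyIntegrableOn U)
    fun φ h1 h2 h3 => by
      rw [he.integral_map, ← h φ h1 h2 h3]
      refine integral_congr_ae (Filter.Eventually.of_forall fun x => ?_)
      simp only [he.injective.extend_apply, smul_eq_mul, mul_comm]
  rw [he.ae_map_iff] at this
  simpa only [he.injective.extend_apply] using this

theorem isWeakStream_unique {R : Opens E3} {w a b : V R} (ha : IsWeakStream R w a)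
    (hb : IsWeakStream R w b) : a = b := by
  have he := isClosedEmbedding_incl.measurableEmbedding
  have hfin : IsFiniteMeasureOnCompacts ((phaseMeasure R).map incl) := ⟨fun K hK => by
    rw [he.map_apply]
    exact (isClosedEmbedding_incl.isCompact_preimage hK).measure_lt_top⟩
  have hl : LocallyIntegrable (Function.extend incl (a - b : V R) 0)
      ((phaseMeasure R).map incl) := by
    refine MemLp.locallyIntegrable (p := 2) ?_ (by norm_num)
    rw [he.memLp_map_measure_iff]
    have e : Function.extend incl ⇑(a - b : V R) 0 ∘ incl = (a - b : V R) := by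
      funext x
      exact he.injective.extend_apply _ _ _
    rw [e]
    exact Lp.memLp _
  have h := ae_eq_zero_of_test (U := (R : Set E3) ×ˢ (univ : Set E3))
    (R.isOpen.prod isOpen_univ) hl fun φ h1 h2 h3 => by
      have e : ∫ x, (a - b : V R) x * φ (incl x) ∂phaseMeasure R
          = ∫ x, (a x * φ (incl x) - b x * φ (incl x)) ∂phaseMeasure R := by
        refine integral_congr_ae ?_
        filter_upwards [Lp.coeFn_sub a b] with x hx
        rw [hx, Pi.sub_apply, sub_mul]
      rw [e, integral_sub (integrable_mul_test R h1 h2 a) (integrable_mul_test R h1 h2 b)]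
      have := (ha φ h1 h2 h3).symm.trans (hb φ h1 h2 h3)
      linarith
  have hR : ∀ᵐ x ∂phaseMeasure R, incl x ∈ (R : Set E3) ×ˢ (univ : Set E3) := by
    have := Measure.quasiMeasurePreserving_fst (ν := sph) |>.ae
      (ae_restrict_mem (μ := (volume : Measure E3)) R.isOpen.measurableSet)
    filter_upwards [this] with x hx
    exact ⟨hx, mem_univ _⟩
  refine sub_eq_zero.1 (Lp.ext ?_)
  filter_upwards [h, hR, Lp.coeFn_zero ℝ 2 (phaseMeasure R)] with x h1 h2 h3
  rw [h1 h2, h3, Pi.zero_apply]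

theorem isBdryTrace_unique {R : Opens E3} {w a : V R} {t u : E3 × S2 → ℝ}
    (ht : IsBdryTrace R w a t) (hu : IsBdryTrace R w a u) : t =ᵐ[fluxMeasure R] u := by
  have he := isClosedEmbedding_incl.measurableEmbedding
  have hi := (integrable_trace_mul_normalComp R ht.1).sub
    (integrable_trace_mul_normalComp R hu.1)
  set f : E3 × S2 → ℝ := fun x => t x * normalComp R x - u x * normalComp R x with hf
  have hl : LocallyIntegrable (Function.extend incl f 0) ((bdryMeasure R).map incl) := by
    refine Integrable.locallyIntegrable ?_
    rw [he.integrable_map_iff]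
    refine hi.congr (Filter.Eventually.of_forall fun x => ?_)
    simp only [Function.comp, he.injective.extend_apply]
    rfl
  have h := ae_eq_zero_of_test (U := univ) isOpen_univ hl fun φ h1 h2 _ => by
    have e := (ht.2 φ h1 h2).symm.trans (hu.2 φ h1 h2)
    rw [← sub_eq_zero, ← integral_sub (integrable_trace_mul_test R ht.1 h1 h2)
      (integrable_trace_mul_test R hu.1 h1 h2)] at e
    rw [← e]
    refine integral_congr_ae (Filter.Eventually.of_forall fun x => ?_)
    simp only [hf]
    ring
  rw [Filter.EventuallyEq, fluxMeasure, ae_withDensity_iff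
    (measurable_normalComp R).abs.ennreal_ofReal]
  filter_upwards [h] with x hx hn
  have h1 : normalComp R x ≠ 0 := fun h0 => hn (by simp [h0])
  have h2 := hx (mem_univ _)
  simp only [hf, ← sub_mul, mul_eq_zero, h1, or_false, sub_eq_zero] at h2
  exact h2

theorem IsWeakStream.add {R : Opens E3} {w w' a a' : V R} (h : IsWeakStream R w a)
    (h' : IsWeakStream R w' a') : IsWeakStream R (w + w') (a + a') := by
  intro φ h1 h2 h3
  have e1 : ∫ x, (w + w' : V R) x * streamDeriv φ x ∂phaseMeasure R =
      ∫ x, (w x * streamDeriv φ x + w' x * streamDeriv φ x) ∂phaseMeasure R := by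
    refine integral_congr_ae ?_
    filter_upwards [Lp.coeFn_add w w'] with x hx
    rw [hx, Pi.add_apply, add_mul]
  have e2 : ∫ x, (a + a' : V R) x * φ (incl x) ∂phaseMeasure R =
      ∫ x, (a x * φ (incl x) + a' x * φ (incl x)) ∂phaseMeasure R := by
    refine integral_congr_ae ?_
    filter_upwards [Lp.coeFn_add a a'] with x hx
    rw [hx, Pi.add_apply, add_mul]
  rw [e1, e2, integral_add (integrable_mul_streamDeriv R h1 h2 w)
    (integrable_mul_streamDeriv R h1 h2 w'), integral_add (integrable_mul_test R h1 h2 a)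
    (integrable_mul_test R h1 h2 a'), h φ h1 h2 h3, h' φ h1 h2 h3]
  ring

theorem IsWeakStream.smul {R : Opens E3} {w a : V R} (c : ℝ) (h : IsWeakStream R w a) :
    IsWeakStream R (c • w) (c • a) := by
  intro φ h1 h2 h3
  have e1 : ∫ x, (c • w : V R) x * streamDeriv φ x ∂phaseMeasure R =
      ∫ x, c * (w x * streamDeriv φ x) ∂phaseMeasure R := by
    refine integral_congr_ae ?_
    filter_upwards [Lp.coeFn_smul c w] with x hx
    rw [hx, Pi.smul_apply, smul_eq_mul, mul_assoc]
  have e2 : ∫ x, (c • a : V R) x * φ (incl x) ∂phaseMeasure R =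
      ∫ x, c * (a x * φ (incl x)) ∂phaseMeasure R := by
    refine integral_congr_ae ?_
    filter_upwards [Lp.coeFn_smul c a] with x hx
    rw [hx, Pi.smul_apply, smul_eq_mul, mul_assoc]
  rw [e1, e2, integral_const_mul, integral_const_mul, h φ h1 h2 h3]
  ring

theorem IsBdryTrace.add {R : Opens E3} {w w' a a' : V R} {t t' : E3 × S2 → ℝ}
    (h : IsBdryTrace R w a t) (h' : IsBdryTrace R w' a' t') :
    IsBdryTrace R (w + w') (a + a') (t + t') := by
  refine ⟨h.1.add h'.1, fun φ h1 h2 => ?_⟩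
  have e1 : ∫ x, ((a + a' : V R) x * φ (incl x) + (w + w' : V R) x * streamDeriv φ x)
        ∂phaseMeasure R =
      ∫ x, ((a x * φ (incl x) + w x * streamDeriv φ x) +
        (a' x * φ (incl x) + w' x * streamDeriv φ x)) ∂phaseMeasure R := by
    refine integral_congr_ae ?_
    filter_upwards [Lp.coeFn_add w w', Lp.coeFn_add a a'] with x hx hy
    rw [hx, hy, Pi.add_apply, Pi.add_apply]
    ring
  have e2 : ∫ x, (t + t') x * φ (incl x) * normalComp R x ∂bdryMeasure R =
      ∫ x, (t x * φ (incl x) * normalComp R x + t' x * φ (incl x) * normalComp R x)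
        ∂bdryMeasure R := by
    refine integral_congr_ae (Filter.Eventually.of_forall fun x => ?_)
    simp only [Pi.add_apply]
    ring
  have i1 : Integrable (fun x => a x * φ (incl x) + w x * streamDeriv φ x) (phaseMeasure R) :=
    (integrable_mul_test R h1 h2 a).add (integrable_mul_streamDeriv R h1 h2 w)
  have i2 : Integrable (fun x => a' x * φ (incl x) + w' x * streamDeriv φ x) (phaseMeasure R) :=
    (integrable_mul_test R h1 h2 a').add (integrable_mul_streamDeriv R h1 h2 w')
  rw [e1, e2, integral_add i1 i2,
    integral_add (integrable_trace_mul_test R h.1 h1 h2)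
    (integrable_trace_mul_test R h'.1 h1 h2), h.2 φ h1 h2, h'.2 φ h1 h2]

theorem IsBdryTrace.smul {R : Opens E3} {w a : V R} {t : E3 × S2 → ℝ} (c : ℝ)
    (h : IsBdryTrace R w a t) : IsBdryTrace R (c • w) (c • a) (c • t) := by
  refine ⟨h.1.smul c, fun φ h1 h2 => ?_⟩
  have e1 : ∫ x, ((c • a : V R) x * φ (incl x) + (c • w : V R) x * streamDeriv φ x)
        ∂phaseMeasure R =
      ∫ x, c * (a x * φ (incl x) + w x * streamDeriv φ x) ∂phaseMeasure R := by
    refine integral_congr_ae ?_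
    filter_upwards [Lp.coeFn_smul c w, Lp.coeFn_smul c a] with x hx hy
    rw [hx, hy, Pi.smul_apply, Pi.smul_apply, smul_eq_mul, smul_eq_mul]
    ring
  have e2 : ∫ x, (c • t) x * φ (incl x) * normalComp R x ∂bdryMeasure R =
      ∫ x, c * (t x * φ (incl x) * normalComp R x) ∂bdryMeasure R := by
    refine integral_congr_ae (Filter.Eventually.of_forall fun x => ?_)
    simp only [Pi.smul_apply, smul_eq_mul]
    ring
  rw [e1, e2, integral_const_mul, integral_const_mul, h.2 φ h1 h2]

theorem isWeakStream_zero (R : Opens E3) : IsWeakStream R 0 0 := by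
  intro φ _ _ _
  have e : (0 : V R) =ᵐ[phaseMeasure R] 0 := Lp.coeFn_zero ℝ 2 (phaseMeasure R)
  rw [integral_eq_zero_of_ae, integral_eq_zero_of_ae, neg_zero]
  · filter_upwards [e] with x hx
    simp only [hx, Pi.zero_apply, zero_mul]
  · filter_upwards [e] with x hx
    simp only [hx, Pi.zero_apply, zero_mul]

theorem isBdryTrace_zero (R : Opens E3) : IsBdryTrace R 0 0 0 := by
  refine ⟨integrable_zero _ _ _, fun φ _ _ => ?_⟩
  have e : (0 : V R) =ᵐ[phaseMeasure R] 0 := Lp.coeFn_zero ℝ 2 (phaseMeasure R)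
  rw [integral_eq_zero_of_ae]
  · simp
  · filter_upwards [e] with x hx
    simp only [hx, Pi.zero_apply, zero_mul, add_zero]

/-! #### Behaviour under `s ↦ -s` -/

/-- The test function `φ(r, -s)`. -/
def reflectTest (φ : E3 × E3 → ℝ) (p : E3 × E3) : ℝ := φ (p.1, -p.2)

theorem contDiff_reflectTest {φ : E3 × E3 → ℝ} (hφ : ContDiff ℝ ∞ φ) :
    ContDiff ℝ ∞ (reflectTest φ) :=
  hφ.comp (contDiff_fst.prodMk contDiff_snd.neg)

theorem hasCompactSupport_reflectTest {φ : E3 × E3 → ℝ} (hc : HasCompactSupport φ) :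
    HasCompactSupport (reflectTest φ) :=
  hc.comp_homeomorph ((Homeomorph.refl E3).prodCongr (Homeomorph.neg E3))

theorem tsupport_reflectTest {R : Opens E3} {φ : E3 × E3 → ℝ}
    (h : tsupport φ ⊆ (R : Set E3) ×ˢ (univ : Set E3)) :
    tsupport (reflectTest φ) ⊆ (R : Set E3) ×ˢ (univ : Set E3) := by
  have h1 := tsupport_comp_subset_preimage φ
    (f := fun p : E3 × E3 => (p.1, -p.2)) (by fun_prop)
  intro p hp
  exact ⟨(h (h1 hp)).1, mem_univ _⟩

theorem streamDeriv_reflectTest {φ : E3 × E3 → ℝ} (hφ : ContDiff ℝ ∞ φ) (x : E3 × S2) :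
    streamDeriv (reflectTest φ) x = -streamDeriv φ (reflect x) := by
  have hd : DifferentiableAt ℝ φ (x.1, -(x.2 : E3)) := hφ.differentiable (by simp) _
  have h : HasFDerivAt (reflectTest φ)
      ((fderiv ℝ φ (x.1, -(x.2 : E3))).comp
        ((ContinuousLinearMap.fst ℝ E3 E3).prod (-ContinuousLinearMap.snd ℝ E3 E3)))
      (incl x) :=
    HasFDerivAt.comp (incl x) (f := fun p : E3 × E3 => (p.1, -p.2)) hd.hasFDerivAt
      (hasFDerivAt_fst.prodMk hasFDerivAt_snd.neg)
  rw [streamDeriv, h.fderiv, streamDeriv, ← map_neg]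
  simp [incl, reflect]

theorem integral_reflect {ν : Measure E3} (f : E3 × S2 → ℝ) :
    ∫ x, f (reflect x) ∂ν.prod sph = ∫ x, f x ∂ν.prod sph :=
  (measurePreserving_reflect_prod ν).integral_comp
    (MeasurableEquiv.measurableEmbedding
      ⟨⟨reflect, reflect, reflect_reflect, reflect_reflect⟩, measurable_reflect,
        measurable_reflect⟩) f

theorem IsWeakStream.of_even {R : Opens E3} {w a : V R} (hw : reflection R w = w)
    (h : IsWeakStream R w a) : IsWeakStream R w (-reflection R a) := by
  intro φ h1 h2 h3
  have e := h (reflectTest φ) (contDiff_reflectTest h1) (hasCompactSupport_reflectTest h2)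
    (tsupport_reflectTest h3)
  have hw' := coeFn_reflection R w
  rw [hw] at hw'
  have e1 : ∫ x, w x * streamDeriv φ x ∂phaseMeasure R =
      -∫ x, w x * streamDeriv (reflectTest φ) x ∂phaseMeasure R := by
    rw [← integral_reflect, ← integral_neg]
    refine integral_congr_ae ?_
    filter_upwards [hw'] with x hx
    rw [← hx, streamDeriv_reflectTest h1]
    ring
  have e2 : ∫ x, (-reflection R a : V R) x * φ (incl x) ∂phaseMeasure R =
      -∫ x, a x * reflectTest φ (incl x) ∂phaseMeasure R := by
    rw [← integral_reflect (fun x => a x * reflectTest φ (incl x)), ← integral_neg]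
    refine integral_congr_ae ?_
    filter_upwards [Lp.coeFn_neg (reflection R a), coeFn_reflection R a] with x hx hy
    rw [hx, Pi.neg_apply, hy]
    simp [reflectTest, incl, reflect]
  rw [e1, e2, e]

theorem IsBdryTrace.of_even {R : Opens E3} {w a : V R} {t : E3 × S2 → ℝ}
    (hw : reflection R w = w) (h : IsBdryTrace R w a t) :
    IsBdryTrace R w (-reflection R a) (t ∘ reflect) := by
  refine ⟨(measurePreserving_reflect_flux R).integrable_comp_of_integrable h.1,
    fun φ h1 h2 => ?_⟩
  have e := h.2 (reflectTest φ) (contDiff_reflectTest h1) (hasCompactSupport_reflectTest h2)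
  have hw' := coeFn_reflection R w
  rw [hw] at hw'
  have e1 : ∫ x, ((-reflection R a : V R) x * φ (incl x) + w x * streamDeriv φ x)
        ∂phaseMeasure R =
      -∫ x, (a x * reflectTest φ (incl x) + w x * streamDeriv (reflectTest φ) x)
        ∂phaseMeasure R := by
    rw [← integral_reflect (fun x => a x * reflectTest φ (incl x) +
      w x * streamDeriv (reflectTest φ) x), ← integral_neg]
    refine integral_congr_ae ?_
    filter_upwards [Lp.coeFn_neg (reflection R a), coeFn_reflection R a, hw'] with x hx hy hz
    rw [hx, Pi.neg_apply, hy, ← hz, streamDeriv_reflectTest h1, reflect_reflect]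
    simp [reflectTest, incl, reflect]
    ring
  have e2 : ∫ x, (t ∘ reflect) x * φ (incl x) * normalComp R x ∂bdryMeasure R =
      -∫ x, t x * reflectTest φ (incl x) * normalComp R x ∂bdryMeasure R := by
    rw [← integral_reflect (fun x => t x * reflectTest φ (incl x) * normalComp R x),
      ← integral_neg]
    refine integral_congr_ae (Filter.Eventually.of_forall fun x => ?_)
    simp only [Function.comp, normalComp_reflect]
    simp [reflectTest, incl, reflect]
  rw [e1, e2, e]

/-- The space `𝕎` of all `w ∈ L²(D)` with `s · ∇_r w ∈ L²(D)` and
`w|_{∂D₋} ∈ L²(∂D₋; |s · n|)`. -/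
def W (R : Opens E3) : Submodule ℝ (V R) where
  carrier := {w | ∃ a : V R, IsWeakStream R w a ∧ ∃ t, IsBdryTrace R w a t ∧
    MemLp t 2 ((fluxMeasure R).restrict (inflow R))}
  add_mem' := by
    rintro w w' ⟨a, ha, t, ht, h⟩ ⟨a', ha', t', ht', h'⟩
    exact ⟨a + a', ha.add ha', t + t', ht.add ht', h.add h'⟩
  zero_mem' := ⟨0, isWeakStream_zero R, 0, isBdryTrace_zero R, MemLp.zero⟩
  smul_mem' := by
    rintro c w ⟨a, ha, t, ht, h⟩
    exact ⟨c • a, ha.smul c, c • t, ht.smul c, h.const_smul c⟩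

/-- The space `𝕎⁺` of the elements of `𝕎` that are even in the direction variable. -/
def WPlus (R : Opens E3) : Type := ↥(W R ⊓ VEven R)

instance (R : Opens E3) : AddCommGroup (WPlus R) :=
  inferInstanceAs (AddCommGroup ↥(W R ⊓ VEven R))

instance (R : Opens E3) : Module ℝ (WPlus R) :=
  inferInstanceAs (Module ℝ ↥(W R ⊓ VEven R))

/-- The inclusion of `𝕎⁺` into `𝕍`, as a linear map. -/
def toVₗ (R : Opens E3) : WPlus R →ₗ[ℝ] V R := (W R ⊓ VEven R).subtype

theorem toVₗ_injective (R : Opens E3) : Function.Injective (toVₗ R) :=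
  Subtype.val_injective

theorem toVₗ_mem (R : Opens E3) (w : WPlus R) : toVₗ R w ∈ W R := w.2.1

theorem toVₗ_even (R : Opens E3) (w : WPlus R) : reflection R (toVₗ R w) = toVₗ R w := w.2.2

/-- `s · ∇_r w`, as an element of `𝕍`. -/
def streamVal (R : Opens E3) (w : WPlus R) : V R := (toVₗ_mem R w).choose

theorem isWeakStream_streamVal (R : Opens E3) (w : WPlus R) :
    IsWeakStream R (toVₗ R w) (streamVal R w) := (toVₗ_mem R w).choose_spec.1

/-- A representative of the trace of `w` on `∂R × S`. -/
def traceVal (R : Opens E3) (w : WPlus R) : E3 × S2 → ℝ := (toVₗ_mem R w).choose_spec.2.choose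

theorem isBdryTrace_traceVal (R : Opens E3) (w : WPlus R) :
    IsBdryTrace R (toVₗ R w) (streamVal R w) (traceVal R w) :=
  (toVₗ_mem R w).choose_spec.2.choose_spec.1

theorem memLp_traceVal_inflow (R : Opens E3) (w : WPlus R) :
    MemLp (traceVal R w) 2 ((fluxMeasure R).restrict (inflow R)) :=
  (toVₗ_mem R w).choose_spec.2.choose_spec.2

theorem streamVal_odd (R : Opens E3) (w : WPlus R) : streamVal R w ∈ VOdd R := by
  have h := isWeakStream_unique (isWeakStream_streamVal R w)
    ((isWeakStream_streamVal R w).of_even (toVₗ_even R w))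
  change reflection R (streamVal R w) = -streamVal R w
  exact neg_eq_iff_eq_neg.1 h.symm

theorem traceVal_even (R : Opens E3) (w : WPlus R) :
    traceVal R w =ᵐ[fluxMeasure R] traceVal R w ∘ reflect := by
  have h := (isBdryTrace_traceVal R w).of_even (toVₗ_even R w)
  have e : -reflection R (streamVal R w) = streamVal R w := by
    rw [show reflection R (streamVal R w) = -streamVal R w from streamVal_odd R w, neg_neg]
  rw [e] at h
  exact isBdryTrace_unique (isBdryTrace_traceVal R w) h

theorem measurableSet_inflow (R : Opens E3) : MeasurableSet (inflow R) :=
  measurableSet_lt (measurable_normalComp R) measurable_const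

theorem measurableEmbedding_reflect : MeasurableEmbedding reflect :=
  MeasurableEquiv.measurableEmbedding
    ⟨⟨reflect, reflect, reflect_reflect, reflect_reflect⟩, measurable_reflect, measurable_reflect⟩

theorem ae_normalComp_ne_zero (R : Opens E3) : ∀ᵐ x ∂fluxMeasure R, normalComp R x ≠ 0 := by
  rw [fluxMeasure, ae_withDensity_iff (measurable_normalComp R).abs.ennreal_ofReal]
  refine Filter.Eventually.of_forall fun x hx h => hx ?_
  simp [h]

theorem inflow_union_ae (R : Opens E3) :
    (inflow R ∪ reflect ⁻¹' inflow R : Set (E3 × S2)) =ᵐ[fluxMeasure R] univ := by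
  rw [Filter.eventuallyEq_univ]
  filter_upwards [ae_normalComp_ne_zero R] with x hx
  rcases lt_or_gt_of_ne hx with h | h
  · exact Or.inl h
  · refine Or.inr ?_
    change normalComp R (reflect x) < 0
    rw [normalComp_reflect]
    linarith

theorem disjoint_inflow (R : Opens E3) : Disjoint (inflow R) (reflect ⁻¹' inflow R) := by
  rw [Set.disjoint_left]
  intro x h1 h2
  change normalComp R (reflect x) < 0 at h2
  change normalComp R x < 0 at h1
  rw [normalComp_reflect] at h2
  linarith

theorem integrableOn_outflow (R : Opens E3) (w : WPlus R) :
    IntegrableOn (fun x => traceVal R w x ^ 2) (reflect ⁻¹' inflow R) (fluxMeasure R) := by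
  have h : IntegrableOn (fun x => traceVal R w x ^ 2) (inflow R) (fluxMeasure R) :=
    (memLp_traceVal_inflow R w).integrable_sq
  have h2 := ((measurePreserving_reflect_flux R).integrableOn_comp_preimage
    measurableEmbedding_reflect).2 h
  refine h2.congr (ae_restrict_of_ae ?_)
  filter_upwards [traceVal_even R w] with x hx
  simp only [Function.comp] at hx ⊢
  rw [hx]

theorem memLp_traceVal (R : Opens E3) (w : WPlus R) :
    MemLp (traceVal R w) 2 (fluxMeasure R) := by
  rw [memLp_two_iff_integrable_sq (isBdryTrace_traceVal R w).1.aestronglyMeasurable,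
    ← integrableOn_univ, ← integrableOn_congr_set_ae (inflow_union_ae R)]
  exact IntegrableOn.union (memLp_traceVal_inflow R w).integrable_sq (integrableOn_outflow R w)

theorem integral_traceVal_sq (R : Opens E3) (w : WPlus R) :
    ∫ x, traceVal R w x ^ 2 ∂fluxMeasure R =
      2 * ∫ x in inflow R, traceVal R w x ^ 2 ∂fluxMeasure R := by
  have h := (measurePreserving_reflect_flux R).setIntegral_preimage_emb
    measurableEmbedding_reflect (fun x => traceVal R w x ^ 2) (inflow R)
  have h' : ∫ x in reflect ⁻¹' inflow R, traceVal R w (reflect x) ^ 2 ∂fluxMeasure R =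
      ∫ x in reflect ⁻¹' inflow R, traceVal R w x ^ 2 ∂fluxMeasure R := by
    refine integral_congr_ae (ae_restrict_of_ae ?_)
    filter_upwards [traceVal_even R w] with x hx
    simp only [Function.comp] at hx ⊢
    rw [hx]
  rw [← setIntegral_univ, ← setIntegral_congr_set (inflow_union_ae R),
    setIntegral_union (disjoint_inflow R) (measurable_reflect (measurableSet_inflow R))
      (memLp_traceVal_inflow R w).integrable_sq (integrableOn_outflow R w), ← h', h]
  ring

/-- `w ↦ s · ∇_r w`, as a linear map `𝕎⁺ → 𝕍⁻`. -/
def transportₗ (R : Opens E3) : WPlus R →ₗ[ℝ] VOdd R where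
  toFun w := ⟨streamVal R w, streamVal_odd R w⟩
  map_add' w w' := Subtype.ext <| isWeakStream_unique (isWeakStream_streamVal R (w + w')) <| by
    rw [map_add]
    exact (isWeakStream_streamVal R w).add (isWeakStream_streamVal R w')
  map_smul' c w := Subtype.ext <| isWeakStream_unique (isWeakStream_streamVal R (c • w)) <| by
    rw [map_smul]
    exact (isWeakStream_streamVal R w).smul c

/-- The trace, as a linear map `𝕎⁺ → L²(∂R × S; |s · n|)`. -/
def traceₗ (R : Opens E3) : WPlus R →ₗ[ℝ] Lp ℝ 2 (fluxMeasure R) where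
  toFun w := (memLp_traceVal R w).toLp _
  map_add' w w' := by
    rw [← MemLp.toLp_add]
    refine MemLp.toLp_congr _ _ (isBdryTrace_unique (isBdryTrace_traceVal R (w + w')) ?_)
    have h := (isBdryTrace_traceVal R w).add (isBdryTrace_traceVal R w')
    have e : streamVal R (w + w') = streamVal R w + streamVal R w' :=
      congrArg Subtype.val ((transportₗ R).map_add w w')
    rwa [map_add, e]
  map_smul' c w := by
    rw [RingHom.id_apply, ← MemLp.toLp_const_smul]
    refine MemLp.toLp_congr _ _ (isBdryTrace_unique (isBdryTrace_traceVal R (c • w)) ?_)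
    have h := (isBdryTrace_traceVal R w).smul c
    have e : streamVal R (c • w) = c • streamVal R w :=
      congrArg Subtype.val ((transportₗ R).map_smul c w)
    rwa [map_smul, e]

/-- `w ↦ (w, s · ∇_r w, w|_{∂D₋})`, which carries the norm of `𝕎`. -/
def graphₗ (R : Opens E3) : WPlus R →ₗ[ℝ]
    WithLp 2 (V R × WithLp 2 (VOdd R × Lp ℝ 2 ((fluxMeasure R).restrict (inflow R)))) :=
  (WithLp.linearEquiv 2 ℝ _).symm.toLinearMap ∘ₗ (toVₗ R).prod
    ((WithLp.linearEquiv 2 ℝ _).symm.toLinearMap ∘ₗ (transportₗ R).prod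
      ((LpToLpRestrictCLM (E3 × S2) ℝ ℝ (fluxMeasure R) 2 (inflow R)).toLinearMap ∘ₗ traceₗ R))

theorem graphₗ_injective (R : Opens E3) : Function.Injective (graphₗ R) := fun _ _ h =>
  toVₗ_injective R (congrArg WithLp.fst h)

/-- The norm of `𝕎`:
`‖w‖² = ‖w‖²_{L²(D)} + ‖s · ∇_r w‖²_{L²(D)} + ‖w‖²_{L²(∂D₋; |s · n|)}`. -/
instance (R : Opens E3) : NormedAddCommGroup (WPlus R) :=
  NormedAddCommGroup.induced (WPlus R) _ (graphₗ R) (graphₗ_injective R)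

instance (R : Opens E3) : InnerProductSpace ℝ (WPlus R) :=
  InnerProductSpace.induced (graphₗ R)

theorem norm_sq_WPlus (R : Opens E3) (w : WPlus R) :
    ‖w‖ ^ 2 = ‖toVₗ R w‖ ^ 2 + ‖transportₗ R w‖ ^ 2 +
      ∫ x in inflow R, traceVal R w x ^ 2 ∂fluxMeasure R := by
  have e : ‖w‖ = ‖graphₗ R w‖ := rfl
  rw [e, WithLp.prod_norm_sq_eq_of_L2, WithLp.prod_norm_sq_eq_of_L2, ← add_assoc]
  congr 1
  rw [← real_inner_self_eq_norm_sq, L2.inner_def]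
  refine integral_congr_ae ?_
  filter_upwards [LpToLpRestrictCLM_coeFn ℝ (inflow R) (traceₗ R w),
    ae_restrict_of_ae (MemLp.coeFn_toLp (memLp_traceVal R w))] with x h1 h2
  have h3 : (graphₗ R w).snd.snd x = traceVal R w x := h1.trans h2
  simp [h3, sq]

/-! ### The operators of the even-parity formulation -/

/-- The inclusion `𝕎⁺ → 𝕍`. -/
def toV (R : Opens E3) : WPlus R →L[ℝ] V R :=
  (toVₗ R).mkContinuous 1 fun w => by
    rw [one_mul]
    refine le_of_sq_le_sq ?_ (norm_nonneg _)
    have h1 := norm_sq_WPlus R w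
    have h2 : 0 ≤ ∫ x in inflow R, traceVal R w x ^ 2 ∂fluxMeasure R :=
      integral_nonneg fun _ => sq_nonneg _
    nlinarith [sq_nonneg ‖transportₗ R w‖]

/-- The transport operator `𝒜 : 𝕎⁺ → 𝕍⁻`, `𝒜 w = s · ∇_r w`. -/
def transport (R : Opens E3) : WPlus R →L[ℝ] VOdd R :=
  (transportₗ R).mkContinuous 1 fun w => by
    rw [one_mul]
    refine le_of_sq_le_sq ?_ (norm_nonneg _)
    have h1 := norm_sq_WPlus R w
    have h2 : 0 ≤ ∫ x in inflow R, traceVal R w x ^ 2 ∂fluxMeasure R :=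
      integral_nonneg fun _ => sq_nonneg _
    nlinarith [sq_nonneg ‖toVₗ R w‖]

/-- The trace operator `𝕎⁺ → L²(∂D; |s · n|)`. -/
def trace (R : Opens E3) : WPlus R →L[ℝ] Lp ℝ 2 (fluxMeasure R) :=
  (traceₗ R).mkContinuous 2 fun w => by
    refine le_of_sq_le_sq ?_ (by positivity)
    have h1 := norm_sq_WPlus R w
    have h2 := integral_traceVal_sq R w
    have h3 : ‖traceₗ R w‖ ^ 2 = ∫ x, traceVal R w x ^ 2 ∂fluxMeasure R := by
      rw [← real_inner_self_eq_norm_sq, L2.inner_def]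
      refine integral_congr_ae ?_
      filter_upwards [MemLp.coeFn_toLp (memLp_traceVal R w)] with x hx
      have h3 : traceₗ R w x = traceVal R w x := hx
      simp [h3, sq]
    have h4 : 0 ≤ ∫ x in inflow R, traceVal R w x ^ 2 ∂fluxMeasure R :=
      integral_nonneg fun _ => sq_nonneg _
    nlinarith [sq_nonneg ‖toVₗ R w‖, sq_nonneg ‖transportₗ R w‖]

/-- The dual `P' : Y → X'` of an operator `P : X → Y` into a Hilbert space `Y` that is identified
with its dual: `⟨P' y, x⟩ = (y, P x)`. -/
def dualOp {X Y : Type*} [NormedAddCommGroup X] [NormedSpace ℝ X] [NormedAddCommGroup Y]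
    [InnerProductSpace ℝ Y] (P : X →L[ℝ] Y) : Y →L[ℝ] StrongDual ℝ X :=
  (ContinuousLinearMap.compL ℝ X Y ℝ).flip P ∘L innerSL ℝ

theorem dualOp_apply {X Y : Type*} [NormedAddCommGroup X] [NormedSpace ℝ X]
    [NormedAddCommGroup Y] [InnerProductSpace ℝ Y] (P : X →L[ℝ] Y) (y : Y) (x : X) :
    dualOp P y x = inner ℝ y (P x) := rfl

/-- An operator on `𝕍` that respects parity, restricted to `𝕍⁻`. -/
def restrictOdd (R : Opens E3) (T : V R →L[ℝ] V R)
    (hT : ∀ v, T (reflection R v) = reflection R (T v)) : VOdd R →L[ℝ] VOdd R :=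
  (T ∘L (VOdd R).subtypeL).codRestrict (VOdd R) fun v => by
    change reflection R (T v) = -T v
    rw [← hT, show reflection R (v : V R) = -(v : V R) from v.2, map_neg]

section Operators

variable (R : Opens E3) (σa σs : Lp ℝ ∞ ((volume : Measure E3).restrict (R : Set E3))) (g : ℝ)

/-- `ℳ` on `𝕍`: multiplication by `σₜ = σₐ + σₛ`. -/
def opM : V R →L[ℝ] V R := mulOp R (σa + σs)

/-- `𝒦 = σₛ 𝒮` on `𝕍`. -/
def opK : V R →L[ℝ] V R := mulOp R σs ∘L scatter R g

theorem opM_reflection (v : V R) :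
    opM R σa σs (reflection R v) = reflection R (opM R σa σs v) :=
  mulOp_reflection R _ v

theorem opK_reflection (v : V R) :
    opK R σs g (reflection R v) = reflection R (opK R σs g v) := by
  simp only [opK, ContinuousLinearMap.comp_apply, scatter_reflection, mulOp_reflection]

/-- `ℳ : 𝕍⁻ → 𝕍⁻`. -/
def opMOdd : VOdd R →L[ℝ] VOdd R := restrictOdd R (opM R σa σs) (opM_reflection R σa σs)

/-- `ℳ - 𝒦 : 𝕍⁻ → 𝕍⁻`. -/
def opMKOdd : VOdd R →L[ℝ] VOdd R :=
  restrictOdd R (opM R σa σs - opK R σs g) fun v => by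
    simp only [sub_apply, opM_reflection, opK_reflection, map_sub]

/-- `ℛ : 𝕎⁺ → (𝕎⁺)'`, `⟨ℛ u, w⟩ = (|s · n| u, w)_{∂D}`. -/
def opR : WPlus R →L[ℝ] StrongDual ℝ (WPlus R) := dualOp (trace R) ∘L trace R

/-- `𝒜' : 𝕍⁻ → (𝕎⁺)'`, `⟨𝒜' v, w⟩ = (𝒜 w, v)`. -/
def transportDual : VOdd R →L[ℝ] StrongDual ℝ (WPlus R) := dualOp (transport R)

/-- `ℳ : 𝕎⁺ → (𝕎⁺)'`, `⟨ℳ u, w⟩ = (σₜ u, w)`. -/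
def opMEven : WPlus R →L[ℝ] StrongDual ℝ (WPlus R) := dualOp (toV R) ∘L opM R σa σs ∘L toV R

/-- `𝒦 : 𝕎⁺ → (𝕎⁺)'`, `⟨𝒦 u, w⟩ = (𝒦 u, w)`. -/
def opKEven : WPlus R →L[ℝ] StrongDual ℝ (WPlus R) := dualOp (toV R) ∘L opK R σs g ∘L toV R

/-- `ℰ = ℛ + 𝒜' (ℳ - 𝒦)⁻¹ 𝒜 + ℳ : 𝕎⁺ → (𝕎⁺)'`. -/
def opE : WPlus R →L[ℝ] StrongDual ℝ (WPlus R) :=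
  opR R + transportDual R ∘L (opMKOdd R σa σs g).inverse ∘L transport R + opMEven R σa σs

/-- `c = ‖σₛ / σₜ‖_∞`. -/
def albedo : ℝ :=
  (eLpNorm (fun r => σs r / (σa r + σs r)) ∞
    ((volume : Measure E3).restrict (R : Set E3))).toReal

/-- `ℰ₀ = (1 - c g)⁻¹ 𝒜' ℳ⁻¹ 𝒜 + ℳ + ℛ : 𝕎⁺ → (𝕎⁺)'`. -/
def opE0 : WPlus R →L[ℝ] StrongDual ℝ (WPlus R) :=
  (1 - albedo R σa σs * g)⁻¹ •
      (transportDual R ∘L (opMOdd R σa σs).inverse ∘L transport R) +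
    opMEven R σa σs + opR R

/-- The norm `‖w‖_Q = √⟨Q w, w⟩`. -/
def energyNorm {R : Opens E3} (Q : WPlus R →L[ℝ] StrongDual ℝ (WPlus R)) (w : WPlus R) : ℝ :=
  √(Q w w)

end Operators

/-- One sweep `u ↦ u'` of the preconditioned Richardson iteration for `B u = ℓ` with
preconditioner `P₁` and subspace correction in `N`: first `u_{1/2} = u - P₁ (B u - ℓ)`, and then
`u' = u_{1/2} + d`, where the correction `d ∈ N` satisfies
`⟨B d, v⟩ = ⟨(B P₁ - I)(B u - ℓ), v⟩` for all `v ∈ N`. -/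
def IsSweep {R : Opens E3} (B : WPlus R →L[ℝ] StrongDual ℝ (WPlus R))
    (P₁ : StrongDual ℝ (WPlus R) →L[ℝ] WPlus R) (N : Submodule ℝ (WPlus R))
    (ℓ : StrongDual ℝ (WPlus R)) (u u' : WPlus R) : Prop :=
  ∃ d ∈ N, (∀ v ∈ N, B d v = (B (P₁ (B u - ℓ)) - (B u - ℓ)) v) ∧
    u' = (u - P₁ (B u - ℓ)) + d

end RTE

end

/-! ### Coercive operators on Hilbert spaces -/

section Hilbert

variable {X : Type*} [NormedAddCommGroup X] [InnerProductSpace ℝ X]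

/-! Everything reduces to quadratic form inequalities between `ℳ` and `𝒦`. On all of `𝕍` one has `0
≤ 𝒦 ≤ c ℳ`, and on `𝕍⁻` the sharper `𝒦 ≤ c g ℳ`. Inversion reverses the order of positive symmetric
operators (`inner_inverse_le_of_inner_le`), so on `𝕍⁻` it follows that `ℳ⁻¹ ≤ (ℳ - 𝒦)⁻¹ ≤ (1 - c
g)⁻¹ ℳ⁻¹`. Hence `ℰ - 𝒦 ≤ ℰ ≤ ℰ₀`, while `ℰ - 𝒦 ≥ (1 - c) ℰ` because `𝒦 ≤ c ℳ ≤ c ℰ`, and `ℰ - 𝒦 ≥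
(1 - c) ℰ₀` because `(1 - c) / (1 - c g) ≤ 1`.

The analytic core is the spectral information on the scattering operator `S_g` on `L²(S)`: it is
nonnegative, a contraction, and of norm at most `g` on functions of mean zero, in particular on odd
ones. Classically `S_g` has the eigenvalue `gⁿ` on spherical harmonics of degree `n`. The proof
avoids harmonics. Positivity comes from expanding the kernel in powers of `s · s'` with nonnegative
coefficients (`RTE.hgKernel_posSemidef`). The contraction property is Jensen's inequality for a
symmetric Markov kernel (`RTE.norm_kernelOp_le_of_markov`). The factor `g` comes from the law that
`S_g S_h` depends on `g h` only (`RTE.hgConv_eq_of_mul_eq`), which follows from the differential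
equation `(g ∂_g)² k + g ∂_g k = -Δ k` and the symmetry of the spherical Laplacian. This law
rewrites `S_gⁿ⁺¹` with a single factor whose parameter tends to zero geometrically; together with
log-convexity of `n ↦ ‖S_gⁿ f‖` this bounds the first step (`RTE.norm_hgOp_le_mul`).

Invertibility and unique solvability are Lax–Milgram, which needs `𝕎⁺` to be complete. Green's
formula characterizes the trace among integrable functions, so the boundary measure must be finite
for square integrable limits of traces to qualify. Finiteness holds because the surface of a bounded
convex set is the image of a subset of the surface of a cube under the nonexpansive nearest-point
map (`RTE.euclideanHausdorffMeasure_frontier_lt_top`).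

For the iteration, `Q⁻¹ B` is self-adjoint in the energy inner product of `B` with spectrum in `[1 -
c, 1]`, so `I - Q⁻¹ B` has energy norm at most `c` (`energy_sub_le_of_spectrally_equivalent`). The
subspace correction subtracts the energy projection of the error onto the subspace and so cannot
increase the error. -/

theorem isCoercive_of_norm_sq_le {Q : X →L[ℝ] StrongDual ℝ X} {C : ℝ} (hC : 0 < C)
    (h : ∀ w, C * ‖w‖ ^ 2 ≤ Q w w) : IsCoercive Q :=
  ⟨C, hC, fun u => by simpa [sq, mul_assoc] using h u⟩

/-- Lax–Milgram, with the Riesz isomorphism used to pass between functionals and vectors. -/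
theorem isInvertible_of_norm_sq_le [CompleteSpace X] {Q : X →L[ℝ] StrongDual ℝ X} {C : ℝ}
    (hC : 0 < C) (h : ∀ w, C * ‖w‖ ^ 2 ≤ Q w w) : Q.IsInvertible := by
  have hco := isCoercive_of_norm_sq_le hC h
  have hinj : Function.Injective Q := by
    refine (injective_iff_map_eq_zero Q).2 fun w hw => ?_
    have h1 := h w
    rw [hw] at h1
    have h2 : ‖w‖ ^ 2 ≤ 0 := by
      by_contra hn
      have := mul_pos hC (not_le.1 hn)
      simp only [zero_apply] at h1
      linarith
    simpa using h2
  have hsurj : Function.Surjective Q := by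
    intro ℓ
    refine ⟨hco.continuousLinearEquivOfBilin.symm ((InnerProductSpace.toDual ℝ X).symm ℓ), ?_⟩
    ext w
    rw [← hco.continuousLinearEquivOfBilin_apply, ContinuousLinearEquiv.apply_symm_apply,
      InnerProductSpace.toDual_symm_apply]
  exact ⟨ContinuousLinearEquiv.ofBijective Q (LinearMap.ker_eq_bot.2 hinj)
    (LinearMap.range_eq_top.2 hsurj), ContinuousLinearEquiv.coe_ofBijective _ _ _⟩

/-- Composing `T` with the Riesz map gives a coercive form, to which Lax–Milgram applies.
Bijectivity passes back to `T` because inner products separate points. -/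
theorem isInvertible_of_norm_sq_le_inner [CompleteSpace X] {T : X →L[ℝ] X} {C : ℝ}
    (hC : 0 < C) (h : ∀ w, C * ‖w‖ ^ 2 ≤ inner ℝ (T w) w) : T.IsInvertible := by
  obtain ⟨e, he⟩ := isInvertible_of_norm_sq_le (Q := RTE.dualOp (.id ℝ X) ∘L T) hC fun w => by
    simpa [RTE.dualOp_apply] using h w
  have hT : ∀ x y, inner ℝ (T x) y = e x y := fun x y => by
    rw [show (e x) = (e : X →L[ℝ] StrongDual ℝ X) x from rfl, he]
    simp [RTE.dualOp_apply]
  have hinj : Function.Injective T := fun x y hxy => e.injective <| by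
    ext z
    rw [← hT, ← hT, hxy]
  have hsurj : Function.Surjective T := fun z => by
    refine ⟨e.symm (RTE.dualOp (.id ℝ X) z), ext_inner_right ℝ fun w => ?_⟩
    rw [hT, e.apply_symm_apply]
    rfl
  exact ⟨ContinuousLinearEquiv.ofBijective T (LinearMap.ker_eq_bot.2 hinj)
    (LinearMap.range_eq_top.2 hsurj), ContinuousLinearEquiv.coe_ofBijective _ _ _⟩

/-- Inversion reverses the order of symmetric positive operators. -/
theorem inner_inverse_le_of_inner_le {S T : X →L[ℝ] X} {t : ℝ} (ht : 0 < t)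
    (hS : S.IsInvertible) (hT : T.IsInvertible) (hsymm : ∀ x y, inner ℝ (S x) y = inner ℝ x (S y))
    (hnonneg : ∀ x, 0 ≤ inner ℝ (S x) x) (hle : ∀ x, inner ℝ (S x) x ≤ t * inner ℝ (T x) x)
    (v : X) : inner ℝ (T.inverse v) v ≤ t * inner ℝ (S.inverse v) v := by
  obtain ⟨x, rfl⟩ := hT.surjective v
  obtain ⟨y, hy⟩ := hS.surjective (T x)
  rw [hT.inverse_apply_self, ← hy, hS.inverse_apply_self, hy]
  -- With `v = T x = S y`, the two sides of the claim are `(x, T x)` and `t (y, T x)`. Nonnegativity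
  -- of `S` at `x - t y` reads `0 ≤ (S x, x) - 2 t (T x, x) + t² (y, T x)`, and `(S x, x) ≤ t (T x,
  -- x)` leaves `t` times the claim.
  have h1 := hnonneg (x - t • y)
  have h2 := hle x
  have h3 : inner ℝ (S y) x = inner ℝ (T x) x := by rw [hy]
  have h4 : inner ℝ (S x) y = inner ℝ (T x) x := by
    rw [hsymm, hy, real_inner_comm]
  have h5 : inner ℝ (S y) y = inner ℝ y (T x) := by rw [hy, real_inner_comm]
  simp only [map_sub, map_smul, inner_sub_left, inner_sub_right, inner_smul_left,
    inner_smul_right, h3, h4, h5, RCLike.conj_to_real] at h1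
  rw [real_inner_comm]
  have h6 : 0 ≤ t * (t * inner ℝ y (T x) - inner ℝ (T x) x) := by nlinarith
  have := nonneg_of_mul_nonneg_right h6 ht
  linarith

theorem inner_inverse_symm {T : X →L[ℝ] X} (hT : T.IsInvertible)
    (hsymm : ∀ x y, inner ℝ (T x) y = inner ℝ x (T y)) (v w : X) :
    inner ℝ (T.inverse v) w = inner ℝ v (T.inverse w) := by
  conv_lhs => rw [← hT.self_apply_inverse w]
  rw [← hsymm, hT.self_apply_inverse]

/-- The residual of one step of the preconditioned Richardson iteration contracts in the energy
norm. -/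
theorem energy_sub_le_of_spectrally_equivalent {B Q : X →L[ℝ] StrongDual ℝ X} {c : ℝ}
    (hc0 : 0 ≤ c) (hc1 : c < 1) (hQ : Q.IsInvertible) (hQs : ∀ v w, Q v w = Q w v)
    (hBs : ∀ v w, B v w = B w v) (hB0 : ∀ w, 0 ≤ B w w)
    (hle : ∀ w, (1 - c) * Q w w ≤ B w w ∧ B w w ≤ Q w w) (x : X) :
    B (x - Q.inverse (B x)) (x - Q.inverse (B x)) ≤ c ^ 2 * B x x := by
  set T : X → X := fun x => Q.inverse (B x) with hT
  have hQT : ∀ x z, Q (T x) z = B x z := fun x z => by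
    rw [hT, hQ.self_apply_inverse]
  have hBT : ∀ x z, B (T x) z = Q (T x) (T z) := fun x z => by
    rw [hBs, hQs, hQT]
  have hadd : ∀ x y (a : ℝ), T (x - a • y) = T x - a • T y := fun x y a => by
    simp only [hT, map_sub, map_smul]
  have hQ0 : ∀ w, 0 ≤ Q w w := fun w => (hB0 w).trans (hle w).2
  -- In operator terms `B T ≤ B`, where `T = Q⁻¹ B` and `Q (T x) (T x) = B (T x) x`. It results from
  -- `0 ≤ B (x - T x) (x - T x)` and `B ≤ Q`.
  have h1 : ∀ x, Q (T x) (T x) ≤ B x x := fun x => by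
    have e := hB0 (x - T x)
    simp only [map_sub, sub_apply] at e
    rw [hBT x x, hBs x (T x), hBT x x] at e
    have := (hle (T x)).2
    linarith
  -- The lower spectral bound `(1 - c) B ≤ B T`, from nonnegativity of `Q` at `T x - (1 - c) x` and
  -- `(1 - c) Q ≤ B`.
  have h2 : ∀ x, (1 - c) * B x x ≤ Q (T x) (T x) := fun x => by
    have e := hQ0 (T x - (1 - c) • x)
    simp only [map_sub, sub_apply, map_smul, smul_apply, smul_eq_mul] at e
    rw [hQs x (T x), hQT x x] at e
    have := (hle x).1
    have h3 : 0 ≤ (1 - c) * (B x x - (1 - c) * Q x x) :=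
      mul_nonneg (by linarith) (by linarith)
    nlinarith
  -- The form of `I - T` in the energy inner product, since `Q (T x) (T z) = B (T x) z`. It lies
  -- between `0` and `c B`, which has to be turned into the norm bound `‖(I - T) x‖ ≤ c ‖x‖`.
  set β : X → X → ℝ := fun x z => B x z - Q (T x) (T z) with hβ
  have hβ0 : ∀ x, 0 ≤ β x x := fun x => sub_nonneg.2 (h1 x)
  have hβc : ∀ x, β x x ≤ c * B x x := fun x => by
    have := h2 x
    simp only [hβ]
    linarith
  have hexp : ∀ x z (a : ℝ), β (z - a • x) (z - a • x) = β z z - 2 * a * β x z + a ^ 2 * β x x :=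
    fun x z a => by
      simp only [hβ, hadd, map_sub, sub_apply, map_smul, smul_apply, smul_eq_mul]
      rw [hBs z x, hQs (T z) (T x)]
      ring
  set z := x - T x with hz
  have hxz : β x z = B z z := by
    simp only [hβ]
    rw [← hBT, ← sub_apply, ← map_sub]
  have hzz : 0 ≤ B z z := hB0 z
  -- Nonnegativity of `β` at `z - c x`, with `β x z = B z z`, gives `2 c B z z ≤ β z z + c² β x x ≤
  -- c B z z + c³ B x x`. Division by `c` requires `c ≠ 0`; for `c = 0` the form `β` vanishes on the
  -- diagonal and the coefficient `1` serves instead.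
  rcases eq_or_lt_of_le hc0 with h0 | h0
  · have e1 := hexp x z 1
    have e2 := hβ0 (z - (1 : ℝ) • x)
    have e3 := hβc z
    have e4 := hβc x
    rw [← h0] at e3 e4 ⊢
    rw [hxz] at e1
    linarith
  · have e1 := hexp x z c
    have e2 := hβ0 (z - c • x)
    have e3 := hβc z
    have e4 := mul_le_mul_of_nonneg_left (hβc x) (sq_nonneg c)
    rw [hxz] at e1
    have e5 : c * B z z ≤ c * (c ^ 2 * B x x) := by nlinarith
    exact le_of_mul_le_mul_left e5 h0

/-- Galerkin orthogonality: subtracting the energy projection does not increase the energy. -/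
theorem energy_sub_le_of_orthogonal {B : X →L[ℝ] StrongDual ℝ X} (hBs : ∀ v w, B v w = B w v)
    (hB0 : ∀ w, 0 ≤ B w w) {z d : X} (h : B (z - d) d = 0) : B (z - d) (z - d) ≤ B z z := by
  have e : B z z = B (z - d) (z - d) + 2 * B (z - d) d + B d d := by
    simp only [map_sub, sub_apply]
    rw [hBs d z]
    ring
  linarith [hB0 d]

/-- The Galerkin problem on a closed subspace has a unique solution. -/
theorem existsUnique_galerkin [CompleteSpace X] {B : X →L[ℝ] StrongDual ℝ X} {C : ℝ} (hC : 0 < C)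
    (h : ∀ w, C * ‖w‖ ^ 2 ≤ B w w) (N : Submodule ℝ X) (hN : IsClosed (N : Set X))
    (ℓ : StrongDual ℝ X) : ∃! d, d ∈ N ∧ ∀ v ∈ N, B d v = ℓ v := by
  have : CompleteSpace N := hN.completeSpace_coe
  set BN : N →L[ℝ] StrongDual ℝ N :=
    (ContinuousLinearMap.compL ℝ N X ℝ).flip N.subtypeL ∘L B ∘L N.subtypeL with hBN
  have hBN_apply : ∀ d v : N, BN d v = B d v := fun d v => rfl
  have hi : BN.IsInvertible := isInvertible_of_norm_sq_le hC fun w => h w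
  obtain ⟨d, hd⟩ := hi.surjective (ℓ ∘L N.subtypeL)
  refine ⟨d, ⟨d.2, fun v hv => ?_⟩, ?_⟩
  · exact DFunLike.congr_fun hd ⟨v, hv⟩
  · rintro d' ⟨hd', he⟩
    have : (⟨d', hd'⟩ : N) = d := hi.injective <| by
      rw [hd]
      ext v
      exact he v v.2
    rw [← this]

end Hilbert

/-! ### Integration on the sphere -/

namespace RTE

theorem sph_real_univ : sph.real univ = 4 * Real.pi := by
  rw [Measure.real, sph, Measure.toSphere_apply_univ, EuclideanSpace.volume_ball_fin_three,
    finrank_euclideanSpace_fin, ENNReal.toReal_mul, ENNReal.toReal_mul, ENNReal.toReal_ofReal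
      (by positivity)]
  simp
  ring

/-- The action of a linear isometry on the sphere. -/
noncomputable def sphereMap (L : E3 ≃ₗᵢ[ℝ] E3) (s : S2) : S2 := ⟨L s, by simp⟩

theorem continuous_sphereMap (L : E3 ≃ₗᵢ[ℝ] E3) : Continuous (sphereMap L) :=
  (L.continuous.comp continuous_subtype_val).subtype_mk _

theorem measurePreserving_sphereMap (L : E3 ≃ₗᵢ[ℝ] E3) :
    MeasurePreserving (sphereMap L) sph sph := by
  have hm : Measurable (sphereMap L) := (continuous_sphereMap L).measurable
  refine ⟨hm, ?_⟩
  ext A hA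
  rw [Measure.map_apply hm hA, sph, Measure.toSphere_apply' _ (hm hA),
    Measure.toSphere_apply' _ hA]
  congr 1
  -- Surface measure is defined through the volume of the cone over a set, and the isometry maps
  -- cones to cones.
  have : Ioo (0 : ℝ) 1 • ((↑) '' (sphereMap L ⁻¹' A) : Set E3)
      = L ⁻¹' (Ioo (0 : ℝ) 1 • ((↑) '' A : Set E3)) := by
    ext x
    simp only [Set.mem_smul, Set.mem_image, Set.mem_preimage]
    constructor
    · rintro ⟨c, hc, _, ⟨s, hs, rfl⟩, rfl⟩
      exact ⟨c, hc, _, ⟨_, hs, rfl⟩, by simp [sphereMap]⟩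
    · rintro ⟨c, hc, _, ⟨s, hs, rfl⟩, h⟩
      refine ⟨c, hc, _, ⟨sphereMap L.symm s, ?_, rfl⟩, ?_⟩
      · have : sphereMap L (sphereMap L.symm s) = s := Subtype.ext (by simp [sphereMap])
        rwa [this]
      · apply L.injective
        rw [← h]
        simp [sphereMap]
  rw [this]
  exact (L.measurePreserving.measure_preimage_emb L.toHomeomorph.measurableEmbedding _)

theorem integrable_sph_of_continuous {f : S2 → ℝ} (hf : Continuous f) : Integrable f sph :=
  hf.integrable_of_hasCompactSupport (HasCompactSupport.of_compactSpace f)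

/-- Differentiation under the integral over the sphere. -/
theorem hasDerivAt_integral_sph {U : Set ℝ} (hU : IsOpen U) {F F' : ℝ → S2 → ℝ}
    (hF : ∀ x ∈ U, Continuous (F x)) (hF' : ContinuousOn (Function.uncurry F') (U ×ˢ univ))
    (h : ∀ x ∈ U, ∀ s, HasDerivAt (F · s) (F' x s) x) {x : ℝ} (hx : x ∈ U) :
    HasDerivAt (fun x => ∫ s, F x s ∂sph) (∫ s, F' x s ∂sph) x := by
  obtain ⟨ε, hε, hball⟩ := Metric.nhds_basis_closedBall.mem_iff.1 (hU.mem_nhds hx)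
  have hc : IsCompact (Metric.closedBall x ε ×ˢ (univ : Set S2)) :=
    (isCompact_closedBall x ε).prod isCompact_univ
  obtain ⟨C, hC⟩ := hc.exists_bound_of_continuousOn (hF'.mono (prod_mono_left hball))
  have hcF' : Continuous (F' x) := by
    have : ContinuousOn (F' x) univ :=
      hF'.comp (f := fun s => (x, s)) (by fun_prop) fun s _ => ⟨hx, mem_univ _⟩
    exact continuousOn_univ.1 this
  refine (hasDerivAt_integral_of_dominated_loc_of_deriv_le (F := F) (F' := F')
    (bound := fun _ => C) (Metric.closedBall_mem_nhds x hε) ?_ ?_ ?_ ?_ ?_ ?_).2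
  · filter_upwards [hU.mem_nhds hx] with y hy
    exact (hF y hy).aestronglyMeasurable
  · exact integrable_sph_of_continuous (hF x hx)
  · exact hcF'.aestronglyMeasurable
  · exact Filter.Eventually.of_forall fun s y hy => hC (y, s) ⟨hy, mem_univ _⟩
  · exact integrable_const _
  · exact Filter.Eventually.of_forall fun s y hy => h y (hball hy) s

/-- Derivatives along infinitesimal rotations integrate to zero over the sphere. -/
theorem integral_rotation_deriv_eq_zero {X : E3 →L[ℝ] E3}
    (hX : ∀ x y, inner ℝ (X x) y = -inner ℝ x (X y)) {u : E3 → ℝ} {u' : E3 → E3 →L[ℝ] ℝ}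
    (hu : ∀ s : S2, HasFDerivAt u (u' s) s) (hc : Continuous fun s : S2 => u' s (X s)) :
    ∫ s : S2, u' s (X s) ∂sph = 0 := by
  -- The exponential of a skew operator is orthogonal, so `exp (θ X)` acts on the sphere. The
  -- integral of `u ∘ exp (θ X)` is constant in `θ`, and its derivative at `θ = 0` is the integral
  -- in question.
  have hskew : X ∈ skewAdjoint (E3 →L[ℝ] E3) := by
    rw [skewAdjoint.mem_iff, ContinuousLinearMap.star_eq_adjoint, eq_comm,
      ContinuousLinearMap.eq_adjoint_iff]
    intro x y
    rw [neg_apply, inner_neg_left, hX, neg_neg]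
  let : NormedAlgebra ℚ (E3 →L[ℝ] E3) := NormedAlgebra.restrictScalars ℚ ℝ _
  have hmem : ∀ θ : ℝ, NormedSpace.exp (θ • X) ∈ unitary (E3 →L[ℝ] E3) := fun θ =>
    NormedSpace.exp_mem_unitary_of_mem_skewAdjoint (skewAdjoint.smul_mem θ hskew)
  set L : ℝ → E3 ≃ₗᵢ[ℝ] E3 := fun θ => Unitary.linearIsometryEquiv ⟨_, hmem θ⟩ with hL
  have hLapp : ∀ θ x, L θ x = NormedSpace.exp (θ • X) x := fun θ x => rfl
  have hder : ∀ θ (s : S2), HasDerivAt (fun θ => L θ s) (X (L θ s)) θ := fun θ s => by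
    have := (hasDerivAt_exp_smul_const' (𝕂 := ℝ) X θ).clm_apply (hasDerivAt_const θ (s : E3))
    simp only [map_zero, add_zero] at this
    exact this
  have hcu : Continuous fun s : S2 => u s :=
    continuous_iff_continuousAt.2 fun s =>
      (hu s).continuousAt.comp continuous_subtype_val.continuousAt
  have hexp : Continuous fun p : ℝ × S2 => sphereMap (L p.1) p.2 := by
    refine Continuous.subtype_mk (f := fun p : ℝ × S2 => L p.1 p.2) ?_ _
    simp only [hLapp]
    have h1 : Continuous fun p : ℝ × S2 => NormedSpace.exp (p.1 • X) :=
      (NormedSpace.exp_continuous (𝔸 := E3 →L[ℝ] E3)).comp (by fun_prop)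
    exact h1.clm_apply (by fun_prop)
  have key := hasDerivAt_integral_sph isOpen_univ (F := fun θ s => u (sphereMap (L θ) s))
    (F' := fun θ s => u' (sphereMap (L θ) s) (X (sphereMap (L θ) s)))
    (fun θ _ => hcu.comp (continuous_sphereMap _)) (hc.comp hexp).continuousOn
    (fun θ _ s => (hu (sphereMap (L θ) s)).comp_hasDerivAt θ (hder θ s)) (mem_univ 0)
  have hconst : (fun θ => ∫ s, u (sphereMap (L θ) s) ∂sph) = fun _ => ∫ s : S2, u s ∂sph := by
    funext θ
    have hinj : Function.Injective (sphereMap (L θ)) := fun s s' h => Subtype.ext <|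
      (L θ).injective (congrArg Subtype.val h)
    exact (measurePreserving_sphereMap (L θ)).integral_comp
      ((continuous_sphereMap _).measurableEmbedding hinj) fun s : S2 => u s
  rw [hconst] at key
  have h0 := key.unique (hasDerivAt_const _ _)
  have hid : ∀ s, sphereMap (L 0) s = s := fun s => Subtype.ext <| by
    change L 0 s = s
    have e : NormedSpace.exp ((0 : ℝ) • X) = 1 :=
      (congrArg NormedSpace.exp (zero_smul ℝ X)).trans NormedSpace.exp_zero
    exact DFunLike.congr_fun e (s : E3)
  simpa only [hid] using h0

/-- The infinitesimal rotation in the plane of the coordinates `i` and `j`. -/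
noncomputable def planeRot (i j : Fin 3) : E3 →L[ℝ] E3 :=
  (EuclideanSpace.proj i : E3 →L[ℝ] ℝ).smulRight (EuclideanSpace.single j (1 : ℝ)) -
    (EuclideanSpace.proj j : E3 →L[ℝ] ℝ).smulRight (EuclideanSpace.single i (1 : ℝ))

theorem planeRot_apply (i j : Fin 3) (x : E3) : planeRot i j x =
    x i • EuclideanSpace.single j (1 : ℝ) - x j • EuclideanSpace.single i (1 : ℝ) := by
  simp [planeRot]

theorem inner_planeRot (i j : Fin 3) (x y : E3) :
    inner ℝ y (planeRot i j x) = x i * y j - x j * y i := by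
  rw [planeRot_apply, inner_sub_right, inner_smul_right, inner_smul_right,
    EuclideanSpace.inner_single_right, EuclideanSpace.inner_single_right]
  simp

theorem inner_sphere_mem (a s : S2) : inner ℝ (a : E3) (s : E3) ∈ Icc (-1 : ℝ) 1 := by
  have := abs_real_inner_le_norm (a : E3) (s : E3)
  simpa [abs_le] using this

/-- Green's formula on the sphere for zonal functions. -/
theorem green_zonal (a b : S2) {f₁ f₂ h h₁ : ℝ → ℝ}
    (hf : ∀ t ∈ Icc (-1 : ℝ) 1, HasDerivAt f₁ (f₂ t) t)
    (hh : ∀ t ∈ Icc (-1 : ℝ) 1, HasDerivAt h (h₁ t) t)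
    (hf₂ : ContinuousOn f₂ (Icc (-1) 1)) (hh₁ : ContinuousOn h₁ (Icc (-1) 1)) :
    ∫ s : S2, ((1 - inner ℝ (a : E3) (s : E3) ^ 2) * f₂ (inner ℝ (a : E3) (s : E3)) -
      2 * inner ℝ (a : E3) (s : E3) * f₁ (inner ℝ (a : E3) (s : E3))) *
        h (inner ℝ (b : E3) (s : E3)) ∂sph =
    -∫ s : S2, f₁ (inner ℝ (a : E3) (s : E3)) * h₁ (inner ℝ (b : E3) (s : E3)) *
      (inner ℝ (a : E3) (b : E3) - inner ℝ (a : E3) (s : E3) * inner ℝ (b : E3) (s : E3))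
        ∂sph := by
  have hin : ∀ a : S2, Continuous fun s : S2 => inner ℝ (a : E3) (s : E3) := fun a => by fun_prop
  have hco : ∀ {φ : ℝ → ℝ}, ContinuousOn φ (Icc (-1) 1) → ∀ a : S2,
      Continuous fun s : S2 => φ (inner ℝ (a : E3) (s : E3)) := fun hφ a =>
    hφ.comp_continuous (hin a) (inner_sphere_mem a)
  have cf₁ := hco (fun t ht => (hf t ht).continuousAt.continuousWithinAt) a
  have ch := hco (fun t ht => (hh t ht).continuousAt.continuousWithinAt) b
  have cf₂ := hco hf₂ a
  have ch₁ := hco hh₁ b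
  -- If `f₁` is the derivative of `f`, this is `L (L f · h)` with `L` the rotation derivative in the
  -- plane of `i` and `j`, for the zonal functions about `a` and `b`. Summed over the three
  -- coordinate planes, `L²` is the spherical Laplacian and `L f · L h` is the product of the
  -- gradients. No primitive `f` is needed.
  set G : Fin 3 → Fin 3 → S2 → ℝ := fun i j s =>
    f₂ (inner ℝ (a : E3) (s : E3)) * inner ℝ (a : E3) (planeRot i j s) ^ 2 *
        h (inner ℝ (b : E3) (s : E3)) +
      f₁ (inner ℝ (a : E3) (s : E3)) * h₁ (inner ℝ (b : E3) (s : E3)) *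
        (inner ℝ (a : E3) (planeRot i j s) * inner ℝ (b : E3) (planeRot i j s)) +
      f₁ (inner ℝ (a : E3) (s : E3)) * h (inner ℝ (b : E3) (s : E3)) *
        inner ℝ (a : E3) (planeRot i j (planeRot i j s)) with hG
  have hGc : ∀ i j, Continuous (G i j) := fun i j => by
    have hA : ∀ a : S2, Continuous fun s : S2 => inner ℝ (a : E3) (planeRot i j s) :=
      fun a => by fun_prop
    have hB : Continuous fun s : S2 => inner ℝ (a : E3) (planeRot i j (planeRot i j s)) := by
      fun_prop
    exact (((cf₂.mul ((hA a).pow 2)).mul ch).add ((cf₁.mul ch₁).mul ((hA a).mul (hA b)))).add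
      ((cf₁.mul ch).mul hB)
  have hG0 : ∀ i j, ∫ s, G i j s ∂sph = 0 := by
    intro i j
    set u : E3 → ℝ := fun x => f₁ (inner ℝ (a : E3) x) * h (inner ℝ (b : E3) x) *
      inner ℝ (a : E3) (planeRot i j x) with hu
    set u' : E3 → E3 →L[ℝ] ℝ := fun x =>
      (f₁ (inner ℝ (a : E3) x) * h (inner ℝ (b : E3) x)) • (innerSL ℝ (a : E3) ∘L planeRot i j) +
      inner ℝ (a : E3) (planeRot i j x) •
        (f₁ (inner ℝ (a : E3) x) • (h₁ (inner ℝ (b : E3) x) • innerSL ℝ (b : E3)) +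
          h (inner ℝ (b : E3) x) • (f₂ (inner ℝ (a : E3) x) • innerSL ℝ (a : E3))) with hu'
    have hd : ∀ s : S2, HasFDerivAt u (u' s) s := by
      intro s
      have e1 : HasFDerivAt (fun x : E3 => f₁ (inner ℝ (a : E3) x))
          (f₂ (inner ℝ (a : E3) (s : E3)) • innerSL ℝ (a : E3)) s :=
        (hf _ (inner_sphere_mem a s)).comp_hasFDerivAt (s : E3)
          (innerSL ℝ (a : E3)).hasFDerivAt
      have e2 : HasFDerivAt (fun x : E3 => h (inner ℝ (b : E3) x))
          (h₁ (inner ℝ (b : E3) (s : E3)) • innerSL ℝ (b : E3)) s :=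
        (hh _ (inner_sphere_mem b s)).comp_hasFDerivAt (s : E3)
          (innerSL ℝ (b : E3)).hasFDerivAt
      have e3 : HasFDerivAt (fun x : E3 => inner ℝ (a : E3) (planeRot i j x))
          (innerSL ℝ (a : E3) ∘L planeRot i j) s :=
        (innerSL ℝ (a : E3) ∘L planeRot i j).hasFDerivAt
      exact (e1.mul e2).mul e3
    have hval : ∀ s : S2, u' s (planeRot i j s) = G i j s := fun s => by
      simp only [hu', hG, add_apply, smul_apply, ContinuousLinearMap.comp_apply,
        innerSL_apply_apply, smul_eq_mul]
      ring
    have := integral_rotation_deriv_eq_zero (X := planeRot i j) (fun x y => by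
      rw [real_inner_comm, inner_planeRot, inner_planeRot]
      ring) hd (by simpa only [hval] using hGc i j)
    simpa only [hval] using this
  have hsum : ∀ s : S2, G 0 1 s + G 1 2 s + G 2 0 s =
      ((1 - inner ℝ (a : E3) (s : E3) ^ 2) * f₂ (inner ℝ (a : E3) (s : E3)) -
        2 * inner ℝ (a : E3) (s : E3) * f₁ (inner ℝ (a : E3) (s : E3))) *
          h (inner ℝ (b : E3) (s : E3)) +
      f₁ (inner ℝ (a : E3) (s : E3)) * h₁ (inner ℝ (b : E3) (s : E3)) *
        (inner ℝ (a : E3) (b : E3) -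
          inner ℝ (a : E3) (s : E3) * inner ℝ (b : E3) (s : E3)) := by
    intro s
    have hn : ∀ s : S2, (s : E3) 0 ^ 2 + (s : E3) 1 ^ 2 + (s : E3) 2 ^ 2 = 1 := fun s => by
      have h1 : ‖(s : E3)‖ ^ 2 = 1 := by simp
      rw [EuclideanSpace.norm_sq_eq] at h1
      simpa [Fin.sum_univ_three] using h1
    have hi : ∀ x y : E3, inner ℝ x y = x 0 * y 0 + x 1 * y 1 + x 2 * y 2 := fun x y => by
      simp [PiLp.inner_apply, Fin.sum_univ_three, mul_comm]
    -- Lagrange's identity: the three terms are the squared components of `a × s`. The next identity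
    -- is its polarization, and the third says that the squares of the three rotations add up to
    -- `-2` times the identity.
    have q1 : inner ℝ (a : E3) (planeRot 0 1 s) ^ 2 + inner ℝ (a : E3) (planeRot 1 2 s) ^ 2 +
        inner ℝ (a : E3) (planeRot 2 0 s) ^ 2 = 1 - inner ℝ (a : E3) (s : E3) ^ 2 := by
      rw [inner_planeRot, inner_planeRot, inner_planeRot, hi]
      linear_combination ((s : E3) 0 ^ 2 + (s : E3) 1 ^ 2 + (s : E3) 2 ^ 2) * hn a + hn s
    have q2 : inner ℝ (a : E3) (planeRot 0 1 s) * inner ℝ (b : E3) (planeRot 0 1 s) +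
        inner ℝ (a : E3) (planeRot 1 2 s) * inner ℝ (b : E3) (planeRot 1 2 s) +
        inner ℝ (a : E3) (planeRot 2 0 s) * inner ℝ (b : E3) (planeRot 2 0 s) =
        inner ℝ (a : E3) (b : E3) -
          inner ℝ (a : E3) (s : E3) * inner ℝ (b : E3) (s : E3) := by
      rw [inner_planeRot, inner_planeRot, inner_planeRot, inner_planeRot, inner_planeRot,
        inner_planeRot, hi, hi, hi]
      linear_combination ((a : E3) 0 * (b : E3) 0 + (a : E3) 1 * (b : E3) 1 +
        (a : E3) 2 * (b : E3) 2) * hn s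
    have q3 : inner ℝ (a : E3) (planeRot 0 1 (planeRot 0 1 s)) +
        inner ℝ (a : E3) (planeRot 1 2 (planeRot 1 2 s)) +
        inner ℝ (a : E3) (planeRot 2 0 (planeRot 2 0 s)) =
        -2 * inner ℝ (a : E3) (s : E3) := by
      rw [inner_planeRot, inner_planeRot, inner_planeRot, planeRot_apply, planeRot_apply,
        planeRot_apply, hi]
      simp
      ring
    simp only [hG]
    linear_combination f₂ (inner ℝ (a : E3) (s : E3)) * h (inner ℝ (b : E3) (s : E3)) * q1 +
      f₁ (inner ℝ (a : E3) (s : E3)) * h₁ (inner ℝ (b : E3) (s : E3)) * q2 +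
      f₁ (inner ℝ (a : E3) (s : E3)) * h (inner ℝ (b : E3) (s : E3)) * q3
  have htot : ∫ s, (G 0 1 s + G 1 2 s + G 2 0 s) ∂sph = 0 := by
    rw [integral_add (f := fun s => G 0 1 s + G 1 2 s)
      ((integrable_sph_of_continuous (hGc 0 1)).add
      (integrable_sph_of_continuous (hGc 1 2))) (integrable_sph_of_continuous (hGc 2 0)),
      integral_add (integrable_sph_of_continuous (hGc 0 1))
      (integrable_sph_of_continuous (hGc 1 2)), hG0, hG0, hG0]
    simp
  simp only [hsum] at htot
  have hina := hin a
  have hinb := hin b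
  have c1 : Continuous fun s : S2 => ((1 - inner ℝ (a : E3) (s : E3) ^ 2) *
      f₂ (inner ℝ (a : E3) (s : E3)) - 2 * inner ℝ (a : E3) (s : E3) *
        f₁ (inner ℝ (a : E3) (s : E3))) * h (inner ℝ (b : E3) (s : E3)) :=
    (((continuous_const.sub (hina.pow 2)).mul cf₂).sub
      ((continuous_const.mul hina).mul cf₁)).mul ch
  have c2 : Continuous fun s : S2 => f₁ (inner ℝ (a : E3) (s : E3)) *
      h₁ (inner ℝ (b : E3) (s : E3)) * (inner ℝ (a : E3) (b : E3) -
        inner ℝ (a : E3) (s : E3) * inner ℝ (b : E3) (s : E3)) :=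
    (cf₁.mul ch₁).mul (continuous_const.sub (hina.mul hinb))
  rw [integral_add (integrable_sph_of_continuous c1) (integrable_sph_of_continuous c2)] at htot
  linarith

end RTE

namespace RTE

/-! ### Calculus of the Henyey–Greenstein kernel -/

/-- `(1 - 2 g t + g²) ^ a`. -/
noncomputable def hgPow (a g t : ℝ) : ℝ := (1 - 2 * g * t + g ^ 2) ^ a

theorem hg_denom_pos {g t : ℝ} (hg : g ∈ Ioo (-1 : ℝ) 1) (ht : t ∈ Icc (-1 : ℝ) 1) :
    0 < 1 - 2 * g * t + g ^ 2 := by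
  obtain ⟨h1, h2⟩ := hg
  obtain ⟨h3, h4⟩ := ht
  have h5 : t ^ 2 ≤ 1 := by nlinarith
  have h6 : g ^ 2 < 1 := by nlinarith
  have e : 1 - 2 * g * t + g ^ 2 = (1 - g * t) ^ 2 + g ^ 2 * (1 - t ^ 2) := by ring
  have h7 : 0 < 1 - g * t := by nlinarith [sq_nonneg (g - t), sq_nonneg (g + t)]
  -- The decomposition separates a strictly positive square from a term that is nonnegative because
  -- `|t| ≤ 1`.
  rw [e]
  have := mul_nonneg (sq_nonneg g) (sub_nonneg.2 h5)
  positivity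

theorem hgPow_add_one {a g t : ℝ} (hg : g ∈ Ioo (-1 : ℝ) 1) (ht : t ∈ Icc (-1 : ℝ) 1) :
    hgPow (a + 1) g t = (1 - 2 * g * t + g ^ 2) * hgPow a g t := by
  rw [hgPow, Real.rpow_add_one (hg_denom_pos hg ht).ne', mul_comm, hgPow]

theorem hasDerivAt_hgPow_left (a : ℝ) {g t : ℝ} (hg : g ∈ Ioo (-1 : ℝ) 1)
    (ht : t ∈ Icc (-1 : ℝ) 1) :
    HasDerivAt (fun g => hgPow a g t) (2 * a * (g - t) * hgPow (a - 1) g t) g := by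
  have h : HasDerivAt (fun g : ℝ => 1 - 2 * g * t + g ^ 2) (2 * (g - t)) g := by
    have := ((((hasDerivAt_id g).const_mul 2).mul_const t).const_sub 1).add
      ((hasDerivAt_id g).pow 2)
    refine this.congr_deriv ?_
    simp
    ring
  refine (h.rpow_const (p := a) (Or.inl (hg_denom_pos hg ht).ne')).congr_deriv ?_
  rw [hgPow]
  ring

theorem hasDerivAt_hgPow_right (a : ℝ) {g t : ℝ} (hg : g ∈ Ioo (-1 : ℝ) 1)
    (ht : t ∈ Icc (-1 : ℝ) 1) :
    HasDerivAt (fun t => hgPow a g t) (-2 * a * g * hgPow (a - 1) g t) t := by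
  have h : HasDerivAt (fun t : ℝ => 1 - 2 * g * t + g ^ 2) (-2 * g) t := by
    have := (((hasDerivAt_id t).const_mul (2 * g)).const_sub 1).add_const (g ^ 2)
    refine this.congr_deriv ?_
    simp
  refine (h.rpow_const (p := a) (Or.inl (hg_denom_pos hg ht).ne')).congr_deriv ?_
  rw [hgPow]
  ring

theorem continuousOn_hgPow (a : ℝ) :
    ContinuousOn (fun p : ℝ × ℝ => hgPow a p.1 p.2) (Ioo (-1) 1 ×ˢ Icc (-1) 1) :=
  ContinuousOn.rpow_const (by fun_prop) fun p hp => Or.inl (hg_denom_pos hp.1 hp.2).ne'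

theorem hgKernel_eq {g t : ℝ} (hg : g ∈ Ioo (-1 : ℝ) 1) (ht : t ∈ Icc (-1 : ℝ) 1) :
    hgKernel g t = 1 / (4 * Real.pi) * ((1 - g ^ 2) * hgPow (-(3 / 2)) g t) := by
  rw [hgKernel, hgPow, Real.rpow_neg (hg_denom_pos hg ht).le, div_eq_mul_inv (1 - g ^ 2)]

/-- `∂_g k_g(t)`. -/
noncomputable def hgDeriv (g t : ℝ) : ℝ :=
  1 / (4 * Real.pi) * (-2 * g * hgPow (-(3 / 2)) g t -
    3 * (g - t) * (1 - g ^ 2) * hgPow (-(5 / 2)) g t)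

/-- `∂_g (g ∂_g k_g(t))`. -/
noncomputable def hgDeriv₂ (g t : ℝ) : ℝ :=
  1 / (4 * Real.pi) * (-4 * g * hgPow (-(3 / 2)) g t + 6 * g ^ 2 * (g - t) * hgPow (-(5 / 2)) g t -
    3 * ((2 * g - t) * (1 - g ^ 2) - 2 * g * (g ^ 2 - g * t)) * hgPow (-(5 / 2)) g t +
    15 * (g ^ 2 - g * t) * (1 - g ^ 2) * (g - t) * hgPow (-(7 / 2)) g t)

/-- `∂_t k_g(t)`. -/
noncomputable def hgSlope (g t : ℝ) : ℝ :=
  1 / (4 * Real.pi) * (3 * g * (1 - g ^ 2) * hgPow (-(5 / 2)) g t)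

/-- `∂_t² k_g(t)`. -/
noncomputable def hgSlope₂ (g t : ℝ) : ℝ :=
  1 / (4 * Real.pi) * (15 * g ^ 2 * (1 - g ^ 2) * hgPow (-(7 / 2)) g t)

theorem hasDerivAt_hgKernel_left {g t : ℝ} (hg : g ∈ Ioo (-1 : ℝ) 1) (ht : t ∈ Icc (-1 : ℝ) 1) :
    HasDerivAt (fun g => hgKernel g t) (hgDeriv g t) g := by
  have h1 : HasDerivAt (fun g : ℝ => 1 - g ^ 2) (-(2 * g)) g := by
    simpa using ((hasDerivAt_id g).pow 2).const_sub 1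
  have h := ((h1.mul (hasDerivAt_hgPow_left (-(3 / 2)) hg ht)).const_mul (1 / (4 * Real.pi)))
  rw [show (-(3 / 2) - 1 : ℝ) = -(5 / 2) by norm_num] at h
  refine (h.congr_of_eventuallyEq ?_).congr_deriv ?_
  · filter_upwards [isOpen_Ioo.mem_nhds hg] with x hx
    exact hgKernel_eq hx ht
  · rw [hgDeriv]
    ring

theorem hasDerivAt_hgKernel_right {g t : ℝ} (hg : g ∈ Ioo (-1 : ℝ) 1)
    (ht : t ∈ Icc (-1 : ℝ) 1) : HasDerivAt (fun t => hgKernel g t) (hgSlope g t) t := by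
  have h := ((hasDerivAt_hgPow_right (-(3 / 2)) hg ht).const_mul (1 - g ^ 2)).const_mul
    (1 / (4 * Real.pi))
  rw [show (-(3 / 2) - 1 : ℝ) = -(5 / 2) by norm_num] at h
  have hpos : ∀ᶠ x in nhds t, 0 < 1 - 2 * g * x + g ^ 2 :=
    (by fun_prop : Continuous fun x : ℝ => 1 - 2 * g * x + g ^ 2).continuousAt.eventually
      (lt_mem_nhds (hg_denom_pos hg ht))
  refine (h.congr_of_eventuallyEq ?_).congr_deriv ?_
  · filter_upwards [hpos] with x hx
    rw [hgKernel, hgPow, Real.rpow_neg hx.le, div_eq_mul_inv (1 - g ^ 2)]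
  · rw [hgSlope]
    ring

theorem hasDerivAt_hgSlope {g t : ℝ} (hg : g ∈ Ioo (-1 : ℝ) 1) (ht : t ∈ Icc (-1 : ℝ) 1) :
    HasDerivAt (fun t => hgSlope g t) (hgSlope₂ g t) t := by
  have h := ((hasDerivAt_hgPow_right (-(5 / 2)) hg ht).const_mul (3 * g * (1 - g ^ 2))).const_mul
    (1 / (4 * Real.pi))
  rw [show (-(5 / 2) - 1 : ℝ) = -(7 / 2) by norm_num] at h
  refine h.congr_deriv ?_
  rw [hgSlope₂]
  ring

theorem hasDerivAt_mul_hgDeriv {g t : ℝ} (hg : g ∈ Ioo (-1 : ℝ) 1) (ht : t ∈ Icc (-1 : ℝ) 1) :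
    HasDerivAt (fun g => g * hgDeriv g t) (hgDeriv₂ g t) g := by
  have h1 : HasDerivAt (fun g : ℝ => -2 * g ^ 2) (-4 * g) g := by
    refine (((hasDerivAt_id g).pow 2).const_mul (-2)).congr_deriv ?_
    simp
    ring
  have h2 : HasDerivAt (fun g : ℝ => 3 * (g ^ 2 - g * t) * (1 - g ^ 2))
      (3 * ((2 * g - t) * (1 - g ^ 2) - 2 * g * (g ^ 2 - g * t))) g := by
    refine (((((hasDerivAt_id g).pow 2).sub ((hasDerivAt_id g).mul_const t)).const_mul 3).mul
      (((hasDerivAt_id g).pow 2).const_sub 1)).congr_deriv ?_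
    simp
    ring
  have h := ((h1.mul (hasDerivAt_hgPow_left (-(3 / 2)) hg ht)).sub
    (h2.mul (hasDerivAt_hgPow_left (-(5 / 2)) hg ht))).const_mul (1 / (4 * Real.pi))
  rw [show (-(3 / 2) - 1 : ℝ) = -(5 / 2) by norm_num,
    show (-(5 / 2) - 1 : ℝ) = -(7 / 2) by norm_num] at h
  have e : (fun g => g * hgDeriv g t) = fun g => 1 / (4 * Real.pi) *
      (-2 * g ^ 2 * hgPow (-(3 / 2)) g t -
        3 * (g ^ 2 - g * t) * (1 - g ^ 2) * hgPow (-(5 / 2)) g t) := by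
    funext g
    rw [hgDeriv]
    ring
  rw [e]
  refine h.congr_deriv ?_
  rw [hgDeriv₂]
  ring

/-- `(g ∂_g)² k_g + g ∂_g k_g = -Δ k_g`, where `Δ` is the Laplacian of the sphere. -/
theorem hg_laplace {g t : ℝ} (hg : g ∈ Ioo (-1 : ℝ) 1) (ht : t ∈ Icc (-1 : ℝ) 1) :
    g * hgDeriv₂ g t + g * hgDeriv g t =
      -((1 - t ^ 2) * hgSlope₂ g t - 2 * t * hgSlope g t) := by
  -- The identity reflects `k_g = (4 π)⁻¹ ∑ (2 n + 1) gⁿ Pₙ`: both sides multiply the `n`-th term by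
  -- `n (n + 1)`. Here it is checked directly, after all powers are reduced to the exponent `-7/2`
  -- so that a polynomial identity remains.
  have e1 : hgPow (-(5 / 2)) g t = (1 - 2 * g * t + g ^ 2) * hgPow (-(7 / 2)) g t := by
    rw [← hgPow_add_one hg ht]
    norm_num
  have e2 : hgPow (-(3 / 2)) g t = (1 - 2 * g * t + g ^ 2) * hgPow (-(5 / 2)) g t := by
    rw [← hgPow_add_one hg ht]
    norm_num
  rw [hgDeriv₂, hgDeriv, hgSlope₂, hgSlope, e2, e1]
  ring

theorem continuousOn_hgKernel :
    ContinuousOn (fun p : ℝ × ℝ => hgKernel p.1 p.2) (Ioo (-1) 1 ×ˢ Icc (-1) 1) := by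
  have := continuousOn_hgPow (-(3 / 2))
  refine ContinuousOn.congr (f := fun p : ℝ × ℝ =>
    1 / (4 * Real.pi) * ((1 - p.1 ^ 2) * hgPow (-(3 / 2)) p.1 p.2)) ?_
    fun p hp => hgKernel_eq hp.1 hp.2
  fun_prop

theorem continuousOn_hgDeriv :
    ContinuousOn (fun p : ℝ × ℝ => hgDeriv p.1 p.2) (Ioo (-1) 1 ×ˢ Icc (-1) 1) := by
  have h1 := continuousOn_hgPow (-(3 / 2))
  have h2 := continuousOn_hgPow (-(5 / 2))
  unfold hgDeriv
  fun_prop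

theorem continuousOn_hgDeriv₂ :
    ContinuousOn (fun p : ℝ × ℝ => hgDeriv₂ p.1 p.2) (Ioo (-1) 1 ×ˢ Icc (-1) 1) := by
  have h1 := continuousOn_hgPow (-(3 / 2))
  have h2 := continuousOn_hgPow (-(5 / 2))
  have h3 := continuousOn_hgPow (-(7 / 2))
  unfold hgDeriv₂
  fun_prop

theorem continuousOn_hgSlope :
    ContinuousOn (fun p : ℝ × ℝ => hgSlope p.1 p.2) (Ioo (-1) 1 ×ˢ Icc (-1) 1) := by
  have h2 := continuousOn_hgPow (-(5 / 2))
  unfold hgSlope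
  fun_prop

theorem continuousOn_hgSlope₂ :
    ContinuousOn (fun p : ℝ × ℝ => hgSlope₂ p.1 p.2) (Ioo (-1) 1 ×ˢ Icc (-1) 1) := by
  have h2 := continuousOn_hgPow (-(7 / 2))
  unfold hgSlope₂
  fun_prop

end RTE

namespace RTE

/-! ### Convolution of Henyey–Greenstein kernels -/

theorem continuousOn_zonal {φ : ℝ × ℝ → ℝ} (hφ : ContinuousOn φ (Ioo (-1) 1 ×ˢ Icc (-1) 1))
    {U : Set ℝ} {f : ℝ → ℝ} (hf : ContinuousOn f U) (hU : MapsTo f U (Ioo (-1) 1)) (a : S2) :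
    ContinuousOn (fun p : ℝ × S2 => φ (f p.1, inner ℝ (a : E3) (p.2 : E3))) (U ×ˢ univ) := by
  refine hφ.comp (f := fun p : ℝ × S2 => (f p.1, inner ℝ (a : E3) (p.2 : E3)))
    (ContinuousOn.prodMk (hf.comp continuousOn_fst fun p hp => hp.1) ?_)
    fun p hp => ⟨hU hp.1, inner_sphere_mem a p.2⟩
  exact (by fun_prop : Continuous fun p : ℝ × S2 =>
    inner ℝ (a : E3) (p.2 : E3)).continuousOn

theorem continuous_zonal {φ : ℝ × ℝ → ℝ} (hφ : ContinuousOn φ (Ioo (-1) 1 ×ˢ Icc (-1) 1)) {g : ℝ}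
    (hg : g ∈ Ioo (-1 : ℝ) 1) (a : S2) :
    Continuous fun s : S2 => φ (g, inner ℝ (a : E3) (s : E3)) :=
  hφ.comp_continuous (f := fun s : S2 => (g, inner ℝ (a : E3) (s : E3))) (by fun_prop)
    fun s => ⟨hg, inner_sphere_mem a s⟩

theorem continuousOn_section {φ : ℝ × ℝ → ℝ} (hφ : ContinuousOn φ (Ioo (-1) 1 ×ˢ Icc (-1) 1))
    {g : ℝ} (hg : g ∈ Ioo (-1 : ℝ) 1) : ContinuousOn (fun t => φ (g, t)) (Icc (-1) 1) :=
  hφ.comp (f := fun t => (g, t)) (by fun_prop) fun _ ht => ⟨hg, ht⟩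

/-- Symmetry of the Laplacian for Henyey–Greenstein kernels. -/
theorem integral_laplace_hg (a b : S2) {g h : ℝ} (hg : g ∈ Ioo (-1 : ℝ) 1)
    (hh : h ∈ Ioo (-1 : ℝ) 1) :
    ∫ s : S2, (g * hgDeriv₂ g (inner ℝ (a : E3) (s : E3)) +
      g * hgDeriv g (inner ℝ (a : E3) (s : E3))) * hgKernel h (inner ℝ (b : E3) (s : E3)) ∂sph =
    ∫ s : S2, hgKernel g (inner ℝ (a : E3) (s : E3)) *
      (h * hgDeriv₂ h (inner ℝ (b : E3) (s : E3)) +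
        h * hgDeriv h (inner ℝ (b : E3) (s : E3))) ∂sph := by
  have key : ∀ (a b : S2) {g h : ℝ}, g ∈ Ioo (-1 : ℝ) 1 → h ∈ Ioo (-1 : ℝ) 1 →
      ∫ s : S2, (g * hgDeriv₂ g (inner ℝ (a : E3) (s : E3)) +
        g * hgDeriv g (inner ℝ (a : E3) (s : E3))) * hgKernel h (inner ℝ (b : E3) (s : E3)) ∂sph =
      ∫ s : S2, hgSlope g (inner ℝ (a : E3) (s : E3)) * hgSlope h (inner ℝ (b : E3) (s : E3)) *
        (inner ℝ (a : E3) (b : E3) - inner ℝ (a : E3) (s : E3) * inner ℝ (b : E3) (s : E3))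
          ∂sph := by
    intro a b g h hg hh
    have := green_zonal a b (fun t ht => hasDerivAt_hgSlope hg ht)
      (fun t ht => hasDerivAt_hgKernel_right hh ht) (continuousOn_section continuousOn_hgSlope₂ hg)
      (continuousOn_section continuousOn_hgSlope hh)
    rw [← neg_eq_iff_eq_neg, ← integral_neg] at this
    -- Green's formula turns either side into the integral of the product of the gradients, an
    -- expression symmetric under exchanging `(a, g)` with `(b, h)`.
    rw [← this]
    refine integral_congr_ae (Filter.Eventually.of_forall fun s => ?_)
    simp only
    rw [hg_laplace hg (inner_sphere_mem a s)]
    ring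
  have h2 := key b a hh hg
  rw [key a b hg hh]
  simp only [mul_comm (hgKernel g _)]
  rw [h2, real_inner_comm]
  refine integral_congr_ae (Filter.Eventually.of_forall fun s => ?_)
  simp only
  ring

/-- Write `D = g ∂_g`. Scaling both parameters by `x`, the derivative in `x` of `x ∫ (D k · k' - k ·
D k')` is `∫ ((D² + D) k · k' - k · (D² + D) k')`: the cross terms `D k · D k'` cancel. Since `D² +
D = -Δ` on these kernels and `Δ` is symmetric, this is zero. The quantity vanishes at `x = 0`, hence
also at `x = 1`. -/
theorem integral_hgDeriv_swap (a b : S2) {g h : ℝ} (hg : g ∈ Ioo (-1 : ℝ) 1)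
    (hh : h ∈ Ioo (-1 : ℝ) 1) :
    ∫ s : S2, (g * hgDeriv g (inner ℝ (a : E3) (s : E3)) *
        hgKernel h (inner ℝ (b : E3) (s : E3)) -
      hgKernel g (inner ℝ (a : E3) (s : E3)) *
        (h * hgDeriv h (inner ℝ (b : E3) (s : E3)))) ∂sph = 0 := by
  set U : Set ℝ := {x | x * g ∈ Ioo (-1 : ℝ) 1 ∧ x * h ∈ Ioo (-1 : ℝ) 1} with hU
  have hUo : IsOpen U := (isOpen_Ioo.preimage (by fun_prop : Continuous fun x : ℝ => x * g)).inter
    (isOpen_Ioo.preimage (by fun_prop : Continuous fun x : ℝ => x * h))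
  have hsub : Icc (0 : ℝ) 1 ⊆ U := by
    rintro x ⟨h0, h1⟩
    refine ⟨⟨?_, ?_⟩, ⟨?_, ?_⟩⟩ <;> nlinarith [hg.1, hg.2, hh.1, hh.2]
  have mg : MapsTo (fun x => x * g) U (Ioo (-1) 1) := fun x hx => hx.1
  have mh : MapsTo (fun x => x * h) U (Ioo (-1) 1) := fun x hx => hx.2
  have cg : ContinuousOn (fun x : ℝ => x * g) U := by fun_prop
  have ch : ContinuousOn (fun x : ℝ => x * h) U := by fun_prop
  have kg := continuousOn_zonal continuousOn_hgKernel cg mg a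
  have dg := continuousOn_zonal continuousOn_hgDeriv cg mg a
  have eg := continuousOn_zonal continuousOn_hgDeriv₂ cg mg a
  have kh := continuousOn_zonal continuousOn_hgKernel ch mh b
  have dh := continuousOn_zonal continuousOn_hgDeriv ch mh b
  have eh := continuousOn_zonal continuousOn_hgDeriv₂ ch mh b
  -- The prefactor `x` contributes the first-order part of `D² + D` upon differentiation, and also
  -- makes the starting value at `x = 0` trivial.
  set Φ : ℝ → S2 → ℝ := fun x s => x * ((x * g) * hgDeriv (x * g) (inner ℝ (a : E3) (s : E3)) *
      hgKernel (x * h) (inner ℝ (b : E3) (s : E3)) -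
    hgKernel (x * g) (inner ℝ (a : E3) (s : E3)) *
      ((x * h) * hgDeriv (x * h) (inner ℝ (b : E3) (s : E3)))) with hΦ
  set Φ' : ℝ → S2 → ℝ := fun x s =>
    ((x * g) * hgDeriv₂ (x * g) (inner ℝ (a : E3) (s : E3)) +
      (x * g) * hgDeriv (x * g) (inner ℝ (a : E3) (s : E3))) *
        hgKernel (x * h) (inner ℝ (b : E3) (s : E3)) -
    hgKernel (x * g) (inner ℝ (a : E3) (s : E3)) *
      ((x * h) * hgDeriv₂ (x * h) (inner ℝ (b : E3) (s : E3)) +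
        (x * h) * hgDeriv (x * h) (inner ℝ (b : E3) (s : E3))) with hΦ'
  have hΦc : ∀ x ∈ U, Continuous (Φ x) := by
    intro x hx
    have kg := continuous_zonal continuousOn_hgKernel (mg hx) a
    have dg := continuous_zonal continuousOn_hgDeriv (mg hx) a
    have kh := continuous_zonal continuousOn_hgKernel (mh hx) b
    have dh := continuous_zonal continuousOn_hgDeriv (mh hx) b
    exact continuous_const.mul (((continuous_const.mul dg).mul kh).sub
      (kg.mul (continuous_const.mul dh)))
  have hΦ'c : ContinuousOn (Function.uncurry Φ') (U ×ˢ univ) := by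
    have c1 : ContinuousOn (fun p : ℝ × S2 => p.1 * g) (U ×ˢ univ) := by fun_prop
    have c2 : ContinuousOn (fun p : ℝ × S2 => p.1 * h) (U ×ˢ univ) := by fun_prop
    exact (((c1.mul eg).add (c1.mul dg)).mul kh).sub (kg.mul ((c2.mul eh).add (c2.mul dh)))
  have hder : ∀ x ∈ U, ∀ s, HasDerivAt (Φ · s) (Φ' x s) x := by
    intro x hx s
    have ig := inner_sphere_mem a s
    have ih := inner_sphere_mem b s
    have lg : HasDerivAt (fun x : ℝ => x * g) g x := by simpa using (hasDerivAt_id x).mul_const g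
    have lh : HasDerivAt (fun x : ℝ => x * h) h x := by simpa using (hasDerivAt_id x).mul_const h
    have d1 := (hasDerivAt_mul_hgDeriv (mg hx) ig).comp x lg
    have d2 := (hasDerivAt_hgKernel_left (mh hx) ih).comp x lh
    have d3 := (hasDerivAt_hgKernel_left (mg hx) ig).comp x lg
    have d4 := (hasDerivAt_mul_hgDeriv (mh hx) ih).comp x lh
    refine ((hasDerivAt_id x).mul ((d1.mul d2).sub (d3.mul d4))).congr_deriv ?_
    simp only [hΦ', Function.comp, id, Pi.sub_apply, Pi.mul_apply]
    ring
  have hzero : ∀ x ∈ U, ∫ s, Φ' x s ∂sph = 0 := by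
    intro x hx
    have kg := continuous_zonal continuousOn_hgKernel (mg hx) a
    have dg := continuous_zonal continuousOn_hgDeriv (mg hx) a
    have eg := continuous_zonal continuousOn_hgDeriv₂ (mg hx) a
    have kh := continuous_zonal continuousOn_hgKernel (mh hx) b
    have dh := continuous_zonal continuousOn_hgDeriv (mh hx) b
    have eh := continuous_zonal continuousOn_hgDeriv₂ (mh hx) b
    refine (integral_sub
      (integrable_sph_of_continuous (((continuous_const.mul eg).add (continuous_const.mul dg)).mul
        kh))
      (integrable_sph_of_continuous (kg.mul ((continuous_const.mul eh).add
        (continuous_const.mul dh))))).trans ?_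
    exact sub_eq_zero.2 (integral_laplace_hg a b (mg hx) (mh hx))
  have hA : ∀ x ∈ U, HasDerivAt (fun x => ∫ s, Φ x s ∂sph) 0 x := fun x hx => by
    have := hasDerivAt_integral_sph hUo hΦc hΦ'c hder hx
    rwa [hzero x hx] at this
  obtain ⟨x, -, hx⟩ := exists_hasDerivAt_eq_slope (fun x => ∫ s, Φ x s ∂sph) (fun _ => 0)
    zero_lt_one (fun x hx => (hA x (hsub hx)).continuousAt.continuousWithinAt)
    fun x hx => hA x (hsub (Ioo_subset_Icc_self hx))
  simp only [hΦ] at hx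
  simpa using hx.symm

/-- The convolution of two Henyey–Greenstein kernels. -/
noncomputable def hgConv (g h : ℝ) (a b : S2) : ℝ :=
  ∫ s : S2, hgKernel g (inner ℝ (a : E3) (s : E3)) * hgKernel h (inner ℝ (b : E3) (s : E3)) ∂sph

/-- The convolution of `k_g` and `k_h` depends on the product `g h` only. -/
theorem hgConv_eq_of_mul_eq {g h g' h' : ℝ} (hg : g ∈ Ioo (0 : ℝ) 1) (hh : h ∈ Ioo (0 : ℝ) 1)
    (hg' : g' ∈ Ioo (0 : ℝ) 1) (hh' : h' ∈ Ioo (0 : ℝ) 1) (he : g * h = g' * h') (a b : S2) :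
    hgConv g h a b = hgConv g' h' a b := by
  -- The pair `(g, h)` is moved to `(g', h')` along the hyperbola `(x, p / x)`. There the derivative
  -- of the convolution is `x⁻¹ ∫ (D k · k' - k · D k')` with `D = g ∂_g`, which is zero.
  wlog hlt : g < g' generalizing g h g' h'
  · rcases eq_or_lt_of_le (not_lt.1 hlt) with h1 | h1
    · subst h1
      rw [mul_left_cancel₀ hg'.1.ne' he]
    · exact (this hg' hh' hg hh he.symm h1).symm
  set p := g * h with hp
  have hp0 : 0 < p := mul_pos hg.1 hh.1
  set U : Set ℝ := Ioo p 1 with hU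
  have mg : MapsTo (fun x => x) U (Ioo (-1) 1) := fun x hx => ⟨by linarith [hx.1], hx.2⟩
  have hxpos : ∀ x ∈ U, 0 < x := fun x hx => hp0.trans hx.1
  have mh : MapsTo (fun x => p / x) U (Ioo (-1) 1) := fun x hx =>
    ⟨by linarith [div_pos hp0 (hxpos x hx)], (div_lt_one (hxpos x hx)).2 hx.1⟩
  have cg : ContinuousOn (fun x : ℝ => x) U := by fun_prop
  have ch : ContinuousOn (fun x : ℝ => p / x) U :=
    continuousOn_const.div continuousOn_id fun x hx => (hxpos x hx).ne'
  have kg := continuousOn_zonal continuousOn_hgKernel cg mg a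
  have dg := continuousOn_zonal continuousOn_hgDeriv cg mg a
  have kh := continuousOn_zonal continuousOn_hgKernel ch mh b
  have dh := continuousOn_zonal continuousOn_hgDeriv ch mh b
  set Φ' : ℝ → S2 → ℝ := fun x s =>
    hgDeriv x (inner ℝ (a : E3) (s : E3)) * hgKernel (p / x) (inner ℝ (b : E3) (s : E3)) +
    hgKernel x (inner ℝ (a : E3) (s : E3)) *
      (hgDeriv (p / x) (inner ℝ (b : E3) (s : E3)) * (-p / x ^ 2)) with hΦ'
  have hA : ∀ x ∈ U, HasDerivAt (fun x => hgConv x (p / x) a b) 0 x := by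
    intro x hx
    have hx0 := hxpos x hx
    have := hasDerivAt_integral_sph isOpen_Ioo (U := U) (F := fun x s =>
      hgKernel x (inner ℝ (a : E3) (s : E3)) * hgKernel (p / x) (inner ℝ (b : E3) (s : E3)))
      (F' := Φ') ?_ ?_ ?_ hx
    · refine this.congr_deriv ?_
      have e := integral_hgDeriv_swap a b (mg hx) (mh hx)
      have e2 : ∀ s, Φ' x s = x⁻¹ * (x * hgDeriv x (inner ℝ (a : E3) (s : E3)) *
          hgKernel (p / x) (inner ℝ (b : E3) (s : E3)) -
        hgKernel x (inner ℝ (a : E3) (s : E3)) *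
          (p / x * hgDeriv (p / x) (inner ℝ (b : E3) (s : E3)))) := fun s => by
        simp only [hΦ']
        field_simp
        ring
      simp only [e2]
      rw [integral_const_mul, e, mul_zero]
    · intro x hx
      exact (continuous_zonal continuousOn_hgKernel (mg hx) a).mul
        (continuous_zonal continuousOn_hgKernel (mh hx) b)
    · have c1 : ContinuousOn (fun q : ℝ × S2 => -p / q.1 ^ 2) (U ×ˢ univ) :=
        ContinuousOn.div (by fun_prop) (by fun_prop) fun q hq => (pow_pos (hxpos _ hq.1) 2).ne'
      exact (dg.mul kh).add (kg.mul (dh.mul c1))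
    · intro x hx s
      have hx0 := hxpos x hx
      have l : HasDerivAt (fun x : ℝ => p / x) (-p / x ^ 2) x := by
        exact ((hasDerivAt_const x p).div (hasDerivAt_id x) hx0.ne').congr_deriv (by simp)
      exact (hasDerivAt_hgKernel_left (mg hx) (inner_sphere_mem a s)).mul
        ((hasDerivAt_hgKernel_left (mh hx) (inner_sphere_mem b s)).comp x l)
  -- Since `p = g h` with `h < 1`, both parameters `x` and `p / x` remain below `1` for `x` between
  -- `g` and `g'`.
  have hgU : p < g := by nlinarith [hg.1, hg.2, hh.1, hh.2]
  have hsub : Icc g g' ⊆ U := fun x hx => ⟨hgU.trans_le hx.1, hx.2.trans_lt hg'.2⟩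
  obtain ⟨x, -, hx⟩ := exists_hasDerivAt_eq_slope (fun x => hgConv x (p / x) a b) (fun _ => 0)
    hlt (fun x hx => (hA x (hsub hx)).continuousAt.continuousWithinAt)
    fun x hx => hA x (hsub (Ioo_subset_Icc_self hx))
  have e1 : p / g = h := by rw [hp]; field_simp [hg.1.ne']
  have e2 : p / g' = h' := by rw [he]; field_simp [hg'.1.ne']
  rw [e1, e2, eq_comm, div_eq_zero_iff] at hx
  rcases hx with hx | hx
  · linarith
  · linarith

theorem hgKernel_zero (t : ℝ) : hgKernel 0 t = 1 / (4 * Real.pi) := by simp [hgKernel]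

/-- The Henyey–Greenstein phase function is a probability density. -/
theorem integral_hgKernel {g : ℝ} (hg : g ∈ Ico (0 : ℝ) 1) (a : S2) :
    ∫ s : S2, hgKernel g (inner ℝ (a : E3) (s : E3)) ∂sph = 1 := by
  have h0 : ∫ s : S2, hgKernel 0 (inner ℝ (a : E3) (s : E3)) ∂sph = 1 := by
    simp only [hgKernel_zero, integral_const, sph_real_univ, smul_eq_mul]
    field_simp
  rcases eq_or_lt_of_le hg.1 with h | h
  · rw [← h, h0]
  have mg : MapsTo (fun x : ℝ => x) (Ioo (-1 : ℝ) 1) (Ioo (-1) 1) := fun x hx => hx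
  have hd : ∀ x ∈ Ioo (-1 : ℝ) 1, HasDerivAt
      (fun x => ∫ s : S2, hgKernel x (inner ℝ (a : E3) (s : E3)) ∂sph)
      (∫ s : S2, hgDeriv x (inner ℝ (a : E3) (s : E3)) ∂sph) x := fun x hx =>
    hasDerivAt_integral_sph isOpen_Ioo
      (F := fun x s => hgKernel x (inner ℝ (a : E3) (s : E3)))
      (F' := fun x s => hgDeriv x (inner ℝ (a : E3) (s : E3)))
      (fun x hx => continuous_zonal continuousOn_hgKernel hx a)
      (continuousOn_zonal continuousOn_hgDeriv continuousOn_id mg a)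
      (fun x hx s => hasDerivAt_hgKernel_left hx (inner_sphere_mem a s)) hx
  have hsub : Icc 0 g ⊆ Ioo (-1 : ℝ) 1 := fun x hx => ⟨by linarith [hx.1], hx.2.trans_lt hg.2⟩
  obtain ⟨x, hx, he⟩ := exists_hasDerivAt_eq_slope
    (fun x => ∫ s : S2, hgKernel x (inner ℝ (a : E3) (s : E3)) ∂sph) _ h
    (fun x hx => (hd x (hsub hx)).continuousAt.continuousWithinAt)
    fun x hx => hd x (hsub (Ioo_subset_Icc_self hx))
  have hx1 := hsub (Ioo_subset_Icc_self hx)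
  -- The kernel with parameter `0` is constant, so the exchange identity says that `x ∫ ∂_g k_x =
  -- 0`. The mean value point satisfies `x > 0`, and the total mass agrees with that of the constant
  -- kernel.
  have e := integral_hgDeriv_swap a a hx1 (h := 0) (by norm_num)
  simp only [hgKernel_zero, zero_mul, mul_zero, sub_zero] at e
  rw [integral_mul_const, integral_const_mul] at e
  have e0 : ∫ s : S2, hgDeriv x (inner ℝ (a : E3) (s : E3)) ∂sph = 0 := by
    have := Real.pi_pos
    simpa [hx.1.ne', this.ne'] using e
  rw [e0, h0, eq_comm, div_eq_zero_iff] at he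
  rcases he with he | he <;> linarith

end RTE

namespace RTE

/-! ### Integral operators with continuous kernels on the sphere -/

theorem integrable_of_memLp_two {f : S2 → ℝ} (hf : MemLp f 2 sph) : Integrable f sph :=
  hf.integrable (by norm_num)

theorem integrable_kernel_mul (κ : C(S2 × S2, ℝ)) {f : S2 → ℝ} (hf : Integrable f sph) (s : S2) :
    Integrable (fun s' => κ (s, s') * f s') sph :=
  hf.bdd_mul (c := ‖κ‖) (by fun_prop) (Filter.Eventually.of_forall fun _ => κ.norm_coe_le_norm _)

theorem integrable_kernel_mul_mul (κ : C(S2 × S2, ℝ)) {f h : S2 → ℝ} (hf : Integrable f sph)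
    (hh : Integrable h sph) :
    Integrable (fun p : S2 × S2 => κ p * (h p.1 * f p.2)) (sph.prod sph) :=
  (hh.mul_prod hf).bdd_mul (c := ‖κ‖) (by fun_prop)
    (Filter.Eventually.of_forall fun _ => κ.norm_coe_le_norm _)

/-- `s ↦ ∫ κ(s, s') f(s') ds'`. -/
noncomputable def kernelFun (κ : C(S2 × S2, ℝ)) (f : S2 → ℝ) (s : S2) : ℝ :=
  ∫ s', κ (s, s') * f s' ∂sph

theorem continuous_kernelFun (κ : C(S2 × S2, ℝ)) {f : S2 → ℝ} (hf : Integrable f sph) :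
    Continuous (kernelFun κ f) := by
  refine continuous_of_dominated (bound := fun s' => ‖κ‖ * |f s'|) ?_ ?_ ?_ ?_
  · exact fun s => (integrable_kernel_mul κ hf s).aestronglyMeasurable
  · refine fun s => Filter.Eventually.of_forall fun s' => ?_
    rw [norm_mul]
    exact mul_le_mul_of_nonneg_right (κ.norm_coe_le_norm _) (abs_nonneg _)
  · exact hf.abs.const_mul _
  · exact Filter.Eventually.of_forall fun s' => by fun_prop

theorem memLp_kernelFun (κ : C(S2 × S2, ℝ)) {f : S2 → ℝ} (hf : Integrable f sph) :
    MemLp (kernelFun κ f) 2 sph :=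
  (continuous_kernelFun κ hf).memLp_of_hasCompactSupport (HasCompactSupport.of_compactSpace _)

theorem kernelFun_congr (κ : C(S2 × S2, ℝ)) {f h : S2 → ℝ} (hfh : f =ᵐ[sph] h) :
    kernelFun κ f = kernelFun κ h := by
  funext s
  refine integral_congr_ae ?_
  filter_upwards [hfh] with s' hs'
  rw [hs']

theorem kernelFun_add (κ : C(S2 × S2, ℝ)) {f h : S2 → ℝ} (hf : Integrable f sph)
    (hh : Integrable h sph) : kernelFun κ (f + h) = kernelFun κ f + kernelFun κ h := by
  funext s
  rw [Pi.add_apply, kernelFun, kernelFun, kernelFun,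
    ← integral_add (integrable_kernel_mul κ hf s) (integrable_kernel_mul κ hh s)]
  simp only [Pi.add_apply, mul_add]

theorem kernelFun_smul (κ : C(S2 × S2, ℝ)) (c : ℝ) (f : S2 → ℝ) :
    kernelFun κ (c • f) = c • kernelFun κ f := by
  funext s
  rw [Pi.smul_apply, kernelFun, kernelFun, smul_eq_mul, ← integral_const_mul]
  simp only [Pi.smul_apply, smul_eq_mul, mul_left_comm]

theorem norm_sq_sph (f : Lp ℝ 2 sph) : ‖f‖ ^ 2 = ∫ s, f s ^ 2 ∂sph := by
  rw [← real_inner_self_eq_norm_sq, L2.inner_def]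
  refine integral_congr_ae (Filter.Eventually.of_forall fun s => ?_)
  simp [sq]

theorem integrable_Lp_sph (f : Lp ℝ 2 sph) : Integrable f sph :=
  integrable_of_memLp_two (Lp.memLp f)

/-- A function bounded by `C ∫ |f|` has `L²` norm at most `4 π C ‖f‖`. -/
theorem norm_le_of_forall_abs_le {C : ℝ} (hC : 0 ≤ C) (f : Lp ℝ 2 sph) (h : Lp ℝ 2 sph)
    (hb : ∀ᵐ s ∂sph, |h s| ≤ C * ∫ s', |f s'| ∂sph) : ‖h‖ ≤ C * (4 * Real.pi) * ‖f‖ := by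
  have hpi := Real.pi_pos
  refine le_of_sq_le_sq ?_ (by positivity)
  have h1 := sq_integral_abs_le (Lp.memLp f)
  rw [← norm_sq_sph, sph_real_univ] at h1
  rw [norm_sq_sph]
  calc ∫ s, h s ^ 2 ∂sph ≤ ∫ _s : S2, (C * ∫ s', |f s'| ∂sph) ^ 2 ∂sph := by
        refine integral_mono_ae (Lp.memLp h).integrable_sq (integrable_const _) ?_
        filter_upwards [hb] with s hs
        rw [← sq_abs]
        exact pow_le_pow_left₀ (abs_nonneg _) hs 2
    _ = 4 * Real.pi * C ^ 2 * (∫ s', |f s'| ∂sph) ^ 2 := by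
        rw [integral_const, sph_real_univ, smul_eq_mul]
        ring
    _ ≤ 4 * Real.pi * C ^ 2 * (4 * Real.pi * ‖f‖ ^ 2) := by gcongr
    _ = (C * (4 * Real.pi) * ‖f‖) ^ 2 := by ring

theorem abs_kernelFun_le {κ : C(S2 × S2, ℝ)} {C : ℝ} (hC : ∀ p, |κ p| ≤ C) {f : S2 → ℝ}
    (hf : Integrable f sph) (s : S2) : |kernelFun κ f s| ≤ C * ∫ s', |f s'| ∂sph := by
  rw [← integral_const_mul, ← Real.norm_eq_abs]
  refine norm_integral_le_of_norm_le (hf.abs.const_mul C)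
    (Filter.Eventually.of_forall fun s' => ?_)
  rw [norm_mul]
  exact mul_le_mul_of_nonneg_right (hC _) (abs_nonneg _)

/-- The integral operator with kernel `κ` on `L²(S)`. -/
noncomputable def kernelOp (κ : C(S2 × S2, ℝ)) : Lp ℝ 2 sph →L[ℝ] Lp ℝ 2 sph :=
  LinearMap.mkContinuous
    { toFun := fun f => (memLp_kernelFun κ (integrable_Lp_sph f)).toLp _
      map_add' := fun f h => by
        rw [← MemLp.toLp_add]
        refine MemLp.toLp_congr _ _ (Filter.EventuallyEq.of_eq ?_)
        rw [← kernelFun_add κ (integrable_Lp_sph f) (integrable_Lp_sph h)]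
        exact kernelFun_congr κ (Lp.coeFn_add f h)
      map_smul' := fun c f => by
        rw [RingHom.id_apply, ← MemLp.toLp_const_smul]
        refine MemLp.toLp_congr _ _ (Filter.EventuallyEq.of_eq ?_)
        rw [← kernelFun_smul κ]
        exact kernelFun_congr κ (Lp.coeFn_smul c f) }
    (‖κ‖ * (4 * Real.pi)) fun f => by
      refine norm_le_of_forall_abs_le (norm_nonneg _) f _ ?_
      filter_upwards [MemLp.coeFn_toLp (memLp_kernelFun κ (integrable_Lp_sph f))] with s hs
      exact (congrArg abs hs).trans_le
        (abs_kernelFun_le (fun p => κ.norm_coe_le_norm p) (integrable_Lp_sph f) s)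

theorem coeFn_kernelOp (κ : C(S2 × S2, ℝ)) (f : Lp ℝ 2 sph) :
    kernelOp κ f =ᵐ[sph] kernelFun κ f :=
  MemLp.coeFn_toLp (memLp_kernelFun κ (integrable_Lp_sph f))

theorem norm_kernelOp_sub_le {κ κ' : C(S2 × S2, ℝ)} {C : ℝ} (hC0 : 0 ≤ C)
    (hC : ∀ p, |κ p - κ' p| ≤ C)
    (f : Lp ℝ 2 sph) : ‖kernelOp κ f - kernelOp κ' f‖ ≤ C * (4 * Real.pi) * ‖f‖ := by
  refine norm_le_of_forall_abs_le hC0 f _ ?_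
  filter_upwards [Lp.coeFn_sub (kernelOp κ f) (kernelOp κ' f), coeFn_kernelOp κ f,
    coeFn_kernelOp κ' f] with s h1 h2 h3
  rw [h1, Pi.sub_apply, h2, h3]
  have e : kernelFun κ f s - kernelFun κ' f s = kernelFun (κ - κ') f s := by
    rw [kernelFun, kernelFun, kernelFun,
      ← integral_sub (integrable_kernel_mul κ (integrable_Lp_sph f) s)
        (integrable_kernel_mul κ' (integrable_Lp_sph f) s)]
    simp only [ContinuousMap.sub_apply, sub_mul]
  rw [e]
  exact abs_kernelFun_le (fun p => by simpa using hC p) (integrable_Lp_sph f) s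

theorem integral_kernelFun_mul (κ : C(S2 × S2, ℝ)) {f h : S2 → ℝ} (hf : Integrable f sph)
    (hh : Integrable h sph) : ∫ s, kernelFun κ f s * h s ∂sph =
      ∫ p : S2 × S2, κ p * (h p.1 * f p.2) ∂sph.prod sph := by
  rw [integral_prod _ (integrable_kernel_mul_mul κ hf hh)]
  refine integral_congr_ae (Filter.Eventually.of_forall fun s => ?_)
  simp only [kernelFun]
  rw [← integral_mul_const]
  refine integral_congr_ae (Filter.Eventually.of_forall fun s' => ?_)
  simp only
  ring

theorem integral_kernelFun_mul_comm {κ : C(S2 × S2, ℝ)} (hκ : ∀ s s', κ (s, s') = κ (s', s))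
    {f h : S2 → ℝ} (hf : Integrable f sph) (hh : Integrable h sph) :
    ∫ s, kernelFun κ f s * h s ∂sph = ∫ s, f s * kernelFun κ h s ∂sph := by
  rw [integral_kernelFun_mul κ hf hh]
  simp only [mul_comm (f _)]
  rw [integral_kernelFun_mul κ hh hf, ← integral_prod_swap]
  refine integral_congr_ae (Filter.Eventually.of_forall fun p => ?_)
  simp only [Prod.swap, hκ p.2 p.1]
  ring

theorem inner_kernelOp_left (κ : C(S2 × S2, ℝ)) (f h : Lp ℝ 2 sph) :
    inner ℝ (kernelOp κ f) h = ∫ s, kernelFun κ f s * h s ∂sph := by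
  rw [L2.inner_def]
  refine integral_congr_ae ?_
  filter_upwards [coeFn_kernelOp κ f] with s hs
  rw [hs]
  simp [mul_comm]

theorem inner_kernelOp_comm {κ : C(S2 × S2, ℝ)} (hκ : ∀ s s', κ (s, s') = κ (s', s))
    (f h : Lp ℝ 2 sph) : inner ℝ (kernelOp κ f) h = inner ℝ f (kernelOp κ h) := by
  rw [inner_kernelOp_left, integral_kernelFun_mul_comm hκ (integrable_Lp_sph f)
    (integrable_Lp_sph h), real_inner_comm, inner_kernelOp_left]
  simp only [mul_comm]

/-- The kernel of a composition of integral operators. -/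
theorem kernelFun_kernelFun (κ κ' : C(S2 × S2, ℝ)) {f : S2 → ℝ} (hf : Integrable f sph) (s : S2) :
    kernelFun κ (kernelFun κ' f) s = ∫ s'', (∫ s', κ (s, s') * κ' (s', s'') ∂sph) * f s'' ∂sph := by
  -- The factor `1` stands for the second function in `integrable_kernel_mul_mul`, which provides
  -- the integrability needed for Fubini.
  have h1 : Integrable (fun p : S2 × S2 => κ (s, p.1) * (κ' p * ((1 : ℝ) * f p.2)))
      (sph.prod sph) :=
    (integrable_kernel_mul_mul κ' hf (integrable_const (1 : ℝ))).bdd_mul (c := ‖κ‖) (by fun_prop)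
      (Filter.Eventually.of_forall fun _ => κ.norm_coe_le_norm _)
  have h2 := integral_integral_swap
    (f := fun s' s'' => κ (s, s') * (κ' (s', s'') * ((1 : ℝ) * f s''))) h1
  calc kernelFun κ (kernelFun κ' f) s
      = ∫ s', ∫ s'', κ (s, s') * (κ' (s', s'') * ((1 : ℝ) * f s'')) ∂sph ∂sph := by
        simp only [kernelFun, ← integral_const_mul, one_mul]
    _ = _ := h2
    _ = _ := by
        refine integral_congr_ae (Filter.Eventually.of_forall fun s'' => ?_)
        simp only
        rw [← integral_mul_const]
        refine integral_congr_ae (Filter.Eventually.of_forall fun s' => ?_)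
        simp only
        ring

theorem kernelOp_kernelOp_congr {κ₁ κ₂ κ₃ κ₄ : C(S2 × S2, ℝ)}
    (h : ∀ s s'', ∫ s', κ₁ (s, s') * κ₂ (s', s'') ∂sph = ∫ s', κ₃ (s, s') * κ₄ (s', s'') ∂sph)
    (f : Lp ℝ 2 sph) : kernelOp κ₁ (kernelOp κ₂ f) = kernelOp κ₃ (kernelOp κ₄ f) := by
  refine Lp.ext ?_
  filter_upwards [coeFn_kernelOp κ₁ (kernelOp κ₂ f), coeFn_kernelOp κ₃ (kernelOp κ₄ f)]
    with s h1 h2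
  rw [h1, h2, kernelFun_congr κ₁ (coeFn_kernelOp κ₂ f), kernelFun_congr κ₃ (coeFn_kernelOp κ₄ f),
    kernelFun_kernelFun _ _ (integrable_Lp_sph f), kernelFun_kernelFun _ _ (integrable_Lp_sph f)]
  simp only [h]

/-- A symmetric Markov kernel acts as a contraction. -/
theorem norm_kernelOp_le_of_markov {κ : C(S2 × S2, ℝ)} (hκ : ∀ s s', κ (s, s') = κ (s', s))
    (h0 : ∀ p, 0 ≤ κ p) (h1 : ∀ s, ∫ s', κ (s, s') ∂sph = 1) (f : Lp ℝ 2 sph) :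
    ‖kernelOp κ f‖ ≤ ‖f‖ := by
  refine le_of_sq_le_sq ?_ (norm_nonneg _)
  have hf := integrable_Lp_sph f
  have hf2 := (Lp.memLp f).integrable_sq
  -- Jensen's inequality for the probability density `κ (s, ·)`, obtained by expanding the
  -- nonnegative variance about the mean `m`. Integration over `s` then uses that, by symmetry, `κ`
  -- also has unit mass in its first variable.
  have hj : ∀ s, kernelFun κ f s ^ 2 ≤ kernelFun κ (fun s' => f s' ^ 2) s := by
    intro s
    set m := kernelFun κ f s with hm
    have i1 : Integrable (fun s' => κ (s, s') * f s') sph := integrable_kernel_mul κ hf s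
    have i2 : Integrable (fun s' => κ (s, s') * f s' ^ 2) sph := integrable_kernel_mul κ hf2 s
    have i3 : Integrable (fun s' => κ (s, s')) sph := integrable_sph_of_continuous (by fun_prop)
    have h : 0 ≤ ∫ s', κ (s, s') * (f s' - m) ^ 2 ∂sph :=
      integral_nonneg fun s' => mul_nonneg (h0 _) (sq_nonneg _)
    have e : (fun s' => κ (s, s') * (f s' - m) ^ 2) = fun s' =>
        (κ (s, s') * f s' ^ 2 - 2 * m * (κ (s, s') * f s')) + m ^ 2 * κ (s, s') := by
      funext s'
      ring
    rw [e, integral_add (f := fun s' => κ (s, s') * f s' ^ 2 - 2 * m * (κ (s, s') * f s'))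
        (i2.sub (i1.const_mul _)) (i3.const_mul _),
      integral_sub i2 (i1.const_mul _), integral_const_mul, integral_const_mul, h1 s] at h
    have e1 : ∫ s', κ (s, s') * f s' ∂sph = m := rfl
    rw [e1] at h
    change m ^ 2 ≤ ∫ s', κ (s, s') * f s' ^ 2 ∂sph
    linarith
  have hone : kernelFun κ (fun _ => 1) = fun _ => 1 := by
    funext s
    simp only [kernelFun, mul_one, h1]
  calc ‖kernelOp κ f‖ ^ 2 = ∫ s, kernelFun κ f s ^ 2 ∂sph := by
        rw [norm_sq_sph]
        refine integral_congr_ae ?_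
        filter_upwards [coeFn_kernelOp κ f] with s hs
        rw [hs]
    _ ≤ ∫ s, kernelFun κ (fun s' => f s' ^ 2) s ∂sph :=
        integral_mono (memLp_kernelFun κ hf).integrable_sq
          (integrable_sph_of_continuous (continuous_kernelFun κ hf2)) hj
    _ = ∫ s, f s ^ 2 ∂sph := by
        have := integral_kernelFun_mul_comm hκ hf2 (integrable_const (μ := sph) (1 : ℝ))
        simpa [hone] using this
    _ = ‖f‖ ^ 2 := (norm_sq_sph f).symm

end RTE

namespace RTE

/-! ### Positive definite zonal kernels -/

/-- The kernel `(s · s') ^ n`. -/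
noncomputable def innerPow (n : ℕ) : C(S2 × S2, ℝ) :=
  ⟨fun p => inner ℝ (p.1 : E3) (p.2 : E3) ^ n, by fun_prop⟩

/-- Multiplication by `s · s' = ∑ sᵢ s'ᵢ` preserves positive definiteness: each summand replaces `f`
by `sᵢ f` in the form of the preceding power. The statement therefore ranges over all integrable `f`
inside the induction. -/
theorem innerPow_posSemidef (n : ℕ) : ∀ {f : S2 → ℝ}, Integrable f sph →
    0 ≤ ∫ p : S2 × S2, innerPow n p * (f p.1 * f p.2) ∂sph.prod sph := by
  induction n with
  | zero =>
    intro f hf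
    simp only [innerPow, ContinuousMap.coe_mk, pow_zero, one_mul]
    rw [integral_prod_mul f f]
    exact mul_self_nonneg _
  | succ n ih =>
    intro f hf
    have hi : ∀ i : Fin 3, Integrable (fun s : S2 => (s : E3) i * f s) sph := fun i => by
      refine hf.bdd_mul (c := 1) (by fun_prop) (Filter.Eventually.of_forall fun s => ?_)
      exact (PiLp.norm_apply_le (s : E3) i).trans (by simp)
    have e : ∀ p : S2 × S2, innerPow (n + 1) p * (f p.1 * f p.2) =
        ∑ i : Fin 3, innerPow n p * (((p.1 : E3) i * f p.1) * ((p.2 : E3) i * f p.2)) := by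
      intro p
      have h : inner ℝ (p.1 : E3) (p.2 : E3) = ∑ i : Fin 3, (p.1 : E3) i * (p.2 : E3) i := by
        simp [PiLp.inner_apply, mul_comm]
      simp only [innerPow, ContinuousMap.coe_mk]
      rw [pow_succ]
      nth_rw 2 [h]
      rw [Finset.mul_sum, Finset.sum_mul]
      refine Finset.sum_congr rfl fun i _ => ?_
      ring
    simp only [e]
    rw [integral_finsetSum _ fun i _ => integrable_kernel_mul_mul (innerPow n) (hi i) (hi i)]
    exact Finset.sum_nonneg fun i _ => ih (hi i)

/-- The Taylor coefficients of `(1 - x) ^ (-3/2)`. -/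
noncomputable def hgCoeff (n : ℕ) : ℝ := Ring.choose ((3 / 2 : ℝ) + n - 1) n

theorem hgCoeff_nonneg (n : ℕ) : 0 ≤ hgCoeff n := by
  rw [hgCoeff, ← Ring.multichoose_eq]
  have h := Ring.factorial_nsmul_multichoose_eq_ascPochhammer (3 / 2 : ℝ) n
  rw [Polynomial.ascPochhammer_smeval_eq_eval, nsmul_eq_mul] at h
  have h1 : 0 < (ascPochhammer ℝ n).eval (3 / 2 : ℝ) := ascPochhammer_pos n _ (by norm_num)
  rw [← h] at h1
  exact (pos_of_mul_pos_right h1 (Nat.cast_nonneg _)).le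

theorem hasSum_hgCoeff {x : ℝ} (hx : |x| < 1) :
    HasSum (fun n => hgCoeff n * x ^ n) (1 / (1 - x) ^ (3 / 2 : ℝ)) := by
  have h := (Real.one_div_one_sub_rpow_hasFPowerSeriesOnBall_zero (3 / 2)).hasSum (y := x)
    (by simpa [enorm_eq_nnnorm] using! hx)
  simp only [FormalMultilinearSeries.ofScalars_apply_eq, smul_eq_mul, zero_add] at h
  exact h

theorem integrable_mul_mul_self {f : S2 → ℝ} (hf : Integrable f sph) :
    Integrable (fun p : S2 × S2 => f p.1 * f p.2) (sph.prod sph) :=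
  hf.mul_prod hf

/-- The Henyey–Greenstein kernel is positive definite. -/
theorem hgKernel_posSemidef {g : ℝ} (hg : g ∈ Ico (0 : ℝ) 1) {f : S2 → ℝ}
    (hf : Integrable f sph) :
    0 ≤ ∫ p : S2 × S2, hgKernel g (inner ℝ (p.1 : E3) (p.2 : E3)) * (f p.1 * f p.2)
      ∂sph.prod sph := by
  have hg1 : g ∈ Ioo (-1 : ℝ) 1 := ⟨by linarith [hg.1], hg.2⟩
  -- This makes `1 - 2 g t + g² = (1 + g²) (1 - x t)`, so the kernel is a positive multiple of the
  -- binomial series of `(1 - x t)^(-3/2)`. Here `x < 1` because `(1 - g)² > 0`.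
  set x : ℝ := 2 * g / (1 + g ^ 2) with hx
  have hd : (0 : ℝ) < 1 + g ^ 2 := by positivity
  have hx0 : 0 ≤ x := div_nonneg (by linarith [hg.1]) hd.le
  have hx1 : x < 1 := by
    rw [hx, div_lt_one hd]
    nlinarith [sq_pos_of_pos (sub_pos.2 hg.2)]
  have hxt : ∀ p : S2 × S2, |x * inner ℝ (p.1 : E3) (p.2 : E3)| ≤ x := fun p => by
    rw [abs_mul, abs_of_nonneg hx0]
    exact mul_le_of_le_one_right hx0 (abs_le.2 (inner_sphere_mem p.1 p.2))
  set A : ℝ := 1 / (4 * Real.pi) * (1 - g ^ 2) * (1 + g ^ 2) ^ (-(3 / 2) : ℝ) with hA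
  have hA0 : 0 ≤ A := by
    have := Real.pi_pos
    have : 0 ≤ 1 - g ^ 2 := by nlinarith [hg.1, hg.2]
    positivity
  have hk : ∀ p : S2 × S2, hgKernel g (inner ℝ (p.1 : E3) (p.2 : E3)) =
      A * (1 / (1 - x * inner ℝ (p.1 : E3) (p.2 : E3)) ^ (3 / 2 : ℝ)) := fun p => by
    have hp := inner_sphere_mem p.1 p.2
    have e : 1 - 2 * g * inner ℝ (p.1 : E3) (p.2 : E3) + g ^ 2 =
        (1 + g ^ 2) * (1 - x * inner ℝ (p.1 : E3) (p.2 : E3)) := by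
      rw [hx]
      field_simp
      ring
    have h1 : 0 ≤ 1 - x * inner ℝ (p.1 : E3) (p.2 : E3) := by
      have := (abs_le.1 (hxt p)).2
      linarith
    rw [hgKernel_eq hg1 hp, hgPow, e, Real.mul_rpow hd.le h1, Real.rpow_neg h1, hA, one_div (_ ^ _)]
    ring
  -- Partial sums of the series have nonnegative forms term by term. They are dominated by the value
  -- of the series at `t = 1`, so the sign survives in the limit.
  set F : ℕ → S2 × S2 → ℝ := fun N p =>
    (∑ n ∈ Finset.range N, hgCoeff n * (x * inner ℝ (p.1 : E3) (p.2 : E3)) ^ n) *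
      (f p.1 * f p.2) with hF
  have hi := integrable_mul_mul_self hf
  have hF0 : ∀ N, 0 ≤ ∫ p, F N p ∂sph.prod sph := by
    intro N
    have e : ∀ p, F N p = ∑ n ∈ Finset.range N,
        (hgCoeff n * x ^ n) * (innerPow n p * (f p.1 * f p.2)) := fun p => by
      simp only [hF, Finset.sum_mul]
      refine Finset.sum_congr rfl fun n _ => ?_
      simp only [innerPow, ContinuousMap.coe_mk, mul_pow]
      ring
    simp only [e]
    rw [integral_finsetSum _ fun n _ => (integrable_kernel_mul_mul (innerPow n) hf hf).const_mul _]
    refine Finset.sum_nonneg fun n _ => ?_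
    rw [integral_const_mul]
    exact mul_nonneg (mul_nonneg (hgCoeff_nonneg n) (pow_nonneg hx0 n)) (innerPow_posSemidef n hf)
  have hlim : Filter.Tendsto (fun N => ∫ p, F N p ∂sph.prod sph) Filter.atTop
      (nhds (∫ p : S2 × S2, (1 / (1 - x * inner ℝ (p.1 : E3) (p.2 : E3)) ^ (3 / 2 : ℝ)) *
        (f p.1 * f p.2) ∂sph.prod sph)) := by
    refine tendsto_integral_of_dominated_convergence
      (fun p => (1 / (1 - x) ^ (3 / 2 : ℝ)) * |f p.1 * f p.2|) ?_ (hi.abs.const_mul _) ?_ ?_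
    · intro N
      have : Continuous fun p : S2 × S2 =>
          ∑ n ∈ Finset.range N, hgCoeff n * (x * inner ℝ (p.1 : E3) (p.2 : E3)) ^ n := by fun_prop
      exact this.aestronglyMeasurable.mul hi.aestronglyMeasurable
    · refine fun N => Filter.Eventually.of_forall fun p => ?_
      rw [norm_mul]
      refine mul_le_mul_of_nonneg_right ?_ (abs_nonneg _)
      refine (norm_sum_le _ _).trans ?_
      have hs := hasSum_hgCoeff (x := x) (by rwa [abs_of_nonneg hx0])
      refine le_trans (Finset.sum_le_sum fun n _ => ?_) (sum_le_hasSum (Finset.range N)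
        (fun n _ => mul_nonneg (hgCoeff_nonneg n) (pow_nonneg hx0 n)) hs)
      rw [norm_mul, norm_pow, Real.norm_eq_abs, Real.norm_eq_abs, abs_of_nonneg (hgCoeff_nonneg n)]
      exact mul_le_mul_of_nonneg_left (pow_le_pow_left₀ (abs_nonneg _) (hxt p) n)
        (hgCoeff_nonneg n)
    · refine Filter.Eventually.of_forall fun p => ?_
      exact (hasSum_hgCoeff ((hxt p).trans_lt hx1)).tendsto_sum_nat.mul_const _
  have hfin := ge_of_tendsto' hlim hF0
  have e : ∀ p : S2 × S2, hgKernel g (inner ℝ (p.1 : E3) (p.2 : E3)) * (f p.1 * f p.2) =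
      A * ((1 / (1 - x * inner ℝ (p.1 : E3) (p.2 : E3)) ^ (3 / 2 : ℝ)) * (f p.1 * f p.2)) :=
    fun p => by rw [hk, mul_assoc]
  simp only [e]
  rw [integral_const_mul]
  exact mul_nonneg hA0 hfin

/-! ### The spectrum of the scattering operator on the sphere -/

/-- The Henyey–Greenstein kernel on `S × S`. -/
noncomputable def hgMap (g : ℝ) (hg : g ∈ Ico (0 : ℝ) 1) : C(S2 × S2, ℝ) :=
  ⟨fun p => hgKernel g (inner ℝ (p.1 : E3) (p.2 : E3)),
    continuousOn_hgKernel.comp_continuous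
      (f := fun p : S2 × S2 => (g, inner ℝ (p.1 : E3) (p.2 : E3))) (by fun_prop)
      fun p => ⟨⟨by linarith [hg.1], hg.2⟩, inner_sphere_mem p.1 p.2⟩⟩

theorem hgMap_apply {g : ℝ} (hg : g ∈ Ico (0 : ℝ) 1) (s s' : S2) :
    hgMap g hg (s, s') = hgKernel g (inner ℝ (s : E3) (s' : E3)) := rfl

theorem hgMap_comm {g : ℝ} (hg : g ∈ Ico (0 : ℝ) 1) (s s' : S2) :
    hgMap g hg (s, s') = hgMap g hg (s', s) := by
  rw [hgMap_apply, hgMap_apply, real_inner_comm]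

theorem hgMap_nonneg {g : ℝ} (hg : g ∈ Ico (0 : ℝ) 1) (p : S2 × S2) : 0 ≤ hgMap g hg p := by
  have hg1 : g ∈ Ioo (-1 : ℝ) 1 := ⟨by linarith [hg.1], hg.2⟩
  have h1 := hg_denom_pos hg1 (inner_sphere_mem p.1 p.2)
  have h2 : 0 ≤ 1 - g ^ 2 := by nlinarith [hg.1, hg.2]
  have := Real.pi_pos
  change 0 ≤ hgKernel g _
  rw [hgKernel]
  positivity

/-- Scattering on the sphere. -/
noncomputable def hgOp (g : ℝ) (hg : g ∈ Ico (0 : ℝ) 1) : Lp ℝ 2 sph →L[ℝ] Lp ℝ 2 sph :=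
  kernelOp (hgMap g hg)

theorem norm_hgOp_le {g : ℝ} (hg : g ∈ Ico (0 : ℝ) 1) (f : Lp ℝ 2 sph) : ‖hgOp g hg f‖ ≤ ‖f‖ :=
  norm_kernelOp_le_of_markov (hgMap_comm hg) (hgMap_nonneg hg) (integral_hgKernel hg) f

theorem inner_hgOp_comm {g : ℝ} (hg : g ∈ Ico (0 : ℝ) 1) (f h : Lp ℝ 2 sph) :
    inner ℝ (hgOp g hg f) h = inner ℝ f (hgOp g hg h) :=
  inner_kernelOp_comm (hgMap_comm hg) f h

theorem hgOp_hgOp_of_mul_eq {g h g' h' : ℝ} (hg : g ∈ Ioo (0 : ℝ) 1) (hh : h ∈ Ioo (0 : ℝ) 1)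
    (hg' : g' ∈ Ioo (0 : ℝ) 1) (hh' : h' ∈ Ioo (0 : ℝ) 1) (he : g * h = g' * h')
    (f : Lp ℝ 2 sph) :
    hgOp g (Ioo_subset_Ico_self hg) (hgOp h (Ioo_subset_Ico_self hh) f) =
      hgOp g' (Ioo_subset_Ico_self hg') (hgOp h' (Ioo_subset_Ico_self hh') f) := by
  refine kernelOp_kernelOp_congr (fun s s'' => ?_) f
  simp only [hgMap_comm _ _ s'']
  exact hgConv_eq_of_mul_eq hg hh hg' hh' he s s''

theorem zero_mem_Ico : (0 : ℝ) ∈ Ico (0 : ℝ) 1 := ⟨le_rfl, one_pos⟩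

/-- The kernel with parameter `0` is the constant `1 / (4 π)`, so its operator takes the mean.
Scattering preserves the mean because its kernel has unit mass; in particular it preserves functions
of mean zero. -/
theorem hgOp_zero_hgOp {g : ℝ} (hg : g ∈ Ico (0 : ℝ) 1) (f : Lp ℝ 2 sph) :
    hgOp 0 zero_mem_Ico (hgOp g hg f) = hgOp 0 zero_mem_Ico (hgOp 0 zero_mem_Ico f) := by
  refine kernelOp_kernelOp_congr (fun s s'' => ?_) f
  have h : ∀ {g : ℝ} (hg : g ∈ Ico (0 : ℝ) 1),
      ∫ s', hgMap 0 zero_mem_Ico (s, s') * hgMap g hg (s', s'') ∂sph = 1 / (4 * Real.pi) := by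
    intro g hg
    simp only [hgMap_apply, hgKernel_zero]
    rw [integral_const_mul]
    simp only [real_inner_comm (s'' : E3)]
    rw [integral_hgKernel hg, mul_one]
  rw [h, h]

/-- Mean value inequality in the parameter, with `∂_g k` bounded on a compact set. On functions of
mean zero it makes the scattering operator of order `ε` for a small parameter `ε`. -/
theorem exists_hgKernel_sub_le {g : ℝ} (hg : g ∈ Ico (0 : ℝ) 1) :
    ∃ C, 0 ≤ C ∧ ∀ ε ∈ Icc 0 g, ∀ t ∈ Icc (-1 : ℝ) 1,
      |hgKernel ε t - hgKernel 0 t| ≤ C * ε := by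
  have hsub : Icc 0 g ×ˢ Icc (-1 : ℝ) 1 ⊆ Ioo (-1 : ℝ) 1 ×ˢ Icc (-1 : ℝ) 1 :=
    prod_mono_left fun x hx => ⟨by linarith [hx.1], hx.2.trans_lt hg.2⟩
  obtain ⟨C, hC⟩ := (isCompact_Icc.prod isCompact_Icc).exists_bound_of_continuousOn
    (continuousOn_hgDeriv.mono hsub)
  refine ⟨|C|, abs_nonneg _, fun ε hε t ht => ?_⟩
  have h := (convex_Icc (0 : ℝ) g).norm_image_sub_le_of_norm_hasDerivWithin_le
    (f := fun x => hgKernel x t) (f' := fun x => hgDeriv x t) (C := |C|) (x := 0) (y := ε)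
    (fun x hx => (hasDerivAt_hgKernel_left (hsub (mk_mem_prod hx ht)).1 ht).hasDerivWithinAt)
    (fun x hx => (hC (x, t) ⟨hx, ht⟩).trans (le_abs_self C)) ⟨le_rfl, hg.1⟩ hε
  simpa [abs_of_nonneg hε.1] using h

/-- A log-convex sequence bounded by a geometric one decays at that rate in the first step. -/
theorem le_mul_of_logConvex {b : ℕ → ℝ} {A x : ℝ} (hx : 0 < x) (hb : ∀ n, 0 ≤ b n)
    (hlog : ∀ n, b (n + 1) ^ 2 ≤ b n * b (n + 2)) (hA : ∀ n, b (n + 1) ≤ A * x ^ n) :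
    b 1 ≤ x * b 0 := by
  -- If the first ratio `y = b 1 / b 0` exceeded `x`, log-convexity would make all later ratios at
  -- least `y`, and growth like `yⁿ` contradicts the bound `A xⁿ`.
  by_contra hcon
  rw [not_le] at hcon
  have h1 : 0 < b 1 := (mul_nonneg hx.le (hb 0)).trans_lt hcon
  have h0 : 0 < b 0 := by
    rcases eq_or_lt_of_le (hb 0) with h | h
    · have := hlog 0
      rw [← h, zero_mul] at this
      nlinarith
    · exact h
  set y := b 1 / b 0 with hy
  have hxy : x < y := (lt_div_iff₀ h0).2 hcon
  have hstep : ∀ n, 0 < b n ∧ y * b n ≤ b (n + 1) := by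
    intro n
    induction n with
    | zero => exact ⟨h0, by rw [hy, div_mul_cancel₀ _ h0.ne']⟩
    | succ n ih =>
      have hp : 0 < b (n + 1) := (mul_pos (hx.trans hxy) ih.1).trans_le ih.2
      refine ⟨hp, ?_⟩
      have e := hlog n
      have e2 := mul_le_mul_of_nonneg_right ih.2 hp.le
      have e3 : b n * (y * b (n + 1)) ≤ b n * b (n + 2) := by nlinarith
      exact le_of_mul_le_mul_left e3 ih.1
  have hgeo : ∀ n, b 1 * y ^ n ≤ b (n + 1) := by
    intro n
    induction n with
    | zero => simp
    | succ n ih =>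
      refine le_trans ?_ (hstep (n + 1)).2
      rw [pow_succ]
      nlinarith [mul_le_mul_of_nonneg_left ih (hx.trans hxy).le]
  have hyx : 1 < y / x := (one_lt_div hx).2 hxy
  obtain ⟨n, hn⟩ := pow_unbounded_of_one_lt (A / b 1) hyx
  have h3 := (hgeo n).trans (hA n)
  rw [div_pow, div_lt_div_iff₀ h1 (pow_pos hx n)] at hn
  linarith

/-- Scattering damps functions of mean zero by the factor `g`. -/
theorem norm_hgOp_le_mul {g : ℝ} (hg : g ∈ Ioo (0 : ℝ) 1) {f : Lp ℝ 2 sph}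
    (hf : hgOp 0 zero_mem_Ico f = 0) : ‖hgOp g (Ioo_subset_Ico_self hg) f‖ ≤ g * ‖f‖ := by
  have hpi := Real.pi_pos
  set S := hgOp g (Ioo_subset_Ico_self hg) with hS
  obtain ⟨C, hC0, hC⟩ := exists_hgKernel_sub_le (Ioo_subset_Ico_self hg)
  -- The auxiliary `ρ` takes the place of the inadmissible parameter `1`, for which scattering would
  -- be the identity. The claim follows as `ρ → 1`.
  have key : ∀ ρ ∈ Ioo g 1, ρ * ‖S f‖ ≤ g * ‖f‖ := by
    intro ρ hρ
    have hρ0 : ρ ∈ Ioo (0 : ℝ) 1 := ⟨hg.1.trans hρ.1, hρ.2⟩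
    set T := hgOp ρ (Ioo_subset_Ico_self hρ0) with hT
    set x := g / ρ with hx
    have hx0 : 0 < x := div_pos hg.1 hρ0.1
    have hx1 : x < 1 := (div_lt_one hρ0.1).2 hρ.1
    have hε : ∀ n, g * x ^ n ∈ Ioo (0 : ℝ) 1 := fun n =>
      ⟨mul_pos hg.1 (pow_pos hx0 n),
        (mul_le_of_le_one_right hg.1.le (pow_le_one₀ hx0.le hx1.le)).trans_lt hg.2⟩
    have hTn : ∀ n, hgOp 0 zero_mem_Ico ((T ^ n) f) = 0 ∧ ‖(T ^ n) f‖ ≤ ‖f‖ := by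
      intro n
      induction n with
      | zero => exact ⟨by simpa using hf, by simp⟩
      | succ n ih =>
        rw [pow_succ', mul_apply_eq_comp, hT, hgOp_zero_hgOp, ih.1, map_zero]
        exact ⟨rfl, (norm_hgOp_le _ _).trans ih.2⟩
    -- The step is `S_g S_{g xⁿ} = S_{g xⁿ⁺¹} S_ρ`, valid because `g · g xⁿ = g xⁿ⁺¹ · ρ` for `x = g
    -- / ρ`. The parameter of the outer factor tends to zero while the powers of `S_ρ` stay
    -- contractive.
    have hiter : ∀ n, (S ^ (n + 1)) f =
        hgOp (g * x ^ n) (Ioo_subset_Ico_self (hε n)) ((T ^ n) f) := by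
      intro n
      induction n with
      | zero => simp [hS]
      | succ n ih =>
        rw [pow_succ', mul_apply_eq_comp, ih, hS,
          hgOp_hgOp_of_mul_eq hg (hε n) (hε (n + 1)) hρ0, ← hT, pow_succ' T,
          mul_apply_eq_comp]
        rw [hx, pow_succ]
        field_simp [hρ0.1.ne']
    -- Since `Tⁿ f` has mean zero, subtracting the operator with parameter `0` changes nothing, and
    -- the Lipschitz bound in the parameter gains the factor `g xⁿ`.
    have hb : ∀ n, ‖(S ^ (n + 1)) f‖ ≤ (C * g * (4 * Real.pi) * ‖f‖) * x ^ n := by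
      intro n
      have h1 := norm_kernelOp_sub_le (κ := hgMap _ (Ioo_subset_Ico_self (hε n)))
        (κ' := hgMap 0 zero_mem_Ico) (mul_nonneg hC0 (hε n).1.le)
        (fun p => hC _ ⟨(hε n).1.le, mul_le_of_le_one_right hg.1.le
          (pow_le_one₀ hx0.le hx1.le)⟩ _ (inner_sphere_mem p.1 p.2)) ((T ^ n) f)
      have h2 : kernelOp (hgMap 0 zero_mem_Ico) ((T ^ n) f) = 0 := (hTn n).1
      rw [h2, sub_zero] at h1
      rw [hiter n]
      refine h1.trans ?_
      calc C * (g * x ^ n) * (4 * Real.pi) * ‖(T ^ n) f‖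
          ≤ C * (g * x ^ n) * (4 * Real.pi) * ‖f‖ :=
            mul_le_mul_of_nonneg_left (hTn n).2 (mul_nonneg (mul_nonneg hC0 (hε n).1.le)
              (by positivity))
        _ = _ := by ring
    have hfin := le_mul_of_logConvex (b := fun n => ‖(S ^ n) f‖) hx0 (fun n => norm_nonneg _)
      (fun n => by
        -- Self-adjointness moves one factor `S` across; Cauchy–Schwarz then yields log-convexity of
        -- the norms.
        have e : ‖(S ^ (n + 1)) f‖ ^ 2 = inner ℝ ((S ^ n) f) ((S ^ (n + 2)) f) := by
          rw [← real_inner_self_eq_norm_sq, pow_succ' S (n + 1), pow_succ' S n,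
            mul_apply_eq_comp, mul_apply_eq_comp,
            mul_apply_eq_comp, hS, inner_hgOp_comm]
        simp only [e]
        exact real_inner_le_norm _ _) hb
    simp only [pow_zero, pow_one, one_apply_eq_self] at hfin
    rw [hx, div_mul_eq_mul_div, le_div_iff₀ hρ0.1] at hfin
    linarith
  have hlim : Filter.Tendsto (fun ρ : ℝ => ρ * ‖S f‖) (nhdsWithin 1 (Iio 1)) (nhds (1 * ‖S f‖)) :=
    (Filter.tendsto_id.mono_left nhdsWithin_le_nhds).mul_const _
  rw [one_mul] at hlim
  exact le_of_tendsto hlim (Filter.eventually_of_mem (Ioo_mem_nhdsLT hg.2) key)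

end RTE

namespace RTE

/-! ### The scattering form on slices -/

theorem integral_scatter_mul_comm {g : ℝ} (hg : g ∈ Ico (0 : ℝ) 1) {f h : S2 → ℝ}
    (hf : Integrable f sph) (hh : Integrable h sph) :
    ∫ s, kernelFun (hgMap g hg) f s * h s ∂sph = ∫ s, kernelFun (hgMap g hg) h s * f s ∂sph := by
  rw [integral_kernelFun_mul_comm (hgMap_comm hg) hf hh]
  simp only [mul_comm]

theorem integral_scatter_mul_self_nonneg {g : ℝ} (hg : g ∈ Ico (0 : ℝ) 1) {f : S2 → ℝ}
    (hf : Integrable f sph) : 0 ≤ ∫ s, kernelFun (hgMap g hg) f s * f s ∂sph := by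
  rw [integral_kernelFun_mul _ hf hf]
  exact hgKernel_posSemidef hg hf

theorem integral_scatter_mul_self_eq {g : ℝ} (hg : g ∈ Ico (0 : ℝ) 1) {f : S2 → ℝ}
    (hf : MemLp f 2 sph) : ∫ s, kernelFun (hgMap g hg) f s * f s ∂sph =
      inner ℝ (hgOp g hg (hf.toLp f)) (hf.toLp f) := by
  have e := hf.coeFn_toLp
  rw [hgOp, inner_kernelOp_left, kernelFun_congr _ e]
  refine integral_congr_ae ?_
  filter_upwards [e] with s hs
  rw [hs]

theorem norm_sq_toLp_sph {f : S2 → ℝ} (hf : MemLp f 2 sph) :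
    ‖hf.toLp f‖ ^ 2 = ∫ s, f s ^ 2 ∂sph := by
  rw [norm_sq_sph]
  refine integral_congr_ae ?_
  filter_upwards [hf.coeFn_toLp] with s hs
  rw [hs]

theorem integral_scatter_mul_self_le {g : ℝ} (hg : g ∈ Ico (0 : ℝ) 1) {f : S2 → ℝ}
    (hf : MemLp f 2 sph) :
    ∫ s, kernelFun (hgMap g hg) f s * f s ∂sph ≤ ∫ s, f s ^ 2 ∂sph := by
  rw [integral_scatter_mul_self_eq hg hf, ← norm_sq_toLp_sph hf, sq]
  exact (real_inner_le_norm _ _).trans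
    (mul_le_mul_of_nonneg_right (norm_hgOp_le hg _) (norm_nonneg _))

theorem integral_scatter_mul_self_le_mul {g : ℝ} (hg : g ∈ Ico (0 : ℝ) 1) {f : S2 → ℝ}
    (hf : MemLp f 2 sph) (h0 : ∫ s, f s ∂sph = 0) :
    ∫ s, kernelFun (hgMap g hg) f s * f s ∂sph ≤ g * ∫ s, f s ^ 2 ∂sph := by
  have hz : hgOp 0 zero_mem_Ico (hf.toLp f) = 0 := by
    refine Lp.ext ?_
    filter_upwards [coeFn_kernelOp (hgMap 0 zero_mem_Ico) (hf.toLp f),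
      Lp.coeFn_zero ℝ 2 sph] with s h1 h2
    rw [hgOp, h1, h2, kernelFun_congr _ hf.coeFn_toLp, kernelFun]
    simp only [hgMap_apply, hgKernel_zero]
    rw [integral_const_mul, h0, mul_zero, Pi.zero_apply]
  rw [integral_scatter_mul_self_eq hg hf, ← norm_sq_toLp_sph hf]
  -- The damping estimate was derived for `g > 0`; for `g = 0` scattering annihilates functions of
  -- mean zero outright.
  rcases eq_or_lt_of_le hg.1 with h | h
  · subst h
    rw [hz, inner_zero_left, zero_mul]
  · refine (real_inner_le_norm _ _).trans ?_
    have := mul_le_mul_of_nonneg_right (norm_hgOp_le_mul ⟨h, hg.2⟩ hz)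
      (norm_nonneg (hf.toLp f))
    linarith

/-! ### The operators `ℳ` and `𝒦` as quadratic forms -/

section Forms

variable {R : Opens E3} {σa σs : Lp ℝ ∞ ((volume : Measure E3).restrict (R : Set E3))} {g : ℝ}

theorem norm_sq_V (u : V R) : ‖u‖ ^ 2 = ∫ x, u x ^ 2 ∂phaseMeasure R := by
  rw [← real_inner_self_eq_norm_sq, L2.inner_def]
  refine integral_congr_ae (Filter.Eventually.of_forall fun s => ?_)
  simp [sq]

theorem inner_mulOp (σ : Lp ℝ ∞ ((volume : Measure E3).restrict (R : Set E3))) (u v : V R) :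
    inner ℝ (mulOp R σ u) v = ∫ x, σ x.1 * (u x * v x) ∂phaseMeasure R := by
  rw [L2.inner_def]
  refine integral_congr_ae ?_
  filter_upwards [coeFn_mulOp R σ u] with x hx
  rw [hx]
  simp
  ring

theorem integrable_coeff_mul (σ : Lp ℝ ∞ ((volume : Measure E3).restrict (R : Set E3)))
    (u v : V R) : Integrable (fun x => σ x.1 * (u x * v x)) (phaseMeasure R) := by
  refine ((Lp.memLp (mulOp R σ u)).integrable_mul (Lp.memLp v)).congr ?_
  filter_upwards [coeFn_mulOp R σ u] with x hx
  rw [Pi.mul_apply, hx]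
  ring

theorem inner_opM (u v : V R) : inner ℝ (opM R σa σs u) v =
    ∫ x, (σa x.1 + σs x.1) * (u x * v x) ∂phaseMeasure R := by
  rw [opM, inner_mulOp]
  have h := Measure.quasiMeasurePreserving_fst (ν := sph) |>.ae (Lp.coeFn_add σa σs)
  refine integral_congr_ae ?_
  filter_upwards [h] with x hx
  rw [hx, Pi.add_apply]

theorem inner_opM_comm (u v : V R) :
    inner ℝ (opM R σa σs u) v = inner ℝ u (opM R σa σs v) := by
  rw [real_inner_comm _ u, inner_opM, inner_opM]
  simp only [mul_comm (u _)]

theorem ae_phase_of_ae {p : E3 → Prop}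
    (h : ∀ᵐ r ∂(volume : Measure E3).restrict (R : Set E3), p r) :
    ∀ᵐ x ∂phaseMeasure R, p x.1 :=
  Measure.quasiMeasurePreserving_fst (ν := sph) |>.ae h

theorem integrable_opM_sq (u : V R) :
    Integrable (fun x => (σa x.1 + σs x.1) * (u x * u x)) (phaseMeasure R) :=
  ((integrable_coeff_mul σa u u).add (integrable_coeff_mul σs u u)).congr
    (Filter.Eventually.of_forall fun x => by simp only [Pi.add_apply]; ring)

theorem le_inner_opM {γ : ℝ}
    (hσs : ∀ᵐ r ∂(volume : Measure E3).restrict (R : Set E3), 0 ≤ σs r)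
    (hσa : ∀ᵐ r ∂(volume : Measure E3).restrict (R : Set E3), γ ≤ σa r) (u : V R) :
    γ * ‖u‖ ^ 2 ≤ inner ℝ (opM R σa σs u) u := by
  rw [inner_opM, norm_sq_V, ← integral_const_mul]
  refine integral_mono_ae ((Lp.memLp u).integrable_sq.const_mul _) (integrable_opM_sq u) ?_
  filter_upwards [ae_phase_of_ae hσs, ae_phase_of_ae hσa] with x h1 h2
  rw [← sq]
  exact mul_le_mul_of_nonneg_right (by linarith) (sq_nonneg _)

theorem integrable_opK_mul (u v : V R) :
    Integrable (fun x => σs x.1 * (scatterFun g u x * v x)) (phaseMeasure R) := by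
  refine (integrable_coeff_mul σs (scatter R g u) v).congr ?_
  filter_upwards [coeFn_scatter R g u] with x hx
  rw [hx]

theorem inner_opK_eq_integral (u v : V R) : inner ℝ (opK R σs g u) v =
    ∫ x, σs x.1 * (scatterFun g u x * v x) ∂phaseMeasure R := by
  rw [opK, ContinuousLinearMap.comp_apply, inner_mulOp]
  refine integral_congr_ae ?_
  filter_upwards [coeFn_scatter R g u] with x hx
  rw [hx]

/-- Fubini reduces the form of `𝒦` to scattering forms on the slices `{r} × S`, so symmetry,
positivity and the upper bounds can be proved on the sphere for almost every `r`. -/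
theorem inner_opK (hg : g ∈ Ico (0 : ℝ) 1) (u v : V R) : inner ℝ (opK R σs g u) v =
    ∫ r in (R : Set E3), σs r *
      ∫ s, kernelFun (hgMap g hg) (fun s' => u (r, s')) s * v (r, s) ∂sph := by
  rw [inner_opK_eq_integral, integral_prod _ (integrable_opK_mul u v)]
  simp only [integral_const_mul]
  rfl

theorem inner_opK_comm (hg : g ∈ Ico (0 : ℝ) 1) (u v : V R) :
    inner ℝ (opK R σs g u) v = inner ℝ u (opK R σs g v) := by
  rw [real_inner_comm _ u, inner_opK hg, inner_opK hg]
  refine integral_congr_ae ?_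
  filter_upwards [ae_memLp_slice R u, ae_memLp_slice R v] with r hu hv
  rw [integral_scatter_mul_comm hg (integrable_of_memLp_two hu) (integrable_of_memLp_two hv)]

theorem inner_opK_self_nonneg (hg : g ∈ Ico (0 : ℝ) 1)
    (hσs : ∀ᵐ r ∂(volume : Measure E3).restrict (R : Set E3), 0 ≤ σs r) (u : V R) :
    0 ≤ inner ℝ (opK R σs g u) u := by
  rw [inner_opK hg]
  refine integral_nonneg_of_ae ?_
  filter_upwards [ae_memLp_slice R u, hσs] with r hu hr
  exact mul_nonneg hr (integral_scatter_mul_self_nonneg hg (integrable_of_memLp_two hu))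

/-- The constant splits into an angular part `t`, from scattering on the sphere, and a spatial part
`c`, from `σₛ ≤ c σₜ`. It is used with `t = 1` on `𝕍` and `t = g` on `𝕍⁻`. -/
theorem inner_opK_self_le_of_slice (hg : g ∈ Ico (0 : ℝ) 1)
    (hσs : ∀ᵐ r ∂(volume : Measure E3).restrict (R : Set E3), 0 ≤ σs r) {c t : ℝ} (ht : 0 ≤ t)
    (hc : ∀ᵐ r ∂(volume : Measure E3).restrict (R : Set E3), σs r ≤ c * (σa r + σs r)) {u : V R}
    (hu : ∀ᵐ r ∂(volume : Measure E3).restrict (R : Set E3),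
      ∫ s, kernelFun (hgMap g hg) (fun s' => u (r, s')) s * u (r, s) ∂sph ≤
        t * ∫ s, u (r, s) ^ 2 ∂sph) :
    inner ℝ (opK R σs g u) u ≤ c * t * inner ℝ (opM R σa σs u) u := by
  have h1 := integrable_coeff_mul σs u u
  have h2 : inner ℝ (opK R σs g u) u ≤ t * ∫ x, σs x.1 * (u x * u x) ∂phaseMeasure R := by
    rw [inner_opK hg, integral_prod _ h1, ← integral_const_mul]
    refine integral_mono_ae ?_ (h1.integral_prod_left.const_mul t) ?_
    · refine (integrable_opK_mul (σs := σs) (g := g) u u).integral_prod_left.congr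
        (Filter.Eventually.of_forall fun r => ?_)
      simp only [integral_const_mul]
      rfl
    · filter_upwards [hu, hσs] with r hr h0
      simp only [integral_const_mul]
      have := mul_le_mul_of_nonneg_left hr h0
      simp only [sq] at this
      linarith
  refine h2.trans ?_
  rw [inner_opM, mul_comm c t, mul_assoc, ← integral_const_mul c]
  refine mul_le_mul_of_nonneg_left ?_ ht
  refine integral_mono_ae h1 ((integrable_opM_sq u).const_mul c) ?_
  filter_upwards [ae_phase_of_ae hc] with x hx
  have := mul_le_mul_of_nonneg_right hx (mul_self_nonneg (u x))
  linarith

theorem inner_opK_self_le (hg : g ∈ Ico (0 : ℝ) 1)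
    (hσs : ∀ᵐ r ∂(volume : Measure E3).restrict (R : Set E3), 0 ≤ σs r) {c : ℝ}
    (hc : ∀ᵐ r ∂(volume : Measure E3).restrict (R : Set E3), σs r ≤ c * (σa r + σs r)) (u : V R) :
    inner ℝ (opK R σs g u) u ≤ c * inner ℝ (opM R σa σs u) u := by
  have := inner_opK_self_le_of_slice (u := u) hg hσs zero_le_one hc (by
    filter_upwards [ae_memLp_slice R u] with r hr
    rw [one_mul]
    exact integral_scatter_mul_self_le hg hr)
  rwa [mul_one] at this

/-- The reflection `s ↦ -s` preserves surface measure and reverses the sign of an odd function. This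
makes the mean-zero damping estimate available on `𝕍⁻`. -/
theorem ae_integral_slice_eq_zero {u : V R} (hu : u ∈ VOdd R) :
    ∀ᵐ r ∂(volume : Measure E3).restrict (R : Set E3), ∫ s, u (r, s) ∂sph = 0 := by
  have hu' : reflection R u = -u := hu
  have h1 : ∀ᵐ x ∂phaseMeasure R, u (reflect x) = -u x := by
    have h2 := coeFn_reflection R u
    rw [hu'] at h2
    filter_upwards [h2, Lp.coeFn_neg u] with x h3 h4
    rw [← h3, h4, Pi.neg_apply]
  filter_upwards [Measure.ae_ae_of_ae_prod h1] with r hr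
  have e : ∫ s, u (r, -s) ∂sph = ∫ s, u (r, s) ∂sph :=
    measurePreserving_neg_sph.integral_comp (MeasurableEquiv.neg S2).measurableEmbedding
      fun s : S2 => u (r, s)
  have e2 : ∫ s, u (r, -s) ∂sph = ∫ s, -u (r, s) ∂sph := integral_congr_ae hr
  rw [integral_neg] at e2
  linarith

theorem inner_opK_self_le_of_odd (hg : g ∈ Ico (0 : ℝ) 1)
    (hσs : ∀ᵐ r ∂(volume : Measure E3).restrict (R : Set E3), 0 ≤ σs r) {c : ℝ}
    (hc : ∀ᵐ r ∂(volume : Measure E3).restrict (R : Set E3), σs r ≤ c * (σa r + σs r)) {u : V R}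
    (hu : u ∈ VOdd R) : inner ℝ (opK R σs g u) u ≤ c * g * inner ℝ (opM R σa σs u) u :=
  inner_opK_self_le_of_slice hg hσs hg.1 hc <| by
    filter_upwards [ae_memLp_slice R u, ae_integral_slice_eq_zero hu] with r hr h0
    exact integral_scatter_mul_self_le_mul hg hr h0

theorem ae_abs_le_norm (σ : Lp ℝ ∞ ((volume : Measure E3).restrict (R : Set E3))) :
    ∀ᵐ r ∂(volume : Measure E3).restrict (R : Set E3), |σ r| ≤ ‖σ‖ := by
  have h := ae_le_eLpNormEssSup (f := σ) (μ := (volume : Measure E3).restrict (R : Set E3))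
  filter_upwards [h] with r hr
  rw [Lp.norm_def, eLpNorm_exponent_top, ← Real.norm_eq_abs, ← toReal_enorm]
  refine ENNReal.toReal_mono ?_ hr
  have := Lp.eLpNorm_ne_top σ
  rwa [eLpNorm_exponent_top] at this

/-- The albedo is less than `1` and bounds the scattering ratio. -/
theorem albedo_spec {γ : ℝ} (hγ : 0 < γ)
    (hσs : ∀ᵐ r ∂(volume : Measure E3).restrict (R : Set E3), 0 ≤ σs r)
    (hσa : ∀ᵐ r ∂(volume : Measure E3).restrict (R : Set E3), γ ≤ σa r) :
    0 ≤ albedo R σa σs ∧ albedo R σa σs < 1 ∧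
      ∀ᵐ r ∂(volume : Measure E3).restrict (R : Set E3),
        σs r ≤ albedo R σa σs * (σa r + σs r) := by
  set q : E3 → ℝ := fun r => σs r / (σa r + σs r) with hq
  -- The ratio `σₛ / (σₐ + σₛ)` increases in `σₛ` and decreases in `σₐ`, so its worst case is `σₛ =
  -- ‖σs‖`, `σₐ = γ`. This bound is uniformly below `1`.
  set d : ℝ := ‖σs‖ / (γ + ‖σs‖) with hd
  have hden : 0 < γ + ‖σs‖ := by positivity
  have hd0 : 0 ≤ d := by positivity
  have hd1 : d < 1 := by
    rw [hd, div_lt_one hden]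
    linarith
  have hqd : ∀ᵐ r ∂(volume : Measure E3).restrict (R : Set E3), ‖q r‖ ≤ d := by
    filter_upwards [hσs, hσa, ae_abs_le_norm σs] with r h1 h2 h3
    have h4 : 0 < σa r + σs r := by linarith
    rw [abs_of_nonneg h1] at h3
    rw [Real.norm_eq_abs, abs_of_nonneg (div_nonneg h1 h4.le), hd, div_le_div_iff₀ h4 hden]
    nlinarith [mul_le_mul_of_nonneg_left h3 hγ.le, mul_le_mul_of_nonneg_left h2 (norm_nonneg σs)]
  have hle : eLpNorm q ∞ ((volume : Measure E3).restrict (R : Set E3)) ≤ ENNReal.ofReal d := by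
    rw [eLpNorm_exponent_top]
    exact eLpNormEssSup_le_of_ae_bound hqd
  have hne : eLpNorm q ∞ ((volume : Measure E3).restrict (R : Set E3)) ≠ ⊤ :=
    ne_top_of_le_ne_top ENNReal.ofReal_ne_top hle
  refine ⟨ENNReal.toReal_nonneg, ?_, ?_⟩
  · refine lt_of_le_of_lt ?_ hd1
    exact ENNReal.toReal_le_of_le_ofReal hd0 hle
  · have h := ae_le_eLpNormEssSup (f := q) (μ := (volume : Measure E3).restrict (R : Set E3))
    filter_upwards [h, hσs, hσa] with r hr h1 h2
    have h4 : 0 < σa r + σs r := by linarith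
    rw [← eLpNorm_exponent_top] at hr
    have h5 := ENNReal.toReal_mono hne hr
    rw [toReal_enorm, Real.norm_eq_abs, abs_of_nonneg (div_nonneg h1 h4.le),
      div_le_iff₀ h4] at h5
    exact h5

end Forms

end RTE

namespace RTE

/-! ### The surface measure of a bounded convex set -/

/-- The surface of the cube of half-width `M`. -/
def cubeSurface (M : ℝ) : Set E3 := {y | ‖WithLp.ofLp y‖ = M}

theorem hausdorffMeasure_cubeSurface_lt_top (M : ℝ) : μH[2] (cubeSurface M) < ⊤ := by
  -- Each of the six faces is a Lipschitz image of a square in the plane, where two-dimensional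
  -- Hausdorff measure is Lebesgue measure.
  set F : Fin 3 → ℝ → (Fin 2 → ℝ) → E3 := fun i c z =>
    WithLp.toLp 2 (Fin.insertNth (α := fun _ => ℝ) i c z) with hF
  have hlip : ∀ i c, ∃ K, LipschitzWith K (F i c) := by
    intro i c
    have h1 : LipschitzWith 1 fun z : Fin 2 → ℝ => Fin.insertNth (α := fun _ => ℝ) i c z := by
      refine LipschitzWith.of_dist_le_mul fun z z' => ?_
      rw [NNReal.coe_one, one_mul, dist_pi_le_iff dist_nonneg]
      intro j
      refine Fin.succAboveCases i ?_ (fun k => ?_) j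
      · simp
      · simpa using dist_le_pi_dist z z' k
    exact ⟨_, (PiLp.lipschitzWith_toLp 2 fun _ : Fin 3 => ℝ).comp h1⟩
  have hfin : ∀ i c, μH[2] (F i c '' Metric.closedBall 0 M) < ⊤ := by
    intro i c
    obtain ⟨K, hK⟩ := hlip i c
    refine (hK.hausdorffMeasure_image_le (by norm_num) _).trans_lt ?_
    refine ENNReal.mul_lt_top (ENNReal.rpow_lt_top_of_nonneg (by norm_num) ENNReal.coe_ne_top) ?_
    have e : (μH[2] : Measure (Fin 2 → ℝ)) = volume := by
      have := hausdorffMeasure_pi_real (ι := Fin 2)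
      simpa using this
    rw [e]
    exact (isCompact_closedBall _ _).measure_lt_top
  have hsub : cubeSurface M ⊆
      ⋃ i : Fin 3, (F i M '' Metric.closedBall 0 M ∪ F i (-M) '' Metric.closedBall 0 M) := by
    intro y hy
    have hy' : ‖WithLp.ofLp y‖ = M := hy
    obtain ⟨i, hi⟩ : ∃ i, ‖y i‖ = M := by
      by_contra hcon
      push Not at hcon
      have h1 : ∀ i, ‖y i‖ < M := fun i =>
        lt_of_le_of_ne ((norm_le_pi_norm (WithLp.ofLp y) i).trans_eq hy') (hcon i)
      have h2 : 0 < M := (norm_nonneg _).trans_lt (h1 0)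
      exact absurd hy' ((pi_norm_lt_iff h2).2 h1).ne
    refine mem_iUnion.2 ⟨i, ?_⟩
    have hz : Fin.removeNth (α := fun _ => ℝ) i (WithLp.ofLp y) ∈
        Metric.closedBall (0 : Fin 2 → ℝ) M := by
      rw [mem_closedBall_zero_iff, pi_norm_le_iff_of_nonneg (hy' ▸ norm_nonneg _)]
      exact fun j => (norm_le_pi_norm (WithLp.ofLp y) _).trans_eq hy'
    have hrec : F i (y i) (Fin.removeNth (α := fun _ => ℝ) i (WithLp.ofLp y)) = y := by
      simp only [hF]
      rw [Fin.insertNth_self_removeNth]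
    rw [Real.norm_eq_abs] at hi
    rcases eq_or_eq_neg_of_abs_eq hi with h | h
    · exact Or.inl ⟨_, hz, by rw [← h, hrec]⟩
    · exact Or.inr ⟨_, hz, by rw [← h, hrec]⟩
  refine (measure_mono hsub).trans_lt ?_
  refine (measure_iUnion_le _).trans_lt ?_
  rw [tsum_fintype, ENNReal.sum_lt_top]
  exact fun i _ => (measure_union_le _ _).trans_lt (ENNReal.add_lt_top.2 ⟨hfin i M, hfin i (-M)⟩)

/-- Every boundary point of a convex open set admits an outer normal. -/
theorem exists_outer_normal {R : Set E3} (hR : IsOpen R) (hne : R.Nonempty) (hconv : Convex ℝ R)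
    {x : E3} (hx : x ∈ frontier R) :
    ∃ ν : E3, ν ≠ 0 ∧ ∀ y ∈ closure R, inner ℝ (y - x) ν ≤ 0 := by
  have hxR : x ∉ R := by
    rw [hR.frontier_eq] at hx
    exact hx.2
  obtain ⟨f, hf⟩ := geometric_hahn_banach_open_point hconv hR hxR
  set ν := (InnerProductSpace.toDual ℝ E3).symm f with hν
  have hfν : ∀ y, inner ℝ y ν = f y := fun y => by
    rw [real_inner_comm, hν, InnerProductSpace.toDual_symm_apply]
  refine ⟨ν, fun h0 => ?_, fun y hy => ?_⟩
  · obtain ⟨y, hy⟩ := hne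
    have := hf y hy
    rw [← hfν, ← hfν, h0, inner_zero_right, inner_zero_right] at this
    exact lt_irrefl _ this
  · have hcl : closure R ⊆ {y | inner ℝ (y - x) ν ≤ 0} :=
      closure_minimal (fun y hy => by
        change inner ℝ (y - x) ν ≤ 0
        rw [inner_sub_left, hfν, hfν]
        linarith [hf y hy]) (isClosed_le (by fun_prop) continuous_const)
    exact hcl hy

/-- A ray starting inside a cube meets the surface of the cube. -/
theorem exists_ray_mem_cubeSurface {M : ℝ} {x ν : E3} (hν : ν ≠ 0)
    (hx : ‖WithLp.ofLp x‖ ≤ M) : ∃ t : ℝ, 0 ≤ t ∧ x + t • ν ∈ cubeSurface M := by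
  obtain ⟨i, hi⟩ : ∃ i, ν i ≠ 0 := by
    by_contra hcon
    push Not at hcon
    exact hν (PiLp.ext hcon)
  have hM : 0 ≤ M := (norm_nonneg _).trans hx
  have hi' : 0 < |ν i| := abs_pos.2 hi
  -- By the time `T` the `i`-th coordinate has moved by `2 M`, hence has absolute value at least
  -- `M`; the intermediate value theorem gives the crossing.
  set T := 2 * M / |ν i| with hT
  have hT0 : 0 ≤ T := by positivity
  have hc : Continuous fun t : ℝ => ‖WithLp.ofLp (x + t • ν)‖ := by fun_prop
  have h0 : ‖WithLp.ofLp (x + (0 : ℝ) • ν)‖ ≤ M := by simpa using hx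
  have h1 : M ≤ ‖WithLp.ofLp (x + T • ν)‖ := by
    refine le_trans ?_ (norm_le_pi_norm _ i)
    have e : WithLp.ofLp (x + T • ν) i = x i + T * ν i := by simp
    rw [e, Real.norm_eq_abs]
    have e1 : |T * ν i| = 2 * M := by
      rw [abs_mul, abs_of_nonneg hT0, hT]
      field_simp
    have e2 : |x i| ≤ M := (norm_le_pi_norm (WithLp.ofLp x) i).trans hx
    have e3 := abs_sub_abs_le_abs_sub (T * ν i) (-x i)
    rw [abs_neg, sub_neg_eq_add, e1, add_comm] at e3
    linarith
  obtain ⟨t, ht, he⟩ := intermediate_value_Icc hT0 hc.continuousOn ⟨h0, h1⟩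
  exact ⟨t, ht.1, he⟩

/-- From each boundary point one follows an outer normal until it meets the surface of an enclosing
cube. The boundary point is the nearest point of the closed convex set to the point reached, and
nearest-point maps do not increase distances. So `∂R` is a nonexpansive image of a subset of the
cube surface. -/
theorem euclideanHausdorffMeasure_frontier_lt_top {R : Set E3} (hR : IsOpen R)
    (hne : R.Nonempty) (hconv : Convex ℝ R) (hbdd : Bornology.IsBounded R) :
    (μHE[2] : Measure E3) (frontier R) < ⊤ := by
  obtain ⟨M, hM⟩ := hbdd.closure.exists_norm_le
  have hsup : ∀ x ∈ frontier R, ‖WithLp.ofLp x‖ ≤ M := fun x hx => by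
    refine le_trans ?_ (hM x (frontier_subset_closure hx))
    rw [pi_norm_le_iff_of_nonneg (norm_nonneg _)]
    exact fun i => PiLp.norm_apply_le x i
  have hex : ∀ x : frontier R, ∃ y : E3, y ∈ cubeSurface M ∧
      ∀ z ∈ closure R, inner ℝ (z - x) (y - x) ≤ 0 := by
    rintro ⟨x, hx⟩
    obtain ⟨ν, hν, hn⟩ := exists_outer_normal hR hne hconv hx
    obtain ⟨t, ht, hy⟩ := exists_ray_mem_cubeSurface hν (hsup x hx)
    refine ⟨_, hy, fun z hz => ?_⟩
    rw [add_sub_cancel_left, inner_smul_right]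
    exact mul_nonpos_of_nonneg_of_nonpos ht (hn z hz)
  choose p hp hpn using hex
  -- The usual proof that the metric projection is nonexpansive: adding the two variational
  -- inequalities gives `‖x - x'‖² ≤ (x - x', p x - p x')`, and Cauchy–Schwarz finishes.
  have hanti : AntilipschitzWith 1 p := by
    refine AntilipschitzWith.of_le_mul_dist fun x x' => ?_
    rw [NNReal.coe_one, one_mul, Subtype.dist_eq, dist_eq_norm, dist_eq_norm]
    have h1 := hpn x x' (frontier_subset_closure x'.2)
    have h2 := hpn x' x (frontier_subset_closure x.2)
    have h3 : ‖(x : E3) - x'‖ ^ 2 ≤ inner ℝ ((x : E3) - x') (p x - p x') := by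
      rw [← real_inner_self_eq_norm_sq]
      have e : inner ℝ ((x : E3) - x') (p x - p x') =
          inner ℝ ((x : E3) - x') ((x : E3) - x') - inner ℝ ((x' : E3) - x) (p x - x) -
            inner ℝ ((x : E3) - x') (p x' - x') := by
        simp only [inner_sub_left, inner_sub_right]
        ring
      linarith
    have h4 := h3.trans (real_inner_le_norm _ _)
    rcases eq_or_lt_of_le (norm_nonneg ((x : E3) - x')) with h | h
    · rw [← h]
      exact norm_nonneg _
    · rw [sq] at h4
      exact le_of_mul_le_mul_left h4 h
  have hH : μH[2] (frontier R) < ⊤ := by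
    have e : frontier R = ((↑) : frontier R → E3) '' univ := by simp
    rw [e, isometry_subtype_coe.hausdorffMeasure_image (Or.inl (by norm_num))]
    refine (hanti.le_hausdorffMeasure_image (by norm_num) univ).trans_lt ?_
    rw [ENNReal.coe_one, ENNReal.one_rpow, one_mul]
    refine (measure_mono ?_).trans_lt (hausdorffMeasure_cubeSurface_lt_top M)
    rintro _ ⟨x, -, rfl⟩
    exact hp x
  rw [Measure.euclideanHausdorffMeasure_def]
  exact ENNReal.mul_lt_top ENNReal.coe_lt_top (by exact_mod_cast hH)

/-! ### Finiteness of the flux measure -/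

theorem norm_outerNormal_le (R : Set E3) (r : E3) : ‖outerNormal R r‖ ≤ 1 := by
  unfold outerNormal
  split_ifs with h
  · exact h.choose_spec.1.1.le
  · simp

theorem abs_normalComp_le (R : Opens E3) (x : E3 × S2) : |normalComp R x| ≤ 1 := by
  refine (abs_real_inner_le_norm _ _).trans ?_
  have := norm_outerNormal_le R x.1
  simpa using this

theorem isFiniteMeasure_fluxMeasure {R : Opens E3}
    (h : (μHE[2] : Measure E3) (frontier (R : Set E3)) < ⊤) : IsFiniteMeasure (fluxMeasure R) := by
  have : IsFiniteMeasure ((μHE[2] : Measure E3).restrict (frontier (R : Set E3))) :=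
    ⟨by rwa [Measure.restrict_apply_univ]⟩
  have hle : fluxMeasure R ≤ bdryMeasure R := by
    calc fluxMeasure R ≤ (bdryMeasure R).withDensity 1 :=
          withDensity_mono (Filter.Eventually.of_forall fun x => by
            rw [Pi.one_apply, ← ENNReal.ofReal_one]
            exact ENNReal.ofReal_le_ofReal (abs_normalComp_le R x))
      _ = bdryMeasure R := withDensity_one
  exact isFiniteMeasure_of_le _ hle

/-! ### Completeness of `𝕎⁺` -/

section Complete

variable {R : Opens E3}

theorem tendsto_integral_mul_of_tendsto {α : Type*} [MeasurableSpace α] {μ : Measure α}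
    {v : ℕ → Lp ℝ 2 μ} {u : Lp ℝ 2 μ} (h : Filter.Tendsto v Filter.atTop (nhds u)) {ψ : α → ℝ}
    (hψ : MemLp ψ 2 μ) :
    Filter.Tendsto (fun n => ∫ x, v n x * ψ x ∂μ) Filter.atTop (nhds (∫ x, u x * ψ x ∂μ)) := by
  have e : ∀ w : Lp ℝ 2 μ, ∫ x, w x * ψ x ∂μ = inner ℝ w (hψ.toLp ψ) := fun w => by
    rw [L2.inner_def]
    refine integral_congr_ae ?_
    filter_upwards [hψ.coeFn_toLp] with x hx
    rw [hx]
    simp [mul_comm]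
  simp only [e]
  exact h.inner tendsto_const_nhds

/-- For a fixed test function both sides of the defining identity are `L²` pairings, hence
continuous: the weak streaming derivative is a closed operator. -/
theorem IsWeakStream.of_tendsto {w a : ℕ → V R} {w' a' : V R}
    (hw : Filter.Tendsto w Filter.atTop (nhds w')) (ha : Filter.Tendsto a Filter.atTop (nhds a'))
    (h : ∀ n, IsWeakStream R (w n) (a n)) : IsWeakStream R w' a' := by
  intro φ h1 h2 h3
  refine tendsto_nhds_unique (tendsto_integral_mul_of_tendsto hw (memLp_streamDeriv R h1 h2)) ?_
  simp only [fun n => h n φ h1 h2 h3]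
  exact (tendsto_integral_mul_of_tendsto ha (memLp_test R h1 h2)).neg

/-- The sign of `s · n`. -/
noncomputable def normalSign (R : Opens E3) (x : E3 × S2) : ℝ :=
  if 0 ≤ normalComp R x then 1 else -1

theorem measurable_normalSign (R : Opens E3) : Measurable (normalSign R) :=
  Measurable.ite (measurableSet_le measurable_const (measurable_normalComp R)) measurable_const
    measurable_const

theorem abs_mul_normalSign (R : Opens E3) (x : E3 × S2) :
    |normalComp R x| * normalSign R x = normalComp R x := by
  unfold normalSign
  split_ifs with h
  · rw [abs_of_nonneg h, mul_one]
  · rw [abs_of_neg (not_le.1 h)]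
    ring

/-- Green's formula carries the signed weight `s · n`, the trace space the weight `|s · n|`. Moving
the sign into the integrand makes the boundary term a pairing in `L²` of the flux measure,
continuous in the trace. -/
theorem integral_mul_normalComp (R : Opens E3) (f : E3 × S2 → ℝ) :
    ∫ x, f x * normalComp R x ∂bdryMeasure R = ∫ x, f x * normalSign R x ∂fluxMeasure R := by
  rw [fluxMeasure, integral_withDensity_eq_integral_toReal_smul
    (measurable_normalComp R).abs.ennreal_ofReal
    (Filter.Eventually.of_forall fun _ => ENNReal.ofReal_lt_top)]
  refine integral_congr_ae (Filter.Eventually.of_forall fun x => ?_)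
  simp only [smul_eq_mul]
  rw [ENNReal.toReal_ofReal (abs_nonneg _), ← abs_mul_normalSign R x]
  simp only [abs_mul_normalSign]
  rw [mul_left_comm, abs_mul_normalSign]

theorem memLp_test_normalSign [IsFiniteMeasure (fluxMeasure R)] {φ : E3 × E3 → ℝ}
    (hφ : ContDiff ℝ ∞ φ) (hc : HasCompactSupport φ) :
    MemLp (fun x => φ (incl x) * normalSign R x) 2 (fluxMeasure R) := by
  obtain ⟨C, hC⟩ := hφ.continuous.bounded_above_of_compact_support hc
  refine MemLp.of_bound (C := C) ?_ (Filter.Eventually.of_forall fun x => ?_)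
  · exact ((hφ.continuous.comp isClosedEmbedding_incl.continuous).measurable.mul
      (measurable_normalSign R)).aestronglyMeasurable
  · have : ‖normalSign R x‖ = 1 := by
      unfold normalSign
      split_ifs <;> simp
    rw [norm_mul, this, mul_one]
    exact hC _

/-- Green's formula passes to the limit term by term. Finiteness of the flux measure enters twice:
it makes the limit trace integrable, and the bounded test functions square integrable. -/
theorem IsBdryTrace.of_tendsto [IsFiniteMeasure (fluxMeasure R)] {w a : ℕ → V R} {w' a' : V R}
    {t : ℕ → Lp ℝ 2 (fluxMeasure R)} {t' : Lp ℝ 2 (fluxMeasure R)}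
    (hw : Filter.Tendsto w Filter.atTop (nhds w')) (ha : Filter.Tendsto a Filter.atTop (nhds a'))
    (ht : Filter.Tendsto t Filter.atTop (nhds t')) (h : ∀ n, IsBdryTrace R (w n) (a n) (t n)) :
    IsBdryTrace R w' a' t' := by
  refine ⟨(Lp.memLp t').integrable (by norm_num), fun φ h1 h2 => ?_⟩
  have e : ∀ f : E3 × S2 → ℝ, ∫ x, f x * φ (incl x) * normalComp R x ∂bdryMeasure R =
      ∫ x, f x * (φ (incl x) * normalSign R x) ∂fluxMeasure R := fun f => by
    rw [integral_mul_normalComp R (fun x => f x * φ (incl x))]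
    simp only [mul_assoc]
  have hl := tendsto_integral_mul_of_tendsto ht (memLp_test_normalSign h1 h2)
  simp only [← e] at hl
  refine tendsto_nhds_unique ?_ hl
  simp only [fun n => ((h n).2 φ h1 h2).symm]
  have e2 : ∀ v b : V R, ∫ x, (b x * φ (incl x) + v x * streamDeriv φ x) ∂phaseMeasure R =
      ∫ x, b x * φ (incl x) ∂phaseMeasure R + ∫ x, v x * streamDeriv φ x ∂phaseMeasure R :=
    fun v b => integral_add (integrable_mul_test R h1 h2 b) (integrable_mul_streamDeriv R h1 h2 v)
  simp only [e2]
  exact (tendsto_integral_mul_of_tendsto ha (memLp_test R h1 h2)).add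
    (tendsto_integral_mul_of_tendsto hw (memLp_streamDeriv R h1 h2))

theorem norm_sq_trace (w : WPlus R) :
    ‖trace R w‖ ^ 2 = 2 * ∫ x in inflow R, traceVal R w x ^ 2 ∂fluxMeasure R := by
  rw [← integral_traceVal_sq, ← real_inner_self_eq_norm_sq, L2.inner_def]
  refine integral_congr_ae ?_
  filter_upwards [MemLp.coeFn_toLp (memLp_traceVal R w)] with x hx
  have h3 : trace R w x = traceVal R w x := hx
  simp [h3, sq]

/-- By evenness the inflow and outflow parts of the trace carry the same energy, whence the factor
`1/2`. -/
theorem norm_sq_eq_WPlus (w : WPlus R) :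
    ‖w‖ ^ 2 = ‖toV R w‖ ^ 2 + ‖transport R w‖ ^ 2 + ‖trace R w‖ ^ 2 / 2 := by
  rw [norm_sq_WPlus, norm_sq_trace]
  have e1 : toVₗ R w = toV R w := rfl
  have e2 : transportₗ R w = transport R w := rfl
  rw [e1, e2]
  ring

/-- Closedness of the graph of `w ↦ (w, s · ∇_r w, w|_{∂D})` on even functions. Uniqueness of the
weak derivative and of the trace identifies the limits with the chosen representatives. -/
theorem exists_WPlus_of_tendsto [IsFiniteMeasure (fluxMeasure R)] {w : ℕ → WPlus R} {u a : V R}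
    {t : Lp ℝ 2 (fluxMeasure R)} (hu : Filter.Tendsto (fun n => toV R (w n)) Filter.atTop (nhds u))
    (ha : Filter.Tendsto (fun n => (transport R (w n) : V R)) Filter.atTop (nhds a))
    (ht : Filter.Tendsto (fun n => trace R (w n)) Filter.atTop (nhds t)) :
    ∃ w' : WPlus R, toV R w' = u ∧ (transport R w' : V R) = a ∧ trace R w' = t := by
  have h1 : IsWeakStream R u a :=
    IsWeakStream.of_tendsto hu ha fun n => isWeakStream_streamVal R (w n)
  have htr : ∀ w : WPlus R, trace R w =ᵐ[fluxMeasure R] traceVal R w := fun w =>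
    MemLp.coeFn_toLp (memLp_traceVal R w)
  have hcongr : ∀ w : WPlus R, IsBdryTrace R (toV R w) (transport R w : V R) (trace R w) := by
    intro w
    have h := isBdryTrace_traceVal R w
    refine ⟨h.1.congr (htr w).symm, fun φ e1 e2 => (h.2 φ e1 e2).trans ?_⟩
    rw [integral_mul_normalComp R (fun x => traceVal R w x * φ (incl x)),
      integral_mul_normalComp R (fun x => trace R w x * φ (incl x))]
    refine integral_congr_ae ?_
    filter_upwards [htr w] with x hx
    rw [hx]
  have h2 : IsBdryTrace R u a t := IsBdryTrace.of_tendsto hu ha ht fun n => hcongr (w n)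
  have h3 : reflection R u = u := by
    refine tendsto_nhds_unique (((reflection R).continuous.tendsto u).comp hu) ?_
    refine hu.congr fun n => ?_
    exact (toVₗ_even R (w n)).symm
  set w' : WPlus R := ⟨u, ⟨a, h1, t, h2, (Lp.memLp t).restrict _⟩, h3⟩ with hw'
  have e1 : toV R w' = u := rfl
  have e2 : (transport R w' : V R) = a := isWeakStream_unique (isWeakStream_streamVal R w') h1
  refine ⟨w', e1, e2, Lp.ext ((htr w').trans ?_)⟩
  have h4 := isBdryTrace_traceVal R w'
  have e3 : streamVal R w' = a := e2
  rw [e3] at h4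
  exact isBdryTrace_unique h4 h2

theorem completeSpace_WPlus [IsFiniteMeasure (fluxMeasure R)] : CompleteSpace (WPlus R) := by
  refine Metric.complete_of_cauchySeq_tendsto fun w hw => ?_
  obtain ⟨u, hu⟩ := cauchySeq_tendsto_of_complete ((toV R).uniformContinuous.comp_cauchySeq hw)
  obtain ⟨a, ha⟩ := cauchySeq_tendsto_of_complete
    (((VOdd R).subtypeL ∘L transport R).uniformContinuous.comp_cauchySeq hw)
  obtain ⟨t, ht⟩ := cauchySeq_tendsto_of_complete ((trace R).uniformContinuous.comp_cauchySeq hw)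
  obtain ⟨w', e1, e2, e3⟩ := exists_WPlus_of_tendsto hu ha ht
  refine ⟨w', tendsto_iff_norm_sub_tendsto_zero.2 ?_⟩
  -- The three components of a Cauchy sequence converge separately in complete spaces; their squared
  -- errors now recombine to the squared norm of `𝕎⁺`.
  have h1 : Filter.Tendsto (fun n => ‖toV R (w n - w')‖ ^ 2) Filter.atTop (nhds 0) := by
    simp only [map_sub, e1]
    have := (tendsto_iff_norm_sub_tendsto_zero.1 hu).pow 2
    simpa using this
  have h2 : Filter.Tendsto (fun n => ‖transport R (w n - w')‖ ^ 2) Filter.atTop (nhds 0) := by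
    have e : ∀ n, ‖transport R (w n - w')‖ = ‖(transport R (w n) : V R) - a‖ := fun n => by
      rw [map_sub, ← e2]
      rfl
    simp only [e]
    have := (tendsto_iff_norm_sub_tendsto_zero.1 ha).pow 2
    simpa using! this
  have h3 : Filter.Tendsto (fun n => ‖trace R (w n - w')‖ ^ 2) Filter.atTop (nhds 0) := by
    simp only [map_sub, e3]
    have := (tendsto_iff_norm_sub_tendsto_zero.1 ht).pow 2
    simpa using this
  have h4 : Filter.Tendsto (fun n => ‖w n - w'‖ ^ 2) Filter.atTop (nhds 0) := by
    have := (h1.add h2).add (h3.div_const 2)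
    simp only [← norm_sq_eq_WPlus] at this
    simpa using this
  have h5 := h4.sqrt
  simpa using h5

end Complete

end RTE

namespace RTE

/-! ### The even-parity operators -/

section EvenParity

variable {R : Opens E3} {σa σs : Lp ℝ ∞ ((volume : Measure E3).restrict (R : Set E3))} {g γ c : ℝ}

instance completeSpace_VOdd : CompleteSpace (VOdd R) := by
  have : IsClosed (VOdd R : Set (V R)) :=
    isClosed_eq (f := fun v => reflection R v) (g := fun v => -v) (reflection R).continuous
      continuous_neg
  exact this.completeSpace_coe

theorem inner_opMOdd (v w : VOdd R) :
    inner ℝ (opMOdd R σa σs v) w = inner ℝ (opM R σa σs v) (w : V R) := rfl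

theorem inner_opMKOdd (v w : VOdd R) : inner ℝ (opMKOdd R σa σs g v) w =
    inner ℝ (opM R σa σs v) (w : V R) - inner ℝ (opK R σs g v) (w : V R) := by
  change inner ℝ (opM R σa σs (v : V R) - opK R σs g (v : V R)) (w : V R) = _
  exact inner_sub_left _ _ _

theorem inner_opMOdd_comm (v w : VOdd R) :
    inner ℝ (opMOdd R σa σs v) w = inner ℝ v (opMOdd R σa σs w) :=
  inner_opM_comm _ _

theorem inner_opMKOdd_comm (hg : g ∈ Ico (0 : ℝ) 1) (v w : VOdd R) :
    inner ℝ (opMKOdd R σa σs g v) w = inner ℝ v (opMKOdd R σa σs g w) := by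
  rw [inner_opMKOdd, real_inner_comm _ v, inner_opMKOdd, inner_opM_comm, inner_opK_comm hg,
    real_inner_comm _ (v : V R), real_inner_comm _ (v : V R)]

theorem opE_apply (v w : WPlus R) : opE R σa σs g v w = inner ℝ (trace R v) (trace R w) +
    inner ℝ ((opMKOdd R σa σs g).inverse (transport R v)) (transport R w) +
    inner ℝ (opM R σa σs (toV R v)) (toV R w) := rfl

theorem opE0_apply (v w : WPlus R) : opE0 R σa σs g v w = (1 - albedo R σa σs * g)⁻¹ *
    inner ℝ ((opMOdd R σa σs).inverse (transport R v)) (transport R w) +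
    inner ℝ (opM R σa σs (toV R v)) (toV R w) + inner ℝ (trace R v) (trace R w) := rfl

theorem opKEven_apply (v w : WPlus R) :
    opKEven R σs g v w = inner ℝ (opK R σs g (toV R v)) (toV R w) := rfl

/-- The assumptions on the coefficients, with `c` the albedo. -/
structure Admissible (σa σs : Lp ℝ ∞ ((volume : Measure E3).restrict (R : Set E3)))
    (g γ c : ℝ) : Prop where
  g_mem : g ∈ Ico (0 : ℝ) 1
  gamma_pos : 0 < γ
  scatter_nonneg : ∀ᵐ r ∂(volume : Measure E3).restrict (R : Set E3), 0 ≤ σs r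
  absorb_le : ∀ᵐ r ∂(volume : Measure E3).restrict (R : Set E3), γ ≤ σa r
  c_nonneg : 0 ≤ c
  c_lt_one : c < 1
  ratio_le : ∀ᵐ r ∂(volume : Measure E3).restrict (R : Set E3), σs r ≤ c * (σa r + σs r)

namespace Admissible

variable (H : Admissible σa σs g γ c)

include H

theorem one_sub_mul_pos : 0 < 1 - c * g := by
  nlinarith [H.c_nonneg, H.c_lt_one, H.g_mem.1, H.g_mem.2]

theorem le_opMOdd (v : VOdd R) : γ * ‖v‖ ^ 2 ≤ inner ℝ (opMOdd R σa σs v) v :=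
  le_inner_opM H.scatter_nonneg H.absorb_le (v : V R)

theorem opMOdd_self_nonneg (v : VOdd R) : 0 ≤ inner ℝ (opMOdd R σa σs v) v :=
  (mul_nonneg H.gamma_pos.le (sq_nonneg _)).trans (H.le_opMOdd v)

theorem opMKOdd_le (v : VOdd R) :
    inner ℝ (opMKOdd R σa σs g v) v ≤ inner ℝ (opMOdd R σa σs v) v := by
  rw [inner_opMKOdd, inner_opMOdd]
  linarith [inner_opK_self_nonneg H.g_mem H.scatter_nonneg (v : V R)]

/-- This is where oddness pays off: `𝒦 ≤ c g ℳ` on `𝕍⁻` instead of only `𝒦 ≤ c ℳ`. It accounts for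
the weight `(1 - c g)⁻¹` in `ℰ₀`. -/
theorem le_opMKOdd (v : VOdd R) :
    (1 - c * g) * inner ℝ (opMOdd R σa σs v) v ≤ inner ℝ (opMKOdd R σa σs g v) v := by
  rw [inner_opMKOdd, inner_opMOdd]
  linarith [inner_opK_self_le_of_odd H.g_mem H.scatter_nonneg H.ratio_le v.2]

theorem opMKOdd_self_nonneg (v : VOdd R) : 0 ≤ inner ℝ (opMKOdd R σa σs g v) v :=
  (mul_nonneg H.one_sub_mul_pos.le (H.opMOdd_self_nonneg v)).trans (H.le_opMKOdd v)

theorem isInvertible_opMOdd : (opMOdd R σa σs).IsInvertible :=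
  isInvertible_of_norm_sq_le_inner H.gamma_pos H.le_opMOdd

theorem isInvertible_opMKOdd : (opMKOdd R σa σs g).IsInvertible :=
  isInvertible_of_norm_sq_le_inner (mul_pos H.one_sub_mul_pos H.gamma_pos) fun v => by
    rw [mul_assoc]
    exact (mul_le_mul_of_nonneg_left (H.le_opMOdd v) H.one_sub_mul_pos.le).trans (H.le_opMKOdd v)

theorem inverse_opMOdd_le (v : VOdd R) :
    inner ℝ ((opMOdd R σa σs).inverse v) v ≤ inner ℝ ((opMKOdd R σa σs g).inverse v) v := by
  have := inner_inverse_le_of_inner_le one_pos H.isInvertible_opMKOdd H.isInvertible_opMOdd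
    (inner_opMKOdd_comm H.g_mem) H.opMKOdd_self_nonneg
    (fun x => by rw [one_mul]; exact H.opMKOdd_le x) v
  rwa [one_mul] at this

theorem inverse_opMKOdd_le (v : VOdd R) : inner ℝ ((opMKOdd R σa σs g).inverse v) v ≤
    (1 - c * g)⁻¹ * inner ℝ ((opMOdd R σa σs).inverse v) v :=
  inner_inverse_le_of_inner_le (inv_pos.2 H.one_sub_mul_pos) H.isInvertible_opMOdd
    H.isInvertible_opMKOdd inner_opMOdd_comm H.opMOdd_self_nonneg
    (fun x => by
      rw [← div_eq_inv_mul, le_div_iff₀ H.one_sub_mul_pos, mul_comm]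
      exact H.le_opMKOdd x) v

/-- Order reversal applied to `ℳ ≤ (‖ℳ‖ + 1) I`, so that `ℳ⁻¹` controls the full norm of `𝒜 w`. The
added `1` keeps the constant positive even if `ℳ` is zero on a trivial space. -/
theorem norm_sq_le_inverse_opMOdd (v : VOdd R) :
    ‖v‖ ^ 2 ≤ (‖opMOdd R σa σs‖ + 1) * inner ℝ ((opMOdd R σa σs).inverse v) v := by
  have := inner_inverse_le_of_inner_le (t := ‖opMOdd R σa σs‖ + 1) (by positivity)
    H.isInvertible_opMOdd (T := .id ℝ _) ⟨.refl ℝ _, rfl⟩ inner_opMOdd_comm H.opMOdd_self_nonneg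
    (fun x => by
      rw [ContinuousLinearMap.id_apply, real_inner_self_eq_norm_sq]
      refine (real_inner_le_norm _ _).trans ?_
      have := mul_le_mul_of_nonneg_right ((opMOdd R σa σs).le_opNorm x) (norm_nonneg x)
      nlinarith [sq_nonneg ‖x‖]) v
  rwa [ContinuousLinearMap.inverse_id, ContinuousLinearMap.id_apply,
    real_inner_self_eq_norm_sq] at this

theorem inverse_opMOdd_nonneg (v : VOdd R) : 0 ≤ inner ℝ ((opMOdd R σa σs).inverse v) v := by
  have h : 0 < ‖opMOdd R σa σs‖ + 1 := by positivity
  exact nonneg_of_mul_nonneg_right ((sq_nonneg _).trans (H.norm_sq_le_inverse_opMOdd v)) h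

theorem exists_norm_sq_le_opE : ∃ m, 0 < m ∧ ∀ w : WPlus R, m * ‖w‖ ^ 2 ≤ opE R σa σs g w w := by
  set κ := ‖opMOdd R σa σs‖ + 1 with hκ
  have hκ0 : 0 < κ := by positivity
  -- One entry for each part of the norm: `1` for the trace from `ℛ`, `κ⁻¹` for the streaming term
  -- through `(ℳ - 𝒦)⁻¹ ≥ ℳ⁻¹ ≥ κ⁻¹`, and `γ` for the `L²` part from `ℳ`.
  refine ⟨min 1 (min κ⁻¹ γ), lt_min one_pos (lt_min (inv_pos.2 hκ0) H.gamma_pos), fun w => ?_⟩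
  set m := min 1 (min κ⁻¹ γ) with hm
  have h1 : m ≤ 1 := min_le_left _ _
  have h2 : m ≤ κ⁻¹ := (min_le_right _ _).trans (min_le_left _ _)
  have h3 : m ≤ γ := (min_le_right _ _).trans (min_le_right _ _)
  have hm0 : 0 ≤ m := (lt_min one_pos (lt_min (inv_pos.2 hκ0) H.gamma_pos)).le
  have e1 : γ * ‖toV R w‖ ^ 2 ≤ inner ℝ (opM R σa σs (toV R w)) (toV R w) :=
    le_inner_opM H.scatter_nonneg H.absorb_le _
  have e2 := (H.norm_sq_le_inverse_opMOdd (transport R w)).trans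
    (mul_le_mul_of_nonneg_left (H.inverse_opMOdd_le (transport R w)) hκ0.le)
  rw [← div_le_iff₀' hκ0, div_eq_inv_mul] at e2
  have f1 := mul_le_mul_of_nonneg_right h3 (sq_nonneg ‖toV R w‖)
  have f2 := mul_le_mul_of_nonneg_right h2 (sq_nonneg ‖transport R w‖)
  have f3 := mul_le_mul_of_nonneg_right h1 (sq_nonneg ‖trace R w‖)
  have f4 := mul_nonneg hm0 (sq_nonneg ‖trace R w‖)
  rw [opE_apply, norm_sq_eq_WPlus, real_inner_self_eq_norm_sq]
  linarith

theorem opE_symm (v w : WPlus R) : opE R σa σs g v w = opE R σa σs g w v := by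
  rw [opE_apply, opE_apply, real_inner_comm, inner_inverse_symm H.isInvertible_opMKOdd
    (inner_opMKOdd_comm H.g_mem), inner_opM_comm, real_inner_comm _ (transport R v),
    real_inner_comm _ (toV R v)]

theorem opE0_symm (v w : WPlus R) : opE0 R σa σs g v w = opE0 R σa σs g w v := by
  rw [opE0_apply, opE0_apply, real_inner_comm (trace R v), inner_inverse_symm H.isInvertible_opMOdd
    inner_opMOdd_comm, inner_opM_comm, real_inner_comm _ (transport R v),
    real_inner_comm _ (toV R v)]

theorem opKEven_symm (v w : WPlus R) : opKEven R σs g v w = opKEven R σs g w v := by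
  rw [opKEven_apply, opKEven_apply, inner_opK_comm H.g_mem, real_inner_comm]

theorem opKEven_nonneg (w : WPlus R) : 0 ≤ opKEven R σs g w w :=
  inner_opK_self_nonneg H.g_mem H.scatter_nonneg _

theorem opKEven_le (w : WPlus R) :
    opKEven R σs g w w ≤ c * inner ℝ (opM R σa σs (toV R w)) (toV R w) :=
  inner_opK_self_le H.g_mem H.scatter_nonneg H.ratio_le _

theorem opE_le_opE0 (hc : c = albedo R σa σs) (w : WPlus R) :
    opE R σa σs g w w ≤ opE0 R σa σs g w w := by
  rw [opE_apply, opE0_apply, ← hc]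
  linarith [H.inverse_opMKOdd_le (transport R w)]

/-- It amounts to `𝒦 ≤ c ℰ`, which follows from `𝒦 ≤ c ℳ` since `ℛ` and the streaming term in `ℰ`
are nonnegative. -/
theorem mul_opE_le (w : WPlus R) :
    (1 - c) * opE R σa σs g w w ≤ opE R σa σs g w w - opKEven R σs g w w := by
  have h1 := H.opKEven_le w
  have h2 : inner ℝ (opM R σa σs (toV R w)) (toV R w) ≤ opE R σa σs g w w := by
    have := (H.inverse_opMOdd_nonneg (transport R w)).trans (H.inverse_opMOdd_le (transport R w))
    rw [opE_apply, real_inner_self_eq_norm_sq]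
    linarith [sq_nonneg ‖trace R w‖]
  linarith [mul_le_mul_of_nonneg_left h2 H.c_nonneg]

/-- The streaming terms compare through `(1 - c) (1 - c g)⁻¹ ≤ 1` and `ℳ⁻¹ ≤ (ℳ - 𝒦)⁻¹`, the mass
terms through `(1 - c) ℳ ≤ ℳ - 𝒦`, and the boundary terms through `c ≥ 0`. -/
theorem mul_opE0_le (hc : c = albedo R σa σs) (w : WPlus R) :
    (1 - c) * opE0 R σa σs g w w ≤ opE R σa σs g w w - opKEven R σs g w w := by
  have h1 := H.opKEven_le w
  have h2 : (1 - c) * (1 - c * g)⁻¹ ≤ 1 := by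
    rw [← div_eq_mul_inv, div_le_one H.one_sub_mul_pos]
    nlinarith [H.c_nonneg, H.g_mem.2]
  have h3 := mul_le_mul_of_nonneg_right h2 (H.inverse_opMOdd_nonneg (transport R w))
  have h4 := H.inverse_opMOdd_le (transport R w)
  rw [opE_apply, opE0_apply, ← hc, real_inner_self_eq_norm_sq]
  linarith [mul_nonneg H.c_nonneg (sq_nonneg ‖trace R w‖)]

end Admissible

end EvenParity

end RTE

/-! ### The preconditioned iteration with subspace correction -/

theorem RTE.existsUnique_isSweep {R : Opens RTE.E3} [CompleteSpace (RTE.WPlus R)]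
    {B : RTE.WPlus R →L[ℝ] StrongDual ℝ (RTE.WPlus R)} {C : ℝ} (hC : 0 < C)
    (h : ∀ w, C * ‖w‖ ^ 2 ≤ B w w) (P : StrongDual ℝ (RTE.WPlus R) →L[ℝ] RTE.WPlus R)
    (N : Submodule ℝ (RTE.WPlus R)) (hN : IsClosed (N : Set (RTE.WPlus R)))
    (ℓ : StrongDual ℝ (RTE.WPlus R)) (u : RTE.WPlus R) : ∃! u', RTE.IsSweep B P N ℓ u u' := by
  obtain ⟨d, hd, hu⟩ := existsUnique_galerkin hC h N hN (B (P (B u - ℓ)) - (B u - ℓ))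
  refine ⟨_, ⟨d, hd.1, hd.2, rfl⟩, ?_⟩
  rintro _ ⟨d', hd', he, rfl⟩
  rw [hu d' ⟨hd', he⟩]

/-- With `e = u - v`, the half step leaves the error `(I - Q⁻¹ B) e`, and the correction `d` is the
`B`-orthogonal projection of that error onto `N`. The factor `c` comes from the half step; the
projection does no harm. -/
theorem RTE.energyNorm_isSweep_le {R : Opens RTE.E3}
    {B Q : RTE.WPlus R →L[ℝ] StrongDual ℝ (RTE.WPlus R)} {c : ℝ}
    (hc0 : 0 ≤ c) (hc1 : c < 1) (hQ : Q.IsInvertible) (hQs : ∀ v w, Q v w = Q w v)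
    (hBs : ∀ v w, B v w = B w v) (hB0 : ∀ w, 0 ≤ B w w)
    (hle : ∀ w, (1 - c) * Q w w ≤ B w w ∧ B w w ≤ Q w w) {N : Submodule ℝ (RTE.WPlus R)}
    {ℓ : StrongDual ℝ (RTE.WPlus R)} {u v v' : RTE.WPlus R} (hu : B u = ℓ)
    (h : RTE.IsSweep B Q.inverse N ℓ v v') :
    RTE.energyNorm B (u - v') ≤ c * RTE.energyNorm B (u - v) := by
  obtain ⟨d, hd, hg, rfl⟩ := h
  set e := u - v with he
  have hr : B v - ℓ = -B e := by
    rw [← hu, he, map_sub]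
    abel
  rw [hr] at hg ⊢
  have h1 : u - (v - Q.inverse (-B e) + d) = (e - Q.inverse (B e)) - d := by
    rw [he, map_neg]
    abel
  -- The equation for the correction, tested with `d` itself: its right-hand side equals `B (e - Q⁻¹
  -- B e)`.
  have h2 : B ((e - Q.inverse (B e)) - d) d = 0 := by
    have := hg d hd
    simp only [map_sub, map_neg, sub_apply, neg_apply] at this ⊢
    linarith
  have h3 := energy_sub_le_of_orthogonal hBs hB0 h2
  have h4 := energy_sub_le_of_spectrally_equivalent hc0 hc1 hQ hQs hBs hB0 hle e
  rw [h1, RTE.energyNorm, RTE.energyNorm, ← Real.sqrt_sq hc0, ← Real.sqrt_mul (sq_nonneg c)]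
  exact Real.sqrt_le_sqrt (h3.trans h4)

/-! ### Spectral equivalence and convergence of the iteration -/

theorem lemma3p3 (R : Opens RTE.E3) (hne : (R : Set RTE.E3).Nonempty)
    (hconv : Convex ℝ (R : Set RTE.E3)) (hbdd : Bornology.IsBounded (R : Set RTE.E3))
    (σa σs : Lp ℝ ∞ ((volume : Measure RTE.E3).restrict (R : Set RTE.E3)))
    (hσs : ∀ᵐ r ∂(volume : Measure RTE.E3).restrict (R : Set RTE.E3), 0 ≤ σs r)
    (γ : ℝ) (hγ : 0 < γ)
    (hσa : ∀ᵐ r ∂(volume : Measure RTE.E3).restrict (R : Set RTE.E3), γ ≤ σa r)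
    (g : ℝ) (hg0 : 0 ≤ g) (hg1 : g < 1)
    (c : ℝ) (hc : c = RTE.albedo R σa σs)
    (B : RTE.WPlus R →L[ℝ] StrongDual ℝ (RTE.WPlus R))
    (hB : B = RTE.opE R σa σs g - RTE.opKEven R σs g)
    (Q : RTE.WPlus R →L[ℝ] StrongDual ℝ (RTE.WPlus R))
    (hQ : Q = RTE.opE R σa σs g ∨ Q = RTE.opE0 R σa σs g) :
    -- the inverses that occur in the definitions of `ℰ` and `ℰ₀` exist
    ((RTE.opMKOdd R σa σs g).IsInvertible ∧ (RTE.opMOdd R σa σs).IsInvertible) ∧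
    -- `Q = P₁⁻¹` for a symmetric positive definite operator `P₁ : (𝕎⁺)' → 𝕎⁺`
    (Q.IsInvertible ∧ (∀ v w, Q v w = Q w v) ∧ ∀ w, w ≠ 0 → 0 < Q w w) ∧
    -- spectral equivalence
    (∀ w, (1 - c) * Q w w ≤ B w w ∧ B w w ≤ Q w w) ∧
    -- `β = 1 - c` satisfies `0 < β ≤ 1`, and the generalized eigenvalues lie in `[β, 1]`
    (0 < 1 - c ∧ 1 - c ≤ 1) ∧
    (∀ (lam : ℝ) (w : RTE.WPlus R), w ≠ 0 → B w = lam • Q w → 1 - c ≤ lam ∧ lam ≤ 1) ∧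
    -- the iteration converges linearly with rate `1 - β = c`
    (∀ ℓ : StrongDual ℝ (RTE.WPlus R),
      (∃! u, B u = ℓ) ∧
      ∀ N : Submodule ℝ (RTE.WPlus R), IsClosed (N : Set (RTE.WPlus R)) →
        (∀ v, ∃! v', RTE.IsSweep B Q.inverse N ℓ v v') ∧
        ∀ u, B u = ℓ → ∀ un : ℕ → RTE.WPlus R,
          (∀ n, RTE.IsSweep B Q.inverse N ℓ (un n) (un (n + 1))) →
            ∀ n, RTE.energyNorm B (u - un (n + 1)) ≤ c * RTE.energyNorm B (u - un n)) := by
  -- The geometry of `R` enters only here: it makes the flux measure finite, hence `𝕎⁺` complete, as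
  -- Lax–Milgram requires.
  have : IsFiniteMeasure (RTE.fluxMeasure R) := RTE.isFiniteMeasure_fluxMeasure
    (RTE.euclideanHausdorffMeasure_frontier_lt_top R.isOpen hne hconv hbdd)
  have : CompleteSpace (RTE.WPlus R) := RTE.completeSpace_WPlus
  obtain ⟨hc0, hc1, hcr⟩ := RTE.albedo_spec hγ hσs hσa
  rw [← hc] at hc0 hc1 hcr
  have H : RTE.Admissible σa σs g γ c := ⟨⟨hg0, hg1⟩, hγ, hσs, hσa, hc0, hc1, hcr⟩
  obtain ⟨m, hm, hmE⟩ := H.exists_norm_sq_le_opE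
  have hBapp : ∀ v w, B v w = RTE.opE R σa σs g v w - RTE.opKEven R σs g v w := fun v w => by
    rw [hB]
    rfl
  have hEQ : ∀ w, RTE.opE R σa σs g w w ≤ Q w w := by
    rcases hQ with rfl | rfl
    · exact fun w => le_rfl
    · exact H.opE_le_opE0 hc
  have hQs : ∀ v w, Q v w = Q w v := by
    rcases hQ with rfl | rfl
    · exact H.opE_symm
    · exact H.opE0_symm
  have hQB : ∀ w, (1 - c) * Q w w ≤ B w w := by
    intro w
    rw [hBapp]
    rcases hQ with rfl | rfl
    · exact H.mul_opE_le w
    · exact H.mul_opE0_le hc w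
  have hBs : ∀ v w, B v w = B w v := fun v w => by
    rw [hBapp, hBapp, H.opE_symm, H.opKEven_symm]
  have hBQ : ∀ w, B w w ≤ Q w w := fun w => by
    rw [hBapp]
    linarith [H.opKEven_nonneg w, hEQ w]
  have hQm : ∀ w, m * ‖w‖ ^ 2 ≤ Q w w := fun w => (hmE w).trans (hEQ w)
  -- Coercivity of `B` is inherited from `Q` through the lower spectral bound; it gives solvability
  -- of `B u = ℓ` and of the Galerkin problem on every closed subspace.
  have hBm : ∀ w, (1 - c) * m * ‖w‖ ^ 2 ≤ B w w := fun w => by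
    rw [mul_assoc]
    exact (mul_le_mul_of_nonneg_left (hQm w) (sub_pos.2 hc1).le).trans (hQB w)
  have hm' : 0 < (1 - c) * m := mul_pos (sub_pos.2 hc1) hm
  have hB0 : ∀ w, 0 ≤ B w w := fun w => (mul_nonneg hm'.le (sq_nonneg _)).trans (hBm w)
  have hQ0 : ∀ w, w ≠ 0 → 0 < Q w w := fun w hw =>
    (mul_pos hm (pow_pos (norm_pos_iff.2 hw) 2)).trans_le (hQm w)
  have hQi : Q.IsInvertible := isInvertible_of_norm_sq_le hm hQm
  have hle : ∀ w, (1 - c) * Q w w ≤ B w w ∧ B w w ≤ Q w w := fun w => ⟨hQB w, hBQ w⟩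
  refine ⟨⟨H.isInvertible_opMKOdd, H.isInvertible_opMOdd⟩, ⟨hQi, hQs, hQ0⟩, hle,
    ⟨sub_pos.2 hc1, sub_le_self _ hc0⟩, fun lam w hw he => ?_, fun ℓ => ⟨?_, fun N hN =>
      ⟨fun v => RTE.existsUnique_isSweep hm' hBm _ N hN ℓ v, fun u hu un hun n =>
        RTE.energyNorm_isSweep_le hc0 hc1 hQi hQs hBs hB0 hle hu (hun n)⟩⟩⟩
  · have e : B w w = lam * Q w w := by
      rw [he]
      rfl
    have hpos := hQ0 w hw
    exact ⟨le_of_mul_le_mul_right (by linarith [hQB w]) hpos,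
      le_of_mul_le_mul_right (by linarith [hBQ w]) hpos⟩
  · exact (isInvertible_of_norm_sq_le hm' hBm).bijective.existsUnique ℓ
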